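/- **Setting.** Exponents $\alpha=(\alpha_1,\dots,\alpha_q)$ are reals $\ge 1$ with $\alpha_{\max}=\max_j\alpha_j>1$. A Bayesian generalized network design (BGND) problem $\mathcal P$ is given by a kind of requests. A request over a finite resource set $E$ is a bit string of length $\mathrm{poly}(|E|)$ that encodes a nonempty family of feasible actions, which are subsets of $E$. An instance consists of $N$ agents, a resource set $E$, for each agent $i$ a finite set $T_i$ of types with a probability distribution $p_i$ on it, for each type $t_i\in T_i$ a request with action family $A_i^{t_i}\subseteq 2^E$, and factors $\xi_{e,j}>0$; these define the cost functions $F_e(l)=\sum_{j=1}^q\xi_{e,j}\,l^{\alpha_j}$. An action profile $a$ costs $C(a)=\sum_{e}F_e(|\{i:e\in a_i\}|)$. A strategy profile $s$ maps each type $t_i$ of each agent $i$ to an action $s_i(t_i)\in A_i^{t_i}$; its cost is $C(s)=\mathbb E_{t\sim\prod_i p_i}[C(s(t))]$. For a type profile $t$ let $\mathtt{OPT}(t)=\min\{C(a): a_i\in A_i^{t_i}\ \forall i\}$. The Bayesian competitive ratio (BCR) of an algorithm, for given exponents, is the smallest $\beta\ge1$ such that on every instance of $\mathcal P$ with these exponents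 the constructed profile satisfies $C(s)\le\beta\,\mathbb E_t[\mathtt{OPT}(t)]$. An action $\varrho$-oracle $\mathcal O$ for $\mathcal P$ answers a request and a weight vector $w\in\mathbb R_{\ge0}^E$ with a feasible action whose weight is at most $\varrho$ times the weight of any feasible action. **Bayes-ABRD** with access to $\mathcal O$ and parameters $\eta$ (depending on $\alpha_{\max}$) and $R$ (depending on $\alpha_{\max}$ and $N$) works as follows. Initially, $s_i(t_i)$ is the answer of $\mathcal O$ for $t_i$ and the weights $\sum_j\xi_{e,j}$. In each of $R$ rounds, with $$\hat f_{i,e}=\sum_j\xi_{e,j}\Bigl[1+\sum_{i'\ne i}\Pr_{t_{i'}\sim p_{i'}}[e\in s_{i'}(t_{i'})]\Bigr]^{\alpha_j-1},\qquad \hat C_i(b)=\mathbb E_{t_i\sim p_i}\Bigl[\sum_{e\in b(t_i)}\hat f_{i,e}\Bigr],$$ let $\hat s_i(t_i)$ be the answer of $\mathcal O$ for $t_i$ and the weights $\hat f_{i,\cdot}$, and let $\Delta_i=\hat C_i(s_i)-\eta\,\hat C_i(\hat s_i)$. The agent $i$ of smallest index with $\Delta_i>0$ and $\Delta_i\ge\frac1N\sum_{i'}\Delta_{i'}$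 switches from $s_i$ to $\hat s_i$; if there is none, the dynamics has converged and $s$ no longer changes. The profile after $R$ rounds is the output. **Theorem.** The parameters $\eta,R$ can be chosen, together with a function $c$ of $\alpha_{\max}$ alone, such that the following holds for every BGND problem $\mathcal P$, every $\varrho\ge1$ and every action $\varrho$-oracle $\mathcal O$ for $\mathcal P$. 1. Bayes-ABRD with access to $\mathcal O$ outputs a strategy profile on every instance, and for all exponents $\alpha$ its BCR is at most $c(\alpha_{\max})\,\varrho^{\alpha_{\max}}$. Thus the BCR is bounded in terms of the exponents (and $\varrho$) only, independently of $N$, $E$, the $T_i$, the $p_i$ and the $\xi_{e,j}$. 2. Bayes-ABRD is fully combinatorial and runs in strongly polynomial time given access to $\mathcal O$. That is, one program, the same for all $\mathcal P,\varrho,\mathcal O$ and all exponents, computes this output using only index manipulation, the operations $+,-,\times,/,\le$ and $x\mapsto x^{\alpha_j}$ on real numbers, and queries to $\mathcal O$. Its number of steps is at most $\kappa(\alpha_{\max})\,n^d$, where $n=N+|E|+q+\sum_i|T_i|+1$. Whenever the $\alpha_j$ are integers and all $p_i(t_i)$ and $\xi_{e,j}$ are rationals of encoding length at most $L$, all numbers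 computed have encoding length at most $\kappa(\alpha_{\max})\,(n+L)^d$. The constant $d$ is absolute, and $\kappa$ depends on $\alpha_{\max}$ only. 3. Hence, if $\mathcal O$ can be implemented to run in strongly polynomial time (in $|E|$ and the length of the request), then the same output can be computed, without an oracle, in strongly polynomial time from the instance together with the encodings of its requests. -/

import Mathlib

noncomputable section

namespace BGND

open scoped ENNReal

/-! ## Bayesian generalized network design -/

/-- Load exponents `α₁, …, α_q ≥ 1`, at least one of which exceeds `1`. -/
structure Exponents where
  q : ℕ
  α : Fin q → ℝ
  one_le : ∀ j, 1 ≤ α j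
  exists_one_lt : ∃ j, 1 < α j

/-- The largest exponent (the index set is finite and nonempty). -/
def Exponents.max (X : Exponents) : ℝ := ⨆ j, X.α j

/-- A BGND problem is given by its kind of requests: a bit string `r` encodes, over the
resource set `Fin m`, the set `actions m r` of feasible actions; `r` is a request over `Fin m` when
this set is nonempty. Requests are succinctly represented: their length is polynomial in `m`. -/
structure Problem where
  actions : (m : ℕ) → List Bool → Finset (Finset (Fin m))
  succinct : ∃ d : ℕ, ∀ m r, (actions m r).Nonempty → r.length ≤ d * (m + 1) ^ d

/-- An instance of the problem `P` with the exponents `X`: `N` agents, the resources `Fin m`, for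
agent `i` the types `Fin (numTypes i)`, each with its request, a prior distribution on these types,
and positive factors `ξ e j`. -/
structure Instance (P : Problem) (X : Exponents) where
  N : ℕ
  m : ℕ
  numTypes : Fin N → ℕ
  req : (i : Fin N) → Fin (numTypes i) → List Bool
  req_valid : ∀ i t, (P.actions m (req i t)).Nonempty
  prob : (i : Fin N) → Fin (numTypes i) → ℝ
  prob_nonneg : ∀ i t, 0 ≤ prob i t
  prob_sum : ∀ i, ∑ t, prob i t = 1
  ξ : Fin m → Fin X.q → ℝ
  ξ_pos : ∀ e j, 0 < ξ e j

namespace Instance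

variable {P : Problem} {X : Exponents} (I : Instance P X)

/-- The feasible actions of type `t` of agent `i`. -/
def act (i : Fin I.N) (t : Fin (I.numTypes i)) : Finset (Finset (Fin I.m)) :=
  P.actions I.m (I.req i t)

/-- Type profiles. -/
abbrev TypeProfile : Type := (i : Fin I.N) → Fin (I.numTypes i)

/-- The product prior. -/
def prior (t : I.TypeProfile) : ℝ := ∏ i, I.prob i (t i)

/-- Expectation over the product prior. -/
def expect (f : I.TypeProfile → ℝ) : ℝ := ∑ t, I.prior t * f t

/-- The cost function `F_e(l) = ∑ j, ξ_{e,j} l ^ α_j`. -/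
def resourceCost (e : Fin I.m) (l : ℝ) : ℝ := ∑ j, I.ξ e j * l ^ X.α j

/-- The number of agents whose action contains `e`. -/
def load (a : Fin I.N → Finset (Fin I.m)) (e : Fin I.m) : ℕ :=
  (Finset.univ.filter fun i => e ∈ a i).card

/-- The cost of an action profile. -/
def cost (a : Fin I.N → Finset (Fin I.m)) : ℝ := ∑ e, I.resourceCost e (I.load a e)

/-- `OPT(t)`: the minimum cost of an action profile that is feasible for `t`
(a minimum over a nonempty finite set). -/
def opt (t : I.TypeProfile) : ℝ :=
  ⨅ a : (i : Fin I.N) → {b : Finset (Fin I.m) // b ∈ I.act i (t i)}, I.cost fun i => (a i).1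

/-- A tuple of maps from the types of each agent to sets of resources. -/
abbrev Profile : Type := (i : Fin I.N) → Fin (I.numTypes i) → Finset (Fin I.m)

/-- `s` is a strategy profile: it maps every type to a feasible action of that type. -/
def IsStrategy (s : I.Profile) : Prop := ∀ i t, s i t ∈ I.act i t

/-- The total (expected) cost `C(s)`. -/
def socialCost (s : I.Profile) : ℝ := I.expect fun t => I.cost fun i => s i (t i)

/-- The expected optimum `𝔼[OPT(t)]`. -/
def expectedOpt : ℝ := I.expect I.opt

/-- The number of numbers of which the instance consists, up to a polynomial. -/
def size : ℕ := I.N + I.m + X.q + (∑ i, I.numTypes i) + 1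

end Instance

/-- A map that constructs a profile for every instance of `P`. -/
abbrev Problem.Algorithm (P : Problem) : Type := (X : Exponents) → (I : Instance P X) → I.Profile

/-- The Bayesian competitive ratio, over the instances with exponents `X`: the smallest `β ≥ 1` such
that `C(s) ≤ β · 𝔼[OPT]` on every instance (`∞` if there is none). -/
def Problem.bcr (P : Problem) (alg : P.Algorithm) (X : Exponents) : ℝ≥0∞ :=
  sInf (ENNReal.ofReal ''
    {β : ℝ | 1 ≤ β ∧ ∀ I : Instance P X, I.socialCost (alg X I) ≤ β * I.expectedOpt})

/-- The input-output behaviour of a procedure that answers a request and a weight vector with a set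
of resources. -/
abbrev ActionProcedure : Type :=
  (m : ℕ) → List Bool → (Fin m → ℝ) → Finset (Fin m)

/-- `O` is an action `ρ`-oracle for `P`. -/
def Problem.IsActionOracle (P : Problem) (ρ : ℝ) (O : ActionProcedure) : Prop :=
  ∀ m r, (P.actions m r).Nonempty → ∀ w : Fin m → ℝ, (∀ e, 0 ≤ w e) →
    O m r w ∈ P.actions m r ∧
      ∀ a ∈ P.actions m r, ∑ e ∈ O m r w, w e ≤ ρ * ∑ e ∈ a, w e

/-! ## The approximate best response dynamics `Bayes-ABRD` -/

namespace Instance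

variable {P : Problem} {X : Exponents} (I : Instance P X)

/-- The estimation of the expected cost share of agent `i` on a resource `e` of her action:
`∑ j, ξ_{e,j} (1 + ∑_{i' ≠ i} Pr[e ∈ s_{i'}(t_{i'})]) ^ (α_j - 1)`. -/
def shareEst (s : I.Profile) (i : Fin I.N) (e : Fin I.m) : ℝ :=
  ∑ j, I.ξ e j *
    (1 + ∑ i' ∈ Finset.univ.erase i, ∑ t, if e ∈ s i' t then I.prob i' t else 0) ^ (X.α j - 1)

/-- The estimated individual cost of agent `i` when she plays `b` against `s_{-i}`. -/
def costEst (s : I.Profile) (i : Fin I.N) (b : Fin (I.numTypes i) → Finset (Fin I.m)) : ℝ :=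
  ∑ t, I.prob i t * ∑ e ∈ b t, I.shareEst s i e

/-- The approximate best response of agent `i` that the oracle computes. -/
def response (O : ActionProcedure) (s : I.Profile) : I.Profile :=
  fun i t => O I.m (I.req i t) (I.shareEst s i)

/-- The estimated improvement `Δ_i`; the parameter `η` is the product of the two factors of the
estimation. -/
def gain (O : ActionProcedure) (η : ℝ) (s : I.Profile) (i : Fin I.N) : ℝ :=
  I.costEst s i (s i) - η * I.costEst s i (I.response O s i)

open scoped Classical in
/-- The agents who are eligible for an update. There is one unless `Δ_i ≤ 0` for all `i`. -/
def eligible (O : ActionProcedure) (η : ℝ) (s : I.Profile) : Finset (Fin I.N) :=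
  Finset.univ.filter fun i =>
    0 < I.gain O η s i ∧ (1 / (I.N : ℝ)) * ∑ i', I.gain O η s i' ≤ I.gain O η s i

open scoped Classical in
/-- One round: the eligible agent of smallest index, if any, switches to her response. -/
def round (O : ActionProcedure) (η : ℝ) (s : I.Profile) : I.Profile :=
  if h : (I.eligible O η s).Nonempty then
    Function.update s ((I.eligible O η s).min' h) (I.response O s ((I.eligible O η s).min' h))
  else s

/-- The initial profile: every agent acts as if she were alone. -/
def initial (O : ActionProcedure) : I.Profile :=
  fun i t => O I.m (I.req i t) fun e => ∑ j, I.ξ e j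

end Instance

/-- `Bayes-ABRD` with access to `O`. Its parameters are chosen from the largest exponent and, for
the number `R` of rounds, the number of agents. A round changes nothing after convergence. -/
def bayesABRD (P : Problem) (O : ActionProcedure) (η : ℝ → ℝ) (R : ℝ → ℕ → ℕ) : P.Algorithm :=
  fun X I => (I.round O (η X.max))^[R X.max I.N] (I.initial O)

/-! ## The machine model

Programs work on index registers and index arrays with entries in `ℕ`, and on real registers and
real arrays. Arrays have three dimensions. Indices can only be copied, incremented, decremented and
compared; reals can be added, subtracted, multiplied, divided, compared, and raised to a power `α_j`.
The only other primitive is a query to the action oracle. -/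

structure Store where
  n : ℕ → ℕ
  r : ℕ → ℝ
  na : ℕ → ℕ → ℕ → ℕ → ℕ
  ra : ℕ → ℕ → ℕ → ℕ → ℝ

namespace Store

def setN (σ : Store) (x v : ℕ) : Store := { σ with n := Function.update σ.n x v }

def setR (σ : Store) (x : ℕ) (v : ℝ) : Store := { σ with r := Function.update σ.r x v }

def setNA (σ : Store) (a i j k v : ℕ) : Store :=
  { σ with na := fun a' i' j' k' =>
      if a' = a ∧ i' = i ∧ j' = j ∧ k' = k then v else σ.na a' i' j' k' }

def setRA (σ : Store) (a i j k : ℕ) (v : ℝ) : Store :=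
  { σ with ra := fun a' i' j' k' =>
      if a' = a ∧ i' = i ∧ j' = j ∧ k' = k then v else σ.ra a' i' j' k' }

/-- Write the indicator of `b` to the entries `(e, 0, 0)`, `e < m`, of the index array `a`. -/
def setSet (σ : Store) (a : ℕ) {m : ℕ} (b : Finset (Fin m)) : Store :=
  { σ with na := fun a' i' j' k' =>
      if h : a' = a ∧ i' < m ∧ j' = 0 ∧ k' = 0 then (if (⟨i', h.2.1⟩ : Fin m) ∈ b then 1 else 0)
      else σ.na a' i' j' k' }

end Store

inductive ArithOp
  | add | sub | mul | div

/-- Instructions; all arguments but the constants `v` are names of registers or arrays. -/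
inductive Instr
  | nconst (x v : ℕ)
  | ncopy (x y : ℕ)
  | nsucc (x : ℕ)
  | npred (x : ℕ)
  | nload (x a i j k : ℕ)
  | nstore (a i j k x : ℕ)
  | rconst (x v : ℕ)
  | rcopy (x y : ℕ)
  | rop (o : ArithOp) (z x y : ℕ)
  | rpow (z x j : ℕ)
  | rload (x a i j k : ℕ)
  | rstore (a i j k x : ℕ)
  | query (i t w b : ℕ)

/-- Programs. The tests are `r x ≤ r y` for `ifR`, and `n x < n y` for `ifN` and `whileN`. -/
inductive Cmd
  | skip
  | instr (c : Instr)
  | seq (p p' : Cmd)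
  | ifR (x y : ℕ) (p p' : Cmd)
  | ifN (x y : ℕ) (p p' : Cmd)
  | whileN (x y : ℕ) (p : Cmd)

/-- The primitives besides arithmetic: the exponents to which reals can be raised, and the answers
to oracle queries (agent, type, weights); `none` means that the query is not legal. -/
structure Env where
  q : ℕ
  α : Fin q → ℝ
  m : ℕ
  query : ℕ → ℕ → (Fin m → ℝ) → Option (Finset (Fin m))

/-- The length of the binary encoding of a rational number. -/
def ratLen (x : ℚ) : ℕ := x.num.natAbs.size + x.den.size + 1

open scoped Classical in
/-- The encoding length of a real number that is rational. (Irrational numbers get `0`; they do not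
occur in runs on rational inputs with integral exponents, the only ones where this is used.) -/
def bitLen (x : ℝ) : ℕ := if h : ∃ y : ℚ, (y : ℝ) = x then ratLen h.choose else 0

open scoped Classical in
/-- The arithmetic operations; division by zero is not legal. -/
def ArithOp.eval : ArithOp → ℝ → ℝ → Option ℝ
  | .add, x, y => some (x + y)
  | .sub, x, y => some (x - y)
  | .mul, x, y => some (x * y)
  | .div, x, y => if y = 0 then none else some (x / y)

open scoped Classical in
/-- The effect of an instruction: the new store, and the encoding length of the real number written;
`none` if the instruction is not legal. -/
def Instr.run (E : Env) (σ : Store) : Instr → Option (Store × ℕ)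
  | .nconst x v => some (σ.setN x v, 0)
  | .ncopy x y => some (σ.setN x (σ.n y), 0)
  | .nsucc x => some (σ.setN x (σ.n x + 1), 0)
  | .npred x => some (σ.setN x (σ.n x - 1), 0)
  | .nload x a i j k => some (σ.setN x (σ.na a (σ.n i) (σ.n j) (σ.n k)), 0)
  | .nstore a i j k x => some (σ.setNA a (σ.n i) (σ.n j) (σ.n k) (σ.n x), 0)
  | .rconst x v => some (σ.setR x v, bitLen v)
  | .rcopy x y => some (σ.setR x (σ.r y), bitLen (σ.r y))
  | .rop o z x y => (o.eval (σ.r x) (σ.r y)).map fun v => (σ.setR z v, bitLen v)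
  | .rpow z x j =>
      if h : σ.n j < E.q ∧ 0 ≤ σ.r x then
        some (σ.setR z (σ.r x ^ E.α ⟨σ.n j, h.1⟩), bitLen (σ.r x ^ E.α ⟨σ.n j, h.1⟩))
      else none
  | .rload x a i j k =>
      some (σ.setR x (σ.ra a (σ.n i) (σ.n j) (σ.n k)), bitLen (σ.ra a (σ.n i) (σ.n j) (σ.n k)))
  | .rstore a i j k x =>
      some (σ.setRA a (σ.n i) (σ.n j) (σ.n k) (σ.r x), bitLen (σ.r x))
  | .query i t w b =>
      (E.query (σ.n i) (σ.n t) fun e => σ.ra w e 0 0).map fun s => (σ.setSet b s, 0)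

/-- An instruction takes one step; for a query, `m` more are charged for the answer. -/
def Instr.time (E : Env) : Instr → ℕ
  | .query _ _ _ _ => E.m + 1
  | _ => 1

/-- `Exec E p σ σ' t b`: the program `p`, started in `σ`, halts in `σ'` after `t` steps, and all real
numbers written meanwhile have encoding length at most `b` (`b` is the largest such length). A
program that attempts an illegal instruction does not halt. -/
inductive Exec (E : Env) : Cmd → Store → Store → ℕ → ℕ → Prop
  | skip (σ) : Exec E .skip σ σ 1 0
  | instr {c σ σ' b} : c.run E σ = some (σ', b) → Exec E (.instr c) σ σ' (c.time E) b
  | seq {p p' σ σ' σ'' t t' b b'} : Exec E p σ σ' t b → Exec E p' σ' σ'' t' b' →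
      Exec E (.seq p p') σ σ'' (t + t') (max b b')
  | ifR_true {x y p p' σ σ' t b} : σ.r x ≤ σ.r y → Exec E p σ σ' t b →
      Exec E (.ifR x y p p') σ σ' (t + 1) b
  | ifR_false {x y p p' σ σ' t b} : ¬ σ.r x ≤ σ.r y → Exec E p' σ σ' t b →
      Exec E (.ifR x y p p') σ σ' (t + 1) b
  | ifN_true {x y p p' σ σ' t b} : σ.n x < σ.n y → Exec E p σ σ' t b →
      Exec E (.ifN x y p p') σ σ' (t + 1) b
  | ifN_false {x y p p' σ σ' t b} : ¬ σ.n x < σ.n y → Exec E p' σ σ' t b →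
      Exec E (.ifN x y p p') σ σ' (t + 1) b
  | while_true {x y p σ σ' σ'' t t' b b'} : σ.n x < σ.n y → Exec E p σ σ' t b →
      Exec E (.whileN x y p) σ' σ'' t' b' →
      Exec E (.whileN x y p) σ σ'' (t + t' + 1) (max b b')
  | while_false {x y p σ} : ¬ σ.n x < σ.n y → Exec E (.whileN x y p) σ σ 1 0

/-! ## Strongly polynomial time -/

/-- `x` is a rational number of encoding length at most `L`. -/
def RationalOfLength (L : ℕ) (x : ℝ) : Prop := ∃ y : ℚ, (y : ℝ) = x ∧ ratLen y ≤ L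

namespace Instance

variable {P : Problem} {X : Exponents} (I : Instance P X)

/-- The numerical data of the instance stand in the input cells of `σ`. Nothing is assumed on the
other cells. -/
def Loaded (σ : Store) : Prop :=
  σ.n 0 = I.N ∧ σ.n 1 = I.m ∧ σ.n 2 = X.q ∧
  (∀ i : Fin I.N, σ.na 0 i 0 0 = I.numTypes i) ∧
  (∀ (i : Fin I.N) (t : Fin (I.numTypes i)), σ.ra 0 i t 0 = I.prob i t) ∧
  (∀ (e : Fin I.m) (j : Fin X.q), σ.ra 1 e j 0 = I.ξ e j) ∧
  (∀ j : Fin X.q, σ.ra 2 j 0 0 = X.α j)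

/-- The encodings of the requests stand in the input cells of `σ`. -/
def RequestsLoaded (σ : Store) : Prop :=
  ∀ (i : Fin I.N) (t : Fin (I.numTypes i)), σ.na 1 i t 0 = (I.req i t).length ∧
    ∀ k : Fin (I.req i t).length, σ.na 2 i t k = ((I.req i t).get k).toNat

/-- The indicator of the profile `s` stands in the output cells of `σ`. -/
def Outputs (σ : Store) (s : I.Profile) : Prop :=
  ∀ (i : Fin I.N) (t : Fin (I.numTypes i)) (e : Fin I.m), σ.na 3 i t e = if e ∈ s i t then 1 else 0

/-- The factors and the probabilities are rational of encoding length at most `L`, and the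
exponents are integers. -/
def RationalOfLength (L : ℕ) : Prop :=
  (∀ i t, BGND.RationalOfLength L (I.prob i t)) ∧ (∀ e j, BGND.RationalOfLength L (I.ξ e j)) ∧
  ∀ j, ∃ k : ℕ, X.α j = k

open scoped Classical in
/-- Access to the procedure `O`, which may be asked about a type of an agent and nonnegative
weights. -/
def oracleEnv (O : ActionProcedure) : Env where
  q := X.q
  α := X.α
  m := I.m
  query i t w :=
    if h : ∃ hi : i < I.N, t < I.numTypes ⟨i, hi⟩ then
      if ∀ e, 0 ≤ w e then some (O I.m (I.req ⟨i, h.1⟩ ⟨t, h.2⟩) w) else none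
    else none

/-- No oracle. -/
def plainEnv : Env where
  q := X.q
  α := X.α
  m := I.m
  query _ _ _ := none

end Instance

/-- Started with the numerical data of any instance of `P` in the memory, and with access to `O`, the
program `F` outputs what `alg` prescribes, in strongly polynomial time: the number of steps is
polynomial in the number of numbers in the input (with a coefficient depending on the largest
exponent), and on rational inputs with integral exponents the encoding lengths of all
numbers computed are polynomial in the size of the input. -/
def Problem.OracleComputes (P : Problem) (O : ActionProcedure) (F : Cmd) (alg : P.Algorithm)
    (κ : ℝ → ℕ) (d : ℕ) : Prop :=
  ∀ (X : Exponents) (I : Instance P X) (σ : Store), I.Loaded σ →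
    ∃ σ' time bits, Exec (I.oracleEnv O) F σ σ' time bits ∧ I.Outputs σ' (alg X I) ∧
      time ≤ κ X.max * I.size ^ d ∧
      ∀ L, I.RationalOfLength L → bits ≤ κ X.max * (I.size + L) ^ d

/-- The same without an oracle, but with the encodings of the requests in the memory. -/
def Problem.Computes (P : Problem) (G : Cmd) (alg : P.Algorithm) (κ : ℝ → ℕ) (d : ℕ) : Prop :=
  ∀ (X : Exponents) (I : Instance P X) (σ : Store), I.Loaded σ → I.RequestsLoaded σ →
    ∃ σ' time bits, Exec I.plainEnv G σ σ' time bits ∧ I.Outputs σ' (alg X I) ∧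
      time ≤ κ X.max * I.size ^ d ∧
      ∀ L, I.RationalOfLength L → bits ≤ κ X.max * (I.size + L) ^ d

/-- Neither powers nor an oracle. -/
def bareEnv : Env where
  q := 0
  α := Fin.elim0
  m := 0
  query _ _ _ := none

/-- The procedure `O` can be implemented, on the requests of `P` and nonnegative weights, to run in
strongly polynomial time. -/
def Problem.StronglyPolynomialProcedure (P : Problem) (O : ActionProcedure) : Prop :=
  ∃ (D : Cmd) (c d : ℕ), ∀ (m : ℕ) (r : List Bool) (w : Fin m → ℝ) (σ : Store),
    (P.actions m r).Nonempty → (∀ e, 0 ≤ w e) →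
    σ.n 0 = m → σ.n 1 = r.length → (∀ k : Fin r.length, σ.na 0 k 0 0 = (r.get k).toNat) →
    (∀ e : Fin m, σ.ra 0 e 0 0 = w e) →
    ∃ σ' time bits, Exec bareEnv D σ σ' time bits ∧
      (∀ e : Fin m, σ'.na 1 e 0 0 = if e ∈ O m r w then 1 else 0) ∧
      time ≤ c * (m + r.length + 1) ^ d ∧
      ∀ L, (∀ e, RationalOfLength L (w e)) → bits ≤ c * (m + r.length + L + 1) ^ d

end BGND

end

/-!
**The competitive ratio.** Let `μ_e` be the expected load of the resource `e` under a strategy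
profile. The dynamics decreases the potential `Φ = ∑_e ∑_j ξ_{e,j} ((1 + μ_e) ^ α_j - 1) / α_j`,
which by convexity lies between `Ψ / α_max` and `Ψ`, where
`Ψ = ∑_e ∑_j ξ_{e,j} μ_e (1 + μ_e) ^ (α_j - 1)` (`proxyCost`). Three facts carry the proof.

* `Ψ` bounds the social cost up to a factor depending on `α_max` (`socialCost_le_proxyCost`).
  Indeed, drawing the type of one agent anew preserves expectations and changes a load by at most
  one, so that the moments of a load are controlled by its mean (`expect_loadAt_mul_le`).
* Convexity again: when agent `i` switches from `s_i` to `b`, the potential grows by at most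
  `2 ^ α_max * Ĉ_i(b) - Ĉ_i(s_i)` (`potential_update_le`). With `η = 2 ^ α_max`, a switch decreases
  it at least by the estimated gain of the agent, hence by the average of all estimated gains.
* A smoothness inequality compares the answers of the oracle with the actions that are optimal for
  the realized type profile. It follows that `Ψ` is at most `c ρ ^ α_max E[OPT]` plus a multiple of
  the sum of the gains (`proxyCost_le_gain`).

So as long as the potential exceeds `c ρ ^ α_max E[OPT]`, a round shrinks the excess by the factor
`1 - 1 / (2 ^ (α_max + 1) N)`. The initial profile is a `ρ (1 + N) ^ (α_max - 1)`-approximation in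
terms of `Ψ`, and `N² ⌈2 ^ α_max⌉²` rounds contract this to a constant (`socialCost_bayesABRD_le`).

**The program.** It is written with a parameter, the command `ask` that answers a query, and a
`Setting` collects what is assumed about this command. Correctness is proved in a Hoare style: `Run`
states that a program halts within given bounds on time and encoding lengths in a store with a given
property, and what a program leaves unchanged is read off its text (`Exec.frame`). Each number
computed is one of the quantities occurring in the dynamics, a partial sum of these, or a counter,
so encoding lengths follow from the definitions of these quantities and do not accumulate over the
rounds. Taking a single query instruction for `ask` gives the program with oracle access. For the
program without an oracle, `ask` copies the request and the weights to a part of the memory which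
the dynamics does not use, and runs there the given implementation of the oracle with all registers
renamed (`Exec.shift`).
-/

noncomputable section

namespace BGND

open scoped ENNReal

/-! ### Expectations over independent types -/

namespace Instance

variable {P : Problem} {X : Exponents} (I : Instance P X)

theorem prior_nonneg (t : I.TypeProfile) : 0 ≤ I.prior t :=
  Finset.prod_nonneg fun i _ => I.prob_nonneg i (t i)

theorem sum_prior : ∑ t, I.prior t = 1 := by
  unfold prior
  rw [← Fintype.prod_sum]
  simp [I.prob_sum]

theorem expect_mono {f g : I.TypeProfile → ℝ} (h : ∀ t, f t ≤ g t) : I.expect f ≤ I.expect g :=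
  Finset.sum_le_sum fun t _ => mul_le_mul_of_nonneg_left (h t) (I.prior_nonneg t)

theorem expect_nonneg {f : I.TypeProfile → ℝ} (h : ∀ t, 0 ≤ f t) : 0 ≤ I.expect f :=
  Finset.sum_nonneg fun t _ => mul_nonneg (I.prior_nonneg t) (h t)

theorem expect_const (c : ℝ) : I.expect (fun _ => c) = c := by
  simp [expect, ← Finset.sum_mul, I.sum_prior]

theorem expect_add (f g : I.TypeProfile → ℝ) :
    I.expect (fun t => f t + g t) = I.expect f + I.expect g := by
  simp [expect, mul_add, Finset.sum_add_distrib]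

theorem expect_mul_left (c : ℝ) (f : I.TypeProfile → ℝ) :
    I.expect (fun t => c * f t) = c * I.expect f := by
  simp only [expect, Finset.mul_sum]
  exact Finset.sum_congr rfl fun t _ => by ring

theorem expect_sum {ι : Type*} (s : Finset ι) (f : ι → I.TypeProfile → ℝ) :
    I.expect (fun t => ∑ i ∈ s, f i t) = ∑ i ∈ s, I.expect (f i) := by
  simp only [expect, Finset.mul_sum]
  exact Finset.sum_comm

/-- Drawing the type of one agent anew does not change an expectation. This is the only form in
which the independence of the types is used; it holds because exchanging the old type and the new
one is a measure preserving involution. -/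
theorem expect_resample (i : Fin I.N) (f : I.TypeProfile → ℝ) :
    I.expect (fun t => ∑ u, I.prob i u * f (Function.update t i u)) = I.expect f := by
  have key : ∀ (t : I.TypeProfile) (u : Fin (I.numTypes i)),
      I.prior (Function.update t i u) * I.prob i (t i) = I.prior t * I.prob i u := by
    intro t u
    unfold prior
    rw [← Finset.mul_prod_erase Finset.univ (fun j => I.prob j (t j)) (Finset.mem_univ i),
      ← Finset.mul_prod_erase Finset.univ (fun j => I.prob j (Function.update t i u j))
        (Finset.mem_univ i)]
    have : ∏ x ∈ Finset.univ.erase i, I.prob x (Function.update t i u x)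
        = ∏ x ∈ Finset.univ.erase i, I.prob x (t x) :=
      Finset.prod_congr rfl fun x hx => by
        rw [Function.update_of_ne (Finset.ne_of_mem_erase hx)]
    rw [this, Function.update_self]
    ring
  let F : I.TypeProfile × Fin (I.numTypes i) → I.TypeProfile × Fin (I.numTypes i) :=
    fun x => (Function.update x.1 i x.2, x.1 i)
  have hF : Function.Involutive F := by
    rintro ⟨t, u⟩
    simp [F]
  have h1 : I.expect (fun t => ∑ u, I.prob i u * f (Function.update t i u))
      = ∑ x : I.TypeProfile × Fin (I.numTypes i), I.prior x.1 * I.prob i x.2 * f (F x).1 := by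
    rw [Fintype.sum_prod_type]
    simp only [expect, Finset.mul_sum, F, mul_assoc]
  have h2 : I.expect f
      = ∑ x : I.TypeProfile × Fin (I.numTypes i), I.prior x.1 * I.prob i x.2 * f x.1 := by
    rw [Fintype.sum_prod_type]
    refine Finset.sum_congr rfl fun t _ => ?_
    dsimp only
    rw [← Finset.sum_mul, ← Finset.mul_sum, I.prob_sum, mul_one]
  rw [h1, h2, ← Equiv.sum_comp hF.toPerm]
  refine Finset.sum_congr rfl fun x _ => ?_
  rw [Function.Involutive.coe_toPerm, hF x]
  have := key x.1 x.2
  simp only [F]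
  rw [this]

theorem expect_marginal (i : Fin I.N) (h : Fin (I.numTypes i) → ℝ) :
    I.expect (fun t => h (t i)) = ∑ u, I.prob i u * h u := by
  rw [← I.expect_resample i]
  simp [I.expect_const]

/-! ### Expected loads -/

/-- The probability that the action of agent `i` contains `e`, when she plays `b`. -/
def hit (i : Fin I.N) (b : Fin (I.numTypes i) → Finset (Fin I.m)) (e : Fin I.m) : ℝ :=
  ∑ t, if e ∈ b t then I.prob i t else 0

/-- The expected load of `e`. -/
def meanLoad (s : I.Profile) (e : Fin I.m) : ℝ := ∑ i, I.hit i (s i) e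

theorem hit_nonneg (i : Fin I.N) (b : Fin (I.numTypes i) → Finset (Fin I.m)) (e : Fin I.m) :
    0 ≤ I.hit i b e :=
  Finset.sum_nonneg fun t _ => by split_ifs <;> simp [I.prob_nonneg]

theorem hit_le_one (i : Fin I.N) (b : Fin (I.numTypes i) → Finset (Fin I.m)) (e : Fin I.m) :
    I.hit i b e ≤ 1 := by
  rw [← I.prob_sum i]
  exact Finset.sum_le_sum fun t _ => by split_ifs <;> simp [I.prob_nonneg]

theorem hit_eq (i : Fin I.N) (b : Fin (I.numTypes i) → Finset (Fin I.m)) (e : Fin I.m) :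
    I.hit i b e = ∑ t, I.prob i t * if e ∈ b t then 1 else 0 := by
  simp [hit]

theorem meanLoad_nonneg (s : I.Profile) (e : Fin I.m) : 0 ≤ I.meanLoad s e :=
  Finset.sum_nonneg fun i _ => I.hit_nonneg i (s i) e

theorem meanLoad_le (s : I.Profile) (e : Fin I.m) : I.meanLoad s e ≤ I.N := by
  refine (Finset.sum_le_sum fun i _ => I.hit_le_one i (s i) e).trans ?_
  simp

theorem meanLoad_eq_add (s : I.Profile) (e : Fin I.m) (i : Fin I.N) :
    I.meanLoad s e = ∑ i' ∈ Finset.univ.erase i, I.hit i' (s i') e + I.hit i (s i) e := by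
  rw [meanLoad, ← Finset.sum_erase_add _ _ (Finset.mem_univ i)]

theorem load_eq_sum (a : Fin I.N → Finset (Fin I.m)) (e : Fin I.m) :
    (I.load a e : ℝ) = ∑ i, if e ∈ a i then (1 : ℝ) else 0 := by
  simp [load]

/-- The load of `e` at the type profile `t`, as a real number. -/
def loadAt (s : I.Profile) (e : Fin I.m) (t : I.TypeProfile) : ℝ :=
  I.load (fun i => s i (t i)) e

theorem loadAt_nonneg (s : I.Profile) (e : Fin I.m) (t : I.TypeProfile) : 0 ≤ I.loadAt s e t :=
  Nat.cast_nonneg _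

theorem loadAt_update_le (s : I.Profile) (e : Fin I.m) (t : I.TypeProfile) (i : Fin I.N)
    (u : Fin (I.numTypes i)) : I.loadAt s e (Function.update t i u) ≤ 1 + I.loadAt s e t := by
  unfold loadAt
  rw [load_eq_sum, load_eq_sum, ← Finset.add_sum_erase _ _ (Finset.mem_univ i)]
  refine add_le_add (by split_ifs <;> simp) ?_
  refine (Finset.sum_le_sum fun j hj => ?_).trans
    (Finset.sum_le_sum_of_subset_of_nonneg (Finset.erase_subset i _)
      fun j _ _ => by split_ifs <;> simp)
  rw [Function.update_of_ne (Finset.ne_of_mem_erase hj)]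

/-- The expectation of `L g(L)` for the load `L` of `e`: conditional on one agent using `e`, the
load exceeds a copy of itself by at most one. -/
theorem expect_loadAt_mul_le (s : I.Profile) (e : Fin I.m) (g : ℝ → ℝ)
    (hg : ∀ x y, 0 ≤ x → x ≤ y → g x ≤ g y) :
    I.expect (fun t => I.loadAt s e t * g (I.loadAt s e t))
      ≤ I.meanLoad s e * I.expect fun t => g (1 + I.loadAt s e t) := by
  have h1 : (fun t => I.loadAt s e t * g (I.loadAt s e t))
      = fun t => ∑ i, (if e ∈ s i (t i) then (1 : ℝ) else 0) * g (I.loadAt s e t) := by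
    funext t
    rw [← Finset.sum_mul]
    congr 1
    exact I.load_eq_sum _ e
  rw [h1, I.expect_sum, meanLoad, Finset.sum_mul]
  refine Finset.sum_le_sum fun i _ => ?_
  rw [← I.expect_resample i, ← I.expect_mul_left]
  refine I.expect_mono fun t => ?_
  rw [hit_eq, Finset.sum_mul]
  refine Finset.sum_le_sum fun u _ => ?_
  rw [mul_assoc, Function.update_self]
  refine mul_le_mul_of_nonneg_left ?_ (I.prob_nonneg i u)
  refine mul_le_mul_of_nonneg_left ?_ (by split_ifs <;> simp)
  exact hg _ _ (I.loadAt_nonneg _ _ _) (I.loadAt_update_le s e t i u)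

/-- By induction on `k`, from `(1 + L) ^ (k + 1) = (1 + L) ^ k + L (1 + L) ^ k`, where the last term
is treated by `expect_loadAt_mul_le` and `(2 + L) ^ k ≤ 2 ^ k (1 + L) ^ k`. -/
theorem expect_one_add_loadAt_pow_le (s : I.Profile) (e : Fin I.m) (k : ℕ) :
    I.expect (fun t => (1 + I.loadAt s e t) ^ k) ≤ 2 ^ (k ^ 2) * (1 + I.meanLoad s e) ^ k := by
  induction k with
  | zero => simp [I.expect_const]
  | succ k ih =>
    have hμ := I.meanLoad_nonneg s e
    set A := I.expect (fun t => (1 + I.loadAt s e t) ^ k) with hA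
    have hA0 : 0 ≤ A := I.expect_nonneg fun t =>
      pow_nonneg (by linarith [I.loadAt_nonneg s e t]) k
    have h1 : I.expect (fun t => (1 + I.loadAt s e t) ^ (k + 1))
        = A + I.expect (fun t => I.loadAt s e t * (1 + I.loadAt s e t) ^ k) := by
      rw [hA, ← I.expect_add]
      congr 1
      funext t
      ring
    have h2 : I.expect (fun t => I.loadAt s e t * (1 + I.loadAt s e t) ^ k)
        ≤ I.meanLoad s e * (2 ^ k * A) := by
      refine (I.expect_loadAt_mul_le s e (fun x => (1 + x) ^ k)
        fun x y hx hxy => by gcongr).trans ?_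
      refine mul_le_mul_of_nonneg_left ?_ hμ
      rw [hA, ← I.expect_mul_left]
      refine I.expect_mono fun t => ?_
      rw [← mul_pow]
      have := I.loadAt_nonneg s e t
      gcongr
      linarith
    have h3 : (1 : ℝ) ≤ 2 ^ k := one_le_pow₀ (by norm_num)
    calc _ ≤ A + I.meanLoad s e * (2 ^ k * A) := by rw [h1]; linarith
      _ ≤ 2 ^ k * (1 + I.meanLoad s e) * A := by nlinarith
      _ ≤ 2 ^ k * (1 + I.meanLoad s e) * (2 ^ (k ^ 2) * (1 + I.meanLoad s e) ^ k) := by gcongr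
      _ = 2 ^ (k + k ^ 2) * (1 + I.meanLoad s e) ^ (k + 1) := by ring
      _ ≤ _ := by
        gcongr
        · norm_num
        · nlinarith

/-- The moments of the load of a resource are controlled by its expectation. -/
theorem expect_loadAt_rpow_le (s : I.Profile) (e : Fin I.m) {α : ℝ} (hα : 1 ≤ α) {k : ℕ}
    (hk : α ≤ k) :
    I.expect (fun t => I.loadAt s e t ^ α)
      ≤ (1 + 2 ^ (k ^ 2)) * (I.meanLoad s e * (1 + I.meanLoad s e) ^ (α - 1)) := by
  have hμ := I.meanLoad_nonneg s e
  set y := 1 + I.meanLoad s e with hy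
  have hy0 : 0 < y := by linarith
  have h1 : (fun t => I.loadAt s e t ^ α)
      = fun t => I.loadAt s e t * I.loadAt s e t ^ (α - 1) := by
    funext t
    rcases (I.loadAt_nonneg s e t).eq_or_lt with h | h
    · rw [← h, Real.zero_rpow (by linarith), zero_mul]
    · rw [Real.rpow_sub_one h.ne']
      field_simp
  -- the real power is bounded by a natural one, in a form that is homogeneous in `y`
  have h2 : ∀ t, (1 + I.loadAt s e t) ^ (α - 1)
      ≤ y ^ (α - 1) * (1 + (y ^ k)⁻¹ * (1 + I.loadAt s e t) ^ k) := by
    intro t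
    have hz : 0 ≤ (1 + I.loadAt s e t) / y := by
      have := I.loadAt_nonneg s e t
      positivity
    have : ((1 + I.loadAt s e t) / y) ^ (α - 1) ≤ 1 + ((1 + I.loadAt s e t) / y) ^ k := by
      rcases le_total ((1 + I.loadAt s e t) / y) 1 with h | h
      · have := Real.rpow_le_one hz h (by linarith : 0 ≤ α - 1)
        have := pow_nonneg hz k
        linarith
      · have : ((1 + I.loadAt s e t) / y) ^ (α - 1) ≤ ((1 + I.loadAt s e t) / y) ^ (k : ℝ) :=
          Real.rpow_le_rpow_of_exponent_le h (by linarith)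
        rw [Real.rpow_natCast] at this
        linarith
    rw [Real.div_rpow (by linarith [I.loadAt_nonneg s e t]) hy0.le,
      div_le_iff₀ (Real.rpow_pos_of_pos hy0 _), div_pow] at this
    calc _ ≤ _ := this
      _ = _ := by rw [mul_comm, div_eq_inv_mul]
  calc _ ≤ I.meanLoad s e * I.expect fun t => (1 + I.loadAt s e t) ^ (α - 1) := by
        rw [h1]
        exact I.expect_loadAt_mul_le s e (fun x => x ^ (α - 1))
          fun x z hx hxz => Real.rpow_le_rpow hx hxz (by linarith)
    _ ≤ I.meanLoad s e * (y ^ (α - 1) * (1 + 2 ^ (k ^ 2))) := by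
        refine mul_le_mul_of_nonneg_left ?_ hμ
        refine (I.expect_mono h2).trans ?_
        rw [I.expect_mul_left, I.expect_add, I.expect_const, I.expect_mul_left]
        refine mul_le_mul_of_nonneg_left ?_ (Real.rpow_nonneg hy0.le _)
        have := I.expect_one_add_loadAt_pow_le s e k
        rw [inv_mul_eq_div, add_le_add_iff_left, div_le_iff₀ (by positivity)]
        exact this
    _ = _ := by ring

end Instance

theorem Exponents.le_max (X : Exponents) (j : Fin X.q) : X.α j ≤ X.max :=
  le_ciSup (Set.finite_range X.α).bddAbove j

theorem Exponents.one_lt_max (X : Exponents) : 1 < X.max := by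
  obtain ⟨j, hj⟩ := X.exists_one_lt
  exact hj.trans_le (X.le_max j)

/-! ### Convexity of powers -/

theorem rpow_tangent_le {y z α : ℝ} (hy : 0 < y) (hz : 0 ≤ z) (hα : 1 ≤ α) :
    y ^ α + α * y ^ (α - 1) * (z - y) ≤ z ^ α := by
  have hs : -1 ≤ (z - y) / y := by
    rw [le_div_iff₀ hy]
    linarith
  have h := one_add_mul_self_le_rpow_one_add hs hα
  have h1 : 1 + (z - y) / y = z / y := by field_simp; ring
  rw [h1, Real.div_rpow hz hy.le, le_div_iff₀ (Real.rpow_pos_of_pos hy _)] at h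
  rw [Real.rpow_sub_one hy.ne']
  calc _ = (1 + α * ((z - y) / y)) * y ^ α := by field_simp
    _ ≤ _ := h

/-- One agent moves in the potential of a single resource and a single exponent: `x - 1` is the
expected load caused by the others, `p` and `p'` are her old and new probabilities. -/
theorem potential_move_le {x p p' α a : ℝ} (hx : 1 ≤ x) (hp : 0 ≤ p) (hp' : 0 ≤ p') (hp1 : p' ≤ 1)
    (hα : 1 ≤ α) (ha : α ≤ a) :
    ((x + p') ^ α - 1) / α + p * x ^ (α - 1)
      ≤ ((x + p) ^ α - 1) / α + 2 ^ a * (p' * x ^ (α - 1)) := by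
  have h1 := rpow_tangent_le (y := x) (z := x + p) (by linarith) (by linarith) hα
  have h2 := rpow_tangent_le (y := x + p') (z := x) (by linarith) (by linarith) hα
  have h3 : (x + p') ^ (α - 1) ≤ 2 ^ a * x ^ (α - 1) := by
    calc (x + p') ^ (α - 1) ≤ (2 * x) ^ (α - 1) :=
          Real.rpow_le_rpow (by linarith) (by linarith) (by linarith)
      _ = 2 ^ (α - 1) * x ^ (α - 1) := Real.mul_rpow (by norm_num) (by linarith)
      _ ≤ _ := by
        gcongr
        · norm_num
        · linarith
  have h4 : p' * (x + p') ^ (α - 1) ≤ p' * (2 ^ a * x ^ (α - 1)) := by gcongr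
  have hα0 : 0 < α := by linarith
  rw [div_add' _ _ _ hα0.ne', div_add' _ _ _ hα0.ne', div_le_div_iff_of_pos_right hα0]
  nlinarith

theorem one_add_rpow_sub_one_div_le {μ α : ℝ} (hμ : 0 ≤ μ) (hα : 1 ≤ α) :
    ((1 + μ) ^ α - 1) / α ≤ μ * (1 + μ) ^ (α - 1) := by
  have h := rpow_tangent_le (y := 1 + μ) (z := 1) (by linarith) (by norm_num) hα
  rw [Real.one_rpow] at h
  rw [div_le_iff₀ (by linarith)]
  linarith

theorem mul_one_add_rpow_le {μ α a : ℝ} (hμ : 0 ≤ μ) (hα : 1 ≤ α) (ha : α ≤ a) :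
    μ * (1 + μ) ^ (α - 1) ≤ a * (((1 + μ) ^ α - 1) / α) := by
  have h1 : (1 : ℝ) ≤ (1 + μ) ^ (α - 1) := Real.one_le_rpow (by linarith) (by linarith)
  have h2 : (1 + μ) ^ α = (1 + μ) ^ (α - 1) * (1 + μ) := by
    rw [Real.rpow_sub_one (by linarith)]
    field_simp
  have h3 : μ * (1 + μ) ^ (α - 1) ≤ (1 + μ) ^ α - 1 := by
    rw [h2]
    linarith
  have h4 : 0 ≤ (1 + μ) ^ α - 1 := le_trans (by positivity) h3
  refine h3.trans ?_
  rw [← mul_div_assoc, le_div_iff₀ (by linarith)]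
  nlinarith

/-- The smoothness inequality for a load `l` in an optimal profile. If `l` is small compared with
`μ`, the first summand is the bound, and otherwise the second one is. -/
theorem natCast_mul_one_add_rpow_le (l : ℕ) {μ α H : ℝ} (hμ : 0 ≤ μ) (hα : 1 ≤ α) (hH : 0 < H) :
    l * (1 + μ) ^ (α - 1)
      ≤ μ * (1 + μ) ^ (α - 1) / H + (1 + H) ^ (α - 1) * (l : ℝ) ^ α := by
  have h0 : 0 ≤ (1 + μ) ^ (α - 1) := by positivity
  rcases le_or_gt (l * H) μ with h | h
  · have : l * (1 + μ) ^ (α - 1) ≤ μ * (1 + μ) ^ (α - 1) / H := by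
      rw [le_div_iff₀ hH]
      nlinarith
    have : 0 ≤ (1 + H) ^ (α - 1) * (l : ℝ) ^ α := by positivity
    linarith
  · have hl : 1 ≤ (l : ℝ) := by
      rcases Nat.eq_zero_or_pos l with h' | h'
      · subst h'
        simp at h
        linarith
      · exact_mod_cast h'
    have h1 : (1 + μ) ^ (α - 1) ≤ (1 + H) ^ (α - 1) * (l : ℝ) ^ (α - 1) := by
      rw [← Real.mul_rpow (by linarith) (by linarith)]
      exact Real.rpow_le_rpow (by linarith) (by nlinarith) (by linarith)
    have h2 : (l : ℝ) ^ α = l * (l : ℝ) ^ (α - 1) := by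
      rw [Real.rpow_sub_one (by linarith)]
      field_simp
    have : 0 ≤ μ * (1 + μ) ^ (α - 1) / H := by positivity
    rw [h2]
    nlinarith

namespace Instance

variable {P : Problem} {X : Exponents} (I : Instance P X)

/-! ### The potential of the dynamics -/

/-- Up to factors that depend on the exponents only, the expected cost of `s`: the expectation of
`L ^ α` is replaced by `μ (1 + μ) ^ (α - 1)`, where `μ` is the expectation of `L`. -/
def proxyCost (s : I.Profile) : ℝ :=
  ∑ e, ∑ j, I.ξ e j * (I.meanLoad s e * (1 + I.meanLoad s e) ^ (X.α j - 1))

/-- The potential function of the dynamics. -/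
def potential (s : I.Profile) : ℝ :=
  ∑ e, ∑ j, I.ξ e j * (((1 + I.meanLoad s e) ^ X.α j - 1) / X.α j)

/-- The expected load of `e` caused by the agents other than `i`. -/
def othersLoad (s : I.Profile) (i : Fin I.N) (e : Fin I.m) : ℝ :=
  ∑ i' ∈ Finset.univ.erase i, I.hit i' (s i') e

theorem othersLoad_nonneg (s : I.Profile) (i : Fin I.N) (e : Fin I.m) : 0 ≤ I.othersLoad s i e :=
  Finset.sum_nonneg fun i' _ => I.hit_nonneg i' (s i') e

theorem meanLoad_eq (s : I.Profile) (i : Fin I.N) (e : Fin I.m) :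
    I.meanLoad s e = I.othersLoad s i e + I.hit i (s i) e :=
  I.meanLoad_eq_add s e i

theorem meanLoad_update (s : I.Profile) (i : Fin I.N) (e : Fin I.m)
    (b : Fin (I.numTypes i) → Finset (Fin I.m)) :
    I.meanLoad (Function.update s i b) e = I.othersLoad s i e + I.hit i b e := by
  rw [I.meanLoad_eq _ i, Function.update_self]
  congr 1
  exact Finset.sum_congr rfl fun i' hi' => by
    rw [Function.update_of_ne (Finset.ne_of_mem_erase hi')]

theorem shareEst_eq (s : I.Profile) (i : Fin I.N) (e : Fin I.m) :
    I.shareEst s i e = ∑ j, I.ξ e j * (1 + I.othersLoad s i e) ^ (X.α j - 1) := rfl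

theorem shareEst_nonneg (s : I.Profile) (i : Fin I.N) (e : Fin I.m) : 0 ≤ I.shareEst s i e := by
  rw [shareEst_eq]
  have := I.othersLoad_nonneg s i e
  exact Finset.sum_nonneg fun j _ => mul_nonneg (I.ξ_pos e j).le (by positivity)

theorem sum_prob_mul_sum_mem (i : Fin I.N) (b : Fin (I.numTypes i) → Finset (Fin I.m))
    (w : Fin I.m → ℝ) : ∑ t, I.prob i t * ∑ e ∈ b t, w e = ∑ e, I.hit i b e * w e := by
  simp only [hit_eq, Finset.sum_mul]
  rw [Finset.sum_comm]
  refine Finset.sum_congr rfl fun t _ => ?_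
  rw [Finset.mul_sum]
  simp

theorem costEst_eq (s : I.Profile) (i : Fin I.N) (b : Fin (I.numTypes i) → Finset (Fin I.m)) :
    I.costEst s i b
      = ∑ e, ∑ j, I.ξ e j * (I.hit i b e * (1 + I.othersLoad s i e) ^ (X.α j - 1)) := by
  rw [costEst, sum_prob_mul_sum_mem]
  refine Finset.sum_congr rfl fun e _ => ?_
  rw [shareEst_eq, Finset.mul_sum]
  exact Finset.sum_congr rfl fun j _ => by ring

/-- The potential decreases at least by the estimated cost of the old strategy minus `2 ^ α_max`
times that of the new one. -/
theorem potential_update_le (s : I.Profile) (i : Fin I.N)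
    (b : Fin (I.numTypes i) → Finset (Fin I.m)) :
    I.potential (Function.update s i b) + I.costEst s i (s i)
      ≤ I.potential s + 2 ^ X.max * I.costEst s i b := by
  simp only [costEst_eq, potential, Finset.mul_sum, ← Finset.sum_add_distrib]
  refine Finset.sum_le_sum fun e _ => Finset.sum_le_sum fun j _ => ?_
  have h := potential_move_le (x := 1 + I.othersLoad s i e) (a := X.max)
    (by linarith [I.othersLoad_nonneg s i e])
    (I.hit_nonneg i (s i) e) (I.hit_nonneg i b e) (I.hit_le_one i b e) (X.one_le j) (X.le_max j)
  rw [I.meanLoad_update, I.meanLoad_eq s i, ← add_assoc, ← add_assoc]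
  have := mul_le_mul_of_nonneg_left h (I.ξ_pos e j).le
  linarith

theorem potential_le_proxyCost (s : I.Profile) : I.potential s ≤ I.proxyCost s :=
  Finset.sum_le_sum fun e _ => Finset.sum_le_sum fun j _ =>
    mul_le_mul_of_nonneg_left (one_add_rpow_sub_one_div_le (I.meanLoad_nonneg s e) (X.one_le j))
      (I.ξ_pos e j).le

theorem proxyCost_le_potential (s : I.Profile) : I.proxyCost s ≤ X.max * I.potential s := by
  simp only [potential, Finset.mul_sum]
  refine Finset.sum_le_sum fun e _ => Finset.sum_le_sum fun j _ => ?_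
  have := mul_le_mul_of_nonneg_left
    (mul_one_add_rpow_le (I.meanLoad_nonneg s e) (X.one_le j) (X.le_max j)) (I.ξ_pos e j).le
  linarith

theorem proxyCost_nonneg (s : I.Profile) : 0 ≤ I.proxyCost s :=
  Finset.sum_nonneg fun e _ => Finset.sum_nonneg fun j _ => by
    have := I.meanLoad_nonneg s e
    have := I.ξ_pos e j
    positivity

/-- The factor makes up for the share of the agent herself in the load: `costEst` evaluates the
powers at the load caused by the others, to which she adds at most one. -/
theorem proxyCost_le_costEst (s : I.Profile) :
    I.proxyCost s ≤ 2 ^ X.max * ∑ i, I.costEst s i (s i) := by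
  simp only [costEst_eq]
  rw [Finset.sum_comm, Finset.mul_sum]
  refine Finset.sum_le_sum fun e _ => ?_
  rw [Finset.sum_comm, Finset.mul_sum]
  refine Finset.sum_le_sum fun j _ => ?_
  rw [← Finset.mul_sum, mul_left_comm (2 ^ X.max : ℝ)]
  refine mul_le_mul_of_nonneg_left ?_ (I.ξ_pos e j).le
  conv_lhs => rw [meanLoad, Finset.sum_mul]
  rw [Finset.mul_sum]
  refine Finset.sum_le_sum fun i _ => ?_
  rw [mul_left_comm (2 ^ X.max : ℝ)]
  refine mul_le_mul_of_nonneg_left ?_ (I.hit_nonneg i (s i) e)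
  have h0 := I.othersLoad_nonneg s i e
  have hj := X.one_le j
  calc (1 + I.meanLoad s e) ^ (X.α j - 1)
      ≤ (2 * (1 + I.othersLoad s i e)) ^ (X.α j - 1) := by
        refine Real.rpow_le_rpow (by linarith [I.meanLoad_nonneg s e]) ?_ (by linarith)
        rw [I.meanLoad_eq s i]
        linarith [I.hit_le_one i (s i) e]
    _ = 2 ^ (X.α j - 1) * (1 + I.othersLoad s i e) ^ (X.α j - 1) :=
        Real.mul_rpow (by norm_num) (by linarith)
    _ ≤ _ := by
        gcongr
        · norm_num
        · linarith [X.le_max j]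

theorem socialCost_le_proxyCost (s : I.Profile) {k : ℕ} (hk : X.max ≤ k) :
    I.socialCost s ≤ (1 + 2 ^ (k ^ 2)) * I.proxyCost s := by
  have h : I.socialCost s = ∑ e, ∑ j, I.ξ e j * I.expect fun t => I.loadAt s e t ^ X.α j := by
    unfold socialCost cost resourceCost
    rw [I.expect_sum]
    refine Finset.sum_congr rfl fun e _ => ?_
    rw [I.expect_sum]
    exact Finset.sum_congr rfl fun j _ => I.expect_mul_left _ _
  rw [h, proxyCost, Finset.mul_sum]
  refine Finset.sum_le_sum fun e _ => ?_
  rw [Finset.mul_sum]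
  refine Finset.sum_le_sum fun j _ => ?_
  rw [mul_left_comm]
  exact mul_le_mul_of_nonneg_left
    (I.expect_loadAt_rpow_le s e (X.one_le j) ((X.le_max j).trans hk)) (I.ξ_pos e j).le

/-! ### Comparison with the optimum -/

theorem exists_cost_eq_opt (t : I.TypeProfile) :
    ∃ a : Fin I.N → Finset (Fin I.m), (∀ i, a i ∈ I.act i (t i)) ∧ I.cost a = I.opt t := by
  have : Nonempty ((i : Fin I.N) → {b : Finset (Fin I.m) // b ∈ I.act i (t i)}) :=
    ⟨fun i => ⟨(I.req_valid i (t i)).choose, (I.req_valid i (t i)).choose_spec⟩⟩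
  obtain ⟨a, ha⟩ := exists_eq_ciInf_of_finite
    (f := fun a : (i : Fin I.N) → {b : Finset (Fin I.m) // b ∈ I.act i (t i)} =>
      I.cost fun i => (a i).1)
  exact ⟨fun i => (a i).1, fun i => (a i).2, ha⟩

/-- An action profile of minimum cost for the type profile `t`. -/
def optProfile (t : I.TypeProfile) : Fin I.N → Finset (Fin I.m) := (I.exists_cost_eq_opt t).choose

theorem optProfile_mem (t : I.TypeProfile) (i : Fin I.N) : I.optProfile t i ∈ I.act i (t i) :=
  (I.exists_cost_eq_opt t).choose_spec.1 i

theorem cost_optProfile (t : I.TypeProfile) : I.cost (I.optProfile t) = I.opt t :=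
  (I.exists_cost_eq_opt t).choose_spec.2

theorem resourceCost_nonneg (e : Fin I.m) {l : ℝ} (hl : 0 ≤ l) : 0 ≤ I.resourceCost e l :=
  Finset.sum_nonneg fun j _ => mul_nonneg (I.ξ_pos e j).le (Real.rpow_nonneg hl _)

theorem opt_nonneg (t : I.TypeProfile) : 0 ≤ I.opt t := by
  rw [← I.cost_optProfile]
  exact Finset.sum_nonneg fun e _ => I.resourceCost_nonneg e (Nat.cast_nonneg _)

theorem expectedOpt_nonneg : 0 ≤ I.expectedOpt := I.expect_nonneg I.opt_nonneg

variable {ρ : ℝ} {O : ActionProcedure}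

/-- If each agent queries the oracle with weights at most `W`, then the expected weight of
the answers is bounded in terms of the loads in optimal profiles. The optimal action of an agent
depends on the types of all agents, which does no harm, as the oracle is compared with it for each
type profile separately. -/
theorem sum_oracle_le (hρ : 0 ≤ ρ) (hO : P.IsActionOracle ρ O) (w : Fin I.N → Fin I.m → ℝ)
    (W : Fin I.m → ℝ) (hw : ∀ i e, 0 ≤ w i e) (hwW : ∀ i e, w i e ≤ W e) :
    ∑ i, ∑ u, I.prob i u * ∑ e ∈ O I.m (I.req i u) (w i), w i e
      ≤ ρ * I.expect fun t => ∑ e, I.load (I.optProfile t) e * W e := by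
  have h1 : ∀ i, ∑ u, I.prob i u * ∑ e ∈ O I.m (I.req i u) (w i), w i e
      ≤ ρ * I.expect fun t => ∑ e, (if e ∈ I.optProfile t i then 1 else 0) * W e := by
    intro i
    rw [← I.expect_marginal i fun u => ∑ e ∈ O I.m (I.req i u) (w i), w i e,
      ← I.expect_mul_left]
    refine I.expect_mono fun t => ?_
    refine ((hO I.m (I.req i (t i)) (I.req_valid i (t i)) (w i) (hw i)).2 _
      (I.optProfile_mem t i)).trans ?_
    refine mul_le_mul_of_nonneg_left ?_ hρ
    refine (Finset.sum_le_sum fun e _ => hwW i e).trans ?_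
    simp
  refine (Finset.sum_le_sum fun i _ => h1 i).trans ?_
  rw [← Finset.mul_sum, ← I.expect_sum]
  refine mul_le_mul_of_nonneg_left (I.expect_mono fun t => ?_) hρ
  rw [Finset.sum_comm]
  refine Finset.sum_le_sum fun e _ => ?_
  rw [load_eq_sum, Finset.sum_mul]

/-- The estimated costs of the oracle's responses, compared with the optimum by smoothness. -/
theorem sum_costEst_response_le (hρ : 0 ≤ ρ) (hO : P.IsActionOracle ρ O) (s : I.Profile) {H : ℝ}
    (hH : 0 < H) :
    ∑ i, I.costEst s i (I.response O s i)
      ≤ ρ * (I.proxyCost s / H + (1 + H) ^ (X.max - 1) * I.expectedOpt) := by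
  refine (I.sum_oracle_le hρ hO (I.shareEst s)
    (fun e => ∑ j, I.ξ e j * (1 + I.meanLoad s e) ^ (X.α j - 1))
    (I.shareEst_nonneg s) fun i e => ?_).trans ?_
  · rw [shareEst_eq]
    refine Finset.sum_le_sum fun j _ => mul_le_mul_of_nonneg_left ?_ (I.ξ_pos e j).le
    have := I.othersLoad_nonneg s i e
    refine Real.rpow_le_rpow (by linarith) ?_ (by linarith [X.one_le j])
    rw [I.meanLoad_eq s i]
    linarith [I.hit_nonneg i (s i) e]
  · refine mul_le_mul_of_nonneg_left ?_ hρ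
    rw [expectedOpt, ← I.expect_mul_left, ← I.expect_const (I.proxyCost s / H), ← I.expect_add]
    refine I.expect_mono fun t => ?_
    rw [← I.cost_optProfile]
    simp only [proxyCost, cost, resourceCost, Finset.sum_div, Finset.mul_sum,
      ← Finset.sum_add_distrib]
    refine Finset.sum_le_sum fun e _ => Finset.sum_le_sum fun j _ => ?_
    have h := natCast_mul_one_add_rpow_le (I.load (I.optProfile t) e) (I.meanLoad_nonneg s e)
      (X.one_le j) hH
    have h2 : (1 + H) ^ (X.α j - 1) ≤ (1 + H) ^ (X.max - 1) :=
      Real.rpow_le_rpow_of_exponent_le (by linarith) (by linarith [X.le_max j])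
    have h3 := mul_le_mul_of_nonneg_right h2
      (Real.rpow_nonneg (Nat.cast_nonneg (I.load (I.optProfile t) e)) (X.α j))
    have h4 := mul_le_mul_of_nonneg_left (h.trans (add_le_add_right h3 _)) (I.ξ_pos e j).le
    calc _ = _ := by ring
      _ ≤ _ := h4
      _ = _ := by ring

/-- The initial profile is a `ρ (1 + N) ^ (α_max - 1)`-approximation. -/
theorem proxyCost_initial_le (hρ : 0 ≤ ρ) (hO : P.IsActionOracle ρ O) :
    I.proxyCost (I.initial O) ≤ (1 + I.N) ^ (X.max - 1) * (ρ * I.expectedOpt) := by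
  have h := I.sum_oracle_le hρ hO (fun _ e => ∑ j, I.ξ e j) (fun e => ∑ j, I.ξ e j)
    (fun _ e => Finset.sum_nonneg fun j _ => (I.ξ_pos e j).le) fun _ _ => le_rfl
  have h1 : ∑ i, ∑ u, I.prob i u * ∑ e ∈ O I.m (I.req i u) (fun e => ∑ j, I.ξ e j), ∑ j, I.ξ e j
      = ∑ e, I.meanLoad (I.initial O) e * ∑ j, I.ξ e j := by
    have : ∀ i, ∑ u, I.prob i u * ∑ e ∈ O I.m (I.req i u) (fun e => ∑ j, I.ξ e j), ∑ j, I.ξ e j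
        = ∑ e, I.hit i (I.initial O i) e * ∑ j, I.ξ e j := fun i =>
      I.sum_prob_mul_sum_mem i (I.initial O i) fun e => ∑ j, I.ξ e j
    simp only [this]
    rw [Finset.sum_comm]
    exact Finset.sum_congr rfl fun e _ => by rw [meanLoad, Finset.sum_mul]
  rw [h1] at h
  have h2 : (I.expect fun t => ∑ e, I.load (I.optProfile t) e * ∑ j, I.ξ e j) ≤ I.expectedOpt := by
    refine I.expect_mono fun t => ?_
    rw [← I.cost_optProfile]
    refine Finset.sum_le_sum fun e _ => ?_
    rw [resourceCost, Finset.mul_sum]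
    refine Finset.sum_le_sum fun j _ => ?_
    rw [mul_comm]
    refine mul_le_mul_of_nonneg_left ?_ (I.ξ_pos e j).le
    rcases Nat.eq_zero_or_pos (I.load (I.optProfile t) e) with h0 | h0
    · rw [h0, Nat.cast_zero, Real.zero_rpow (by linarith [X.one_le j])]
    · exact Real.self_le_rpow_of_one_le (by exact_mod_cast h0) (X.one_le j)
  calc I.proxyCost (I.initial O)
      ≤ (1 + I.N) ^ (X.max - 1) * ∑ e, I.meanLoad (I.initial O) e * ∑ j, I.ξ e j := by
        simp only [proxyCost, Finset.mul_sum]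
        refine Finset.sum_le_sum fun e _ => Finset.sum_le_sum fun j _ => ?_
        have h0 := I.meanLoad_nonneg (I.initial O) e
        have h3 : (1 + I.meanLoad (I.initial O) e) ^ (X.α j - 1) ≤ (1 + I.N : ℝ) ^ (X.max - 1) :=
          (Real.rpow_le_rpow (by linarith) (by linarith [I.meanLoad_le (I.initial O) e])
            (by linarith [X.one_le j])).trans
          (Real.rpow_le_rpow_of_exponent_le (by linarith [Nat.cast_nonneg (α := ℝ) I.N])
            (by linarith [X.le_max j]))
        have h4 := mul_le_mul_of_nonneg_left h3 (mul_nonneg (I.ξ_pos e j).le h0)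
        calc _ = _ := by ring
          _ ≤ _ := h4
          _ = _ := by ring
    _ ≤ (1 + I.N) ^ (X.max - 1) * (ρ * I.expectedOpt) := by
        refine mul_le_mul_of_nonneg_left ?_ (by positivity)
        exact h.trans (mul_le_mul_of_nonneg_left h2 hρ)

/-- Unless the estimated gains are large, the profile is within a constant factor of the optimum. -/
theorem proxyCost_le_gain (hρ : 1 ≤ ρ) (hO : P.IsActionOracle ρ O) (s : I.Profile) :
    I.proxyCost s ≤ (3 * (2 ^ X.max) ^ 2) ^ X.max * ρ ^ X.max * I.expectedOpt
      + 2 * 2 ^ X.max * ∑ i, I.gain O (2 ^ X.max) s i := by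
  have hρ0 : 0 < ρ := by linarith
  set M : ℝ := 2 ^ X.max with hM
  have hM1 : 1 ≤ M := Real.one_le_rpow (by norm_num) (by linarith [X.one_lt_max])
  -- chosen such that the term `Ψ / H` below is absorbed by half of the left hand side
  set H : ℝ := 2 * M ^ 2 * ρ with hH
  have hM2 : 1 ≤ M ^ 2 * ρ := by nlinarith [one_le_pow₀ hM1 (n := 2)]
  have hH0 : 0 < H := by linarith
  have h1 := I.proxyCost_le_costEst s
  have h2 := I.sum_costEst_response_le hρ0.le hO s hH0
  have h3 : ∑ i, I.gain O M s i
      = ∑ i, I.costEst s i (s i) - M * ∑ i, I.costEst s i (I.response O s i) := by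
    rw [Finset.mul_sum, ← Finset.sum_sub_distrib]
    rfl
  have h4 : H * (1 + H) ^ (X.max - 1) ≤ (3 * M ^ 2) ^ X.max * ρ ^ X.max := by
    rw [← Real.mul_rpow (by positivity) hρ0.le]
    calc H * (1 + H) ^ (X.max - 1) ≤ (1 + H) * (1 + H) ^ (X.max - 1) := by
          have : 0 ≤ (1 + H) ^ (X.max - 1) := by positivity
          nlinarith
      _ = (1 + H) ^ X.max := by
          rw [Real.rpow_sub_one (by linarith)]
          field_simp
      _ ≤ _ := Real.rpow_le_rpow (by linarith) (by linarith) (by linarith [X.one_lt_max])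
  have h5 := mul_le_mul_of_nonneg_right h4 I.expectedOpt_nonneg
  have h6 : M * M * (ρ * (I.proxyCost s / H + (1 + H) ^ (X.max - 1) * I.expectedOpt))
      = I.proxyCost s / 2 + H * (1 + H) ^ (X.max - 1) * I.expectedOpt / 2 := by
    rw [hH]
    field_simp
  have h7 := mul_le_mul_of_nonneg_left h2 (by positivity : 0 ≤ M * M)
  rw [h6] at h7
  rw [h3]
  nlinarith

/-! ### Convergence -/

/-- A round does not increase the potential, and decreases it at least by the average of the
estimated gains. If no agent is eligible, this average is not positive. -/
theorem potential_round_le (s : I.Profile) :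
    I.potential (I.round O (2 ^ X.max) s) ≤ I.potential s ∧
      I.potential (I.round O (2 ^ X.max) s)
        ≤ I.potential s - 1 / I.N * ∑ i, I.gain O (2 ^ X.max) s i := by
  unfold round
  split_ifs with h
  · have hi := Finset.min'_mem _ h
    set i := (I.eligible O (2 ^ X.max) s).min' h
    rw [eligible, Finset.mem_filter] at hi
    have h1 := I.potential_update_le s i (I.response O s i)
    have h2 : I.gain O (2 ^ X.max) s i
      = I.costEst s i (s i) - 2 ^ X.max * I.costEst s i (I.response O s i) := rfl
    constructor
    · linarith [hi.2.1]
    · linarith [hi.2.2]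
  · refine ⟨le_rfl, ?_⟩
    have hle : 1 / (I.N : ℝ) * ∑ i, I.gain O (2 ^ X.max) s i ≤ 0 := by
      by_contra hcon
      rw [not_le] at hcon
      have hN : 0 < I.N := by
        refine Nat.pos_of_ne_zero fun h0 => ?_
        have h0' : (I.N : ℝ) = 0 := by exact_mod_cast h0
        simp [h0'] at hcon
      have hN' : (0 : ℝ) < I.N := by exact_mod_cast hN
      have : Nonempty (Fin I.N) := ⟨⟨0, hN⟩⟩
      obtain ⟨i, _, hi⟩ := Finset.exists_le_of_sum_le (s := Finset.univ)
        (f := fun _ => 1 / (I.N : ℝ) * ∑ i, I.gain O (2 ^ X.max) s i)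
        (g := fun i => I.gain O (2 ^ X.max) s i) Finset.univ_nonempty (by
          rw [Finset.sum_const, Finset.card_univ, Fintype.card_fin, nsmul_eq_mul, ← mul_assoc,
            mul_one_div_cancel hN'.ne', one_mul])
      exact h ⟨i, by
        rw [eligible, Finset.mem_filter]
        exact ⟨Finset.mem_univ i, hcon.trans_le hi, hi⟩⟩
    linarith

/-- Above the first summand, the potential contracts in each round by the factor
`1 - 1 / (2 * 2 ^ α_max * N)`. -/
theorem potential_iterate_le (hρ : 1 ≤ ρ) (hO : P.IsActionOracle ρ O) (s : I.Profile) (r : ℕ) :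
    I.potential ((I.round O (2 ^ X.max))^[r] s)
      ≤ (3 * (2 ^ X.max) ^ 2) ^ X.max * ρ ^ X.max * I.expectedOpt
        + Real.exp (-(r / (2 * 2 ^ X.max * I.N))) * I.proxyCost s := by
  set A := (3 * ((2 : ℝ) ^ X.max) ^ 2) ^ X.max * ρ ^ X.max * I.expectedOpt with hA
  have hM : (1 : ℝ) ≤ 2 ^ X.max := Real.one_le_rpow (by norm_num) (by linarith [X.one_lt_max])
  have hA0 : 0 ≤ A := by
    have := I.expectedOpt_nonneg
    positivity
  induction r with
  | zero => simpa using (I.potential_le_proxyCost s).trans (by linarith)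
  | succ r ih =>
    rw [Function.iterate_succ_apply']
    set s' := (I.round O (2 ^ X.max))^[r] s
    obtain ⟨h1, h2⟩ := I.potential_round_le (O := O) s'
    have h3 := (I.potential_le_proxyCost s').trans (I.proxyCost_le_gain hρ hO s')
    rw [← hA] at h3
    set G := ∑ i, I.gain O (2 ^ X.max) s' i
    have hs0 : 0 ≤ I.proxyCost s := I.proxyCost_nonneg s
    have he := mul_nonneg (Real.exp_pos (-((r + 1 : ℕ) / (2 * 2 ^ X.max * I.N : ℝ)))).le hs0
    rcases le_or_gt (I.potential s') A with h | h
    · linarith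
    · have hexp : Real.exp (-((r + 1 : ℕ) / (2 * 2 ^ X.max * I.N : ℝ)))
          = Real.exp (-(1 / (2 * 2 ^ X.max * I.N : ℝ)))
            * Real.exp (-(r / (2 * 2 ^ X.max * I.N : ℝ))) := by
        rw [← Real.exp_add]
        congr 1
        push_cast
        ring
      have hb := Real.one_sub_le_exp_neg (1 / (2 * 2 ^ X.max * I.N : ℝ))
      have h4 : (I.potential s' - A) * (1 / (2 * 2 ^ X.max * I.N)) ≤ 1 / I.N * G := by
        have : 1 / (2 * 2 ^ X.max * (I.N : ℝ)) = 1 / (2 * 2 ^ X.max) * (1 / I.N) := by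
          rw [one_div_mul_one_div]
        rw [this, ← mul_assoc, mul_comm _ G]
        refine mul_le_mul_of_nonneg_right ?_ (by positivity)
        rw [mul_one_div, div_le_iff₀ (by positivity)]
        linarith
      rw [hexp]
      have h5 : (I.potential s' - A) * (1 - 1 / (2 * 2 ^ X.max * I.N))
          ≤ (I.potential s' - A) * Real.exp (-(1 / (2 * 2 ^ X.max * I.N : ℝ))) :=
        mul_le_mul_of_nonneg_left hb (by linarith)
      have h6 := mul_le_mul_of_nonneg_right ih (Real.exp_pos (-(1 / (2 * 2 ^ X.max * I.N : ℝ)))).le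
      have h7 : Real.exp (-(1 / (2 * 2 ^ X.max * I.N : ℝ))) ≤ 1 := by
        rw [Real.exp_le_one_iff, neg_nonpos]
        positivity
      nlinarith

end Instance

/-- The parameter `η`: the factor by which the estimated cost of a response is multiplied. It makes
every estimated gain a lower bound for the decrease of the potential. -/
def discount (a : ℝ) : ℝ := 2 ^ a

/-- The number of rounds. The potential contracts in each of them by the factor
`1 - 1 / (2 * 2 ^ a * N)`, so that these are enough to gain a factor `exp ((a - 1) N)`, which is at
least the approximation factor `(1 + N) ^ (a - 1)` of the initial profile. The ceiling can be
computed by counting, and the product form allows nested loops. -/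
def numRounds (a : ℝ) (N : ℕ) : ℕ := N * N * (⌈(2 : ℝ) ^ a⌉₊ * ⌈(2 : ℝ) ^ a⌉₊)

/-- The bound on the competitive ratio, divided by `ρ ^ α_max`. -/
def ratioBound (a : ℝ) : ℝ := (1 + 2 ^ (⌈a⌉₊ ^ 2)) * (a * ((3 * (2 ^ a) ^ 2) ^ a + 1))

namespace Instance

variable {P : Problem} {X : Exponents} (I : Instance P X) {ρ : ℝ} {O : ActionProcedure}

theorem isStrategy_round (hO : P.IsActionOracle ρ O) (η : ℝ) {s : I.Profile}
    (hs : I.IsStrategy s) : I.IsStrategy (I.round O η s) := by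
  unfold round
  split_ifs with h
  · intro i t
    generalize (I.eligible O η s).min' h = i'
    rcases eq_or_ne i i' with rfl | hi
    · rw [Function.update_self]
      exact (hO I.m _ (I.req_valid _ t) _ (I.shareEst_nonneg _ _)).1
    · rw [Function.update_of_ne hi]
      exact hs i t
  · exact hs

theorem isStrategy_bayesABRD (hO : P.IsActionOracle ρ O) (η : ℝ → ℝ) (R : ℝ → ℕ → ℕ) :
    I.IsStrategy (bayesABRD P O η R X I) := by
  unfold bayesABRD
  induction R X.max I.N with
  | zero => exact fun i t => (hO I.m _ (I.req_valid i t) _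
      fun e => Finset.sum_nonneg fun j _ => (I.ξ_pos e j).le).1
  | succ r ih =>
    rw [Function.iterate_succ_apply']
    exact I.isStrategy_round hO _ ih

theorem sub_one_mul_le_numRounds_div :
    (X.max - 1) * I.N ≤ numRounds X.max I.N / (2 * 2 ^ X.max * I.N) := by
  have ha := X.one_lt_max
  have hM : (0 : ℝ) < 2 ^ X.max := by positivity
  have h1 : X.max - 1 ≤ 2 ^ X.max / 2 := by
    rw [← Real.rpow_sub_one (by norm_num)]
    rcases le_total 1 (X.max - 1) with h | h
    · have := one_add_mul_self_le_rpow_one_add (s := 1) (by norm_num) h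
      norm_num at this ⊢
      linarith
    · exact h.trans (Real.one_le_rpow (by norm_num) (by linarith))
  have h2 := Nat.le_ceil ((2 : ℝ) ^ X.max)
  rcases Nat.eq_zero_or_pos I.N with h0 | h0
  · simp [h0]
  · have hN : (0 : ℝ) < I.N := by exact_mod_cast h0
    rw [numRounds, le_div_iff₀ (by positivity)]
    push_cast
    set K : ℝ := (⌈(2 : ℝ) ^ X.max⌉₊ : ℝ)
    have h3 : (X.max - 1) * (2 * 2 ^ X.max) ≤ K * K := by nlinarith
    nlinarith [mul_pos hN hN]

theorem socialCost_bayesABRD_le (hρ : 1 ≤ ρ) (hO : P.IsActionOracle ρ O) :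
    I.socialCost (bayesABRD P O discount numRounds X I)
      ≤ ratioBound X.max * ρ ^ X.max * I.expectedOpt := by
  have ha := X.one_lt_max
  set s := bayesABRD P O discount numRounds X I with hs
  have h1 := I.socialCost_le_proxyCost s (Nat.le_ceil X.max)
  have h2 := I.proxyCost_le_potential s
  have h3 := I.potential_iterate_le hρ hO (I.initial O) (numRounds X.max I.N)
  change I.potential s ≤ _ at h3
  have h4 := I.proxyCost_initial_le (by linarith) hO
  have hopt := I.expectedOpt_nonneg
  have h5 : Real.exp (-(numRounds X.max I.N / (2 * 2 ^ X.max * I.N : ℝ)))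
      * (1 + I.N) ^ (X.max - 1) ≤ 1 := by
    have h6 : (1 + I.N : ℝ) ^ (X.max - 1) ≤ Real.exp ((X.max - 1) * I.N) := by
      rw [mul_comm, Real.exp_mul]
      refine Real.rpow_le_rpow (by positivity) ?_ (by linarith)
      linarith [Real.add_one_le_exp (I.N : ℝ)]
    calc _ ≤ Real.exp (-((X.max - 1) * I.N)) * Real.exp ((X.max - 1) * I.N) := by
          gcongr
          exact I.sub_one_mul_le_numRounds_div
      _ = 1 := by rw [← Real.exp_add]; simp
  have h7 : Real.exp (-(numRounds X.max I.N / (2 * 2 ^ X.max * I.N : ℝ)))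
      * I.proxyCost (I.initial O) ≤ ρ ^ X.max * I.expectedOpt := by
    calc _ ≤ Real.exp (-(numRounds X.max I.N / (2 * 2 ^ X.max * I.N : ℝ)))
          * ((1 + I.N) ^ (X.max - 1) * (ρ * I.expectedOpt)) := by gcongr
      _ = (Real.exp (-(numRounds X.max I.N / (2 * 2 ^ X.max * I.N : ℝ)))
          * (1 + I.N) ^ (X.max - 1)) * (ρ * I.expectedOpt) := by ring
      _ ≤ 1 * (ρ * I.expectedOpt) := by
          have : 0 ≤ ρ * I.expectedOpt := mul_nonneg (by linarith) hopt
          gcongr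
      _ ≤ ρ ^ X.max * I.expectedOpt := by
          rw [one_mul]
          gcongr
          exact Real.self_le_rpow_of_one_le hρ ha.le
  calc I.socialCost s ≤ (1 + 2 ^ (⌈X.max⌉₊ ^ 2)) * (X.max * I.potential s) :=
        h1.trans (by gcongr)
    _ ≤ (1 + 2 ^ (⌈X.max⌉₊ ^ 2)) * (X.max * ((3 * (2 ^ X.max) ^ 2) ^ X.max * ρ ^ X.max
          * I.expectedOpt + ρ ^ X.max * I.expectedOpt)) := by
        have h8 := h3.trans (add_le_add_right h7 _)
        gcongr
    _ = _ := by rw [ratioBound]; ring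

end Instance

theorem Problem.bcr_bayesABRD_le (P : Problem) {ρ : ℝ} {O : ActionProcedure} (hρ : 1 ≤ ρ)
    (hO : P.IsActionOracle ρ O) (X : Exponents) :
    P.bcr (bayesABRD P O discount numRounds) X
      ≤ ENNReal.ofReal (ratioBound X.max * ρ ^ X.max) := by
  refine sInf_le ⟨_, ⟨?_, fun I => I.socialCost_bayesABRD_le hρ hO⟩, rfl⟩
  have ha := X.one_lt_max
  have h1 : 1 ≤ ρ ^ X.max := Real.one_le_rpow hρ (by linarith)
  have h2 : 1 ≤ ratioBound X.max := by
    refine one_le_mul_of_one_le_of_one_le (le_add_of_nonneg_right (by positivity)) ?_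
    exact one_le_mul_of_one_le_of_one_le ha.le (le_add_of_nonneg_left (by positivity))
  exact one_le_mul_of_one_le_of_one_le h2 h1

/-! ### Encoding lengths of rational numbers -/

/-- `x` is a rational number of denominator and absolute value at most `2 ^ ℓ`. Up to a constant
factor, `ℓ` bounds the encoding length; unlike the latter, this bound grows only additively
under addition. -/
def BoundedRat (ℓ : ℕ) (x : ℝ) : Prop := ∃ y : ℚ, (y : ℝ) = x ∧ y.den ≤ 2 ^ ℓ ∧ |y| ≤ 2 ^ ℓ

theorem natCast_natAbs_num (r : ℚ) : (r.num.natAbs : ℚ) = |r| * r.den := by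
  rw [Nat.cast_natAbs, Int.cast_abs, ← Rat.mul_den_eq_num, abs_mul, Nat.abs_cast]

namespace BoundedRat

variable {a b ℓ : ℕ} {x y : ℝ}

theorem mono (h : BoundedRat a x) (hab : a ≤ b) : BoundedRat b x := by
  obtain ⟨r, hr, h1, h2⟩ := h
  exact ⟨r, hr, h1.trans (Nat.pow_le_pow_right (by norm_num) hab),
    h2.trans (pow_le_pow_right₀ (by norm_num) hab)⟩

theorem zero : BoundedRat ℓ 0 := ⟨0, by simp, by simpa using Nat.one_le_two_pow, by simp⟩

theorem natCast (n : ℕ) (hn : n ≤ ℓ) : BoundedRat ℓ n := by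
  refine ⟨n, by simp, by simpa using Nat.one_le_two_pow, ?_⟩
  rw [Nat.abs_cast]
  exact_mod_cast Nat.lt_two_pow_self.le.trans (Nat.pow_le_pow_right (by norm_num) hn)

theorem neg (h : BoundedRat a x) : BoundedRat a (-x) := by
  obtain ⟨r, rfl, h1, h2⟩ := h
  exact ⟨-r, by simp, by simpa using h1, by simpa using h2⟩

theorem add (hx : BoundedRat a x) (hy : BoundedRat b y) : BoundedRat (a + b + 1) (x + y) := by
  obtain ⟨r, rfl, h1, h2⟩ := hx
  obtain ⟨s, rfl, h3, h4⟩ := hy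
  refine ⟨r + s, by simp, ?_, ?_⟩
  · have h5 : (r + s).den ≤ r.den * s.den :=
      Nat.le_of_dvd (Nat.mul_pos r.den_pos s.den_pos) (Rat.add_den_dvd r s)
    refine h5.trans ((Nat.mul_le_mul h1 h3).trans ?_)
    rw [← pow_add]
    exact Nat.pow_le_pow_right (by norm_num) (by omega)
  · refine (abs_add_le r s).trans ((add_le_add h2 h4).trans ?_)
    have h5 : (2 : ℚ) ^ a ≤ 2 ^ (a + b) := pow_le_pow_right₀ (by norm_num) (by omega)
    have h6 : (2 : ℚ) ^ b ≤ 2 ^ (a + b) := pow_le_pow_right₀ (by norm_num) (by omega)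
    rw [pow_succ]
    linarith

theorem sub (hx : BoundedRat a x) (hy : BoundedRat b y) : BoundedRat (a + b + 1) (x - y) := by
  rw [sub_eq_add_neg]
  exact hx.add hy.neg

theorem mul (hx : BoundedRat a x) (hy : BoundedRat b y) : BoundedRat (a + b) (x * y) := by
  obtain ⟨r, rfl, h1, h2⟩ := hx
  obtain ⟨s, rfl, h3, h4⟩ := hy
  refine ⟨r * s, by simp, ?_, ?_⟩
  · have h5 : (r * s).den ≤ r.den * s.den :=
      Nat.le_of_dvd (Nat.mul_pos r.den_pos s.den_pos) (Rat.mul_den_dvd r s)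
    rw [pow_add]
    exact h5.trans (Nat.mul_le_mul h1 h3)
  · rw [abs_mul, pow_add]
    exact mul_le_mul h2 h4 (abs_nonneg s) (by positivity)

/-- The new denominator is the old numerator, which is at most `|x|` times the old denominator. -/
theorem inv (hx : BoundedRat a x) : BoundedRat (2 * a) x⁻¹ := by
  obtain ⟨r, rfl, h1, h2⟩ := hx
  rcases eq_or_ne r 0 with rfl | hr
  · simpa using zero
  have h0 : (0 : ℚ) < r.den := by exact_mod_cast r.den_pos
  have h1' : (r.den : ℚ) ≤ 2 ^ a := by exact_mod_cast h1
  have hnum := natCast_natAbs_num r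
  refine ⟨r⁻¹, by simp, ?_, ?_⟩
  · rw [Rat.den_inv_of_ne_zero hr]
    have : (r.num.natAbs : ℚ) ≤ 2 ^ (2 * a) := by
      rw [hnum, two_mul, pow_add]
      exact mul_le_mul h2 h1' h0.le (by positivity)
    exact_mod_cast this
  · have h3 : (1 : ℚ) ≤ r.num.natAbs := by
      exact_mod_cast Nat.one_le_iff_ne_zero.2 (Int.natAbs_ne_zero.2 (Rat.num_ne_zero.2 hr))
    rw [hnum] at h3
    have h4 : 0 < |r| := abs_pos.2 hr
    rw [abs_inv, inv_le_iff_one_le_mul₀ h4]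
    have h5 : (2 : ℚ) ^ a ≤ 2 ^ (2 * a) := pow_le_pow_right₀ (by norm_num) (by omega)
    nlinarith

theorem div (hx : BoundedRat a x) (hy : BoundedRat b y) : BoundedRat (a + 2 * b) (x / y) := by
  rw [div_eq_mul_inv]
  exact hx.mul hy.inv

theorem pow (hx : BoundedRat a x) (k : ℕ) : BoundedRat (k * a) (x ^ k) := by
  induction k with
  | zero => exact ⟨1, by simp, by simp, by simp⟩
  | succ k ih =>
    rw [pow_succ, Nat.succ_mul]
    exact ih.mul hx

theorem sum {ι : Type*} (s : Finset ι) (f : ι → ℝ) (h : ∀ i ∈ s, BoundedRat a (f i)) :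
    BoundedRat (s.card * (a + 1)) (∑ i ∈ s, f i) := by
  classical
  induction s using Finset.induction_on with
  | empty => simpa using zero
  | insert i s hi ih =>
    rw [Finset.sum_insert hi, Finset.card_insert_of_notMem hi]
    refine ((h i (Finset.mem_insert_self i s)).add
      (ih fun j hj => h j (Finset.mem_insert_of_mem hj))).mono (le_of_eq (by ring))

theorem ite (p : Prop) [Decidable p] (hx : BoundedRat a x) :
    BoundedRat a (if p then x else 0) := by
  split_ifs
  · exact hx
  · exact zero

theorem ratLen_le {r : ℚ} (h1 : r.den ≤ 2 ^ ℓ) (h2 : |r| ≤ 2 ^ ℓ) : ratLen r ≤ 3 * ℓ + 3 := by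
  have h0 : (0 : ℚ) < r.den := by exact_mod_cast r.den_pos
  have h1' : (r.den : ℚ) ≤ 2 ^ ℓ := by exact_mod_cast h1
  have hnum := natCast_natAbs_num r
  have h3 : r.num.natAbs ≤ 2 ^ (2 * ℓ) := by
    have : (r.num.natAbs : ℚ) ≤ 2 ^ (2 * ℓ) := by
      rw [hnum, two_mul, pow_add]
      exact mul_le_mul h2 h1' h0.le (by positivity)
    exact_mod_cast this
  have h4 : r.num.natAbs.size ≤ 2 * ℓ + 1 :=
    Nat.size_le.2 (h3.trans_lt (Nat.pow_lt_pow_right (by norm_num) (by omega)))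
  have h5 : r.den.size ≤ ℓ + 1 :=
    Nat.size_le.2 (h1.trans_lt (Nat.pow_lt_pow_right (by norm_num) (by omega)))
  unfold ratLen
  omega

theorem rationalOfLength (h : BoundedRat ℓ x) : RationalOfLength (3 * ℓ + 3) x := by
  obtain ⟨r, hr, h1, h2⟩ := h
  exact ⟨r, hr, ratLen_le h1 h2⟩

theorem bitLen_le (h : BoundedRat ℓ x) : bitLen x ≤ 3 * ℓ + 3 := by
  obtain ⟨r, hr, h1, h2⟩ := h
  have hex : ∃ y : ℚ, (y : ℝ) = x := ⟨r, hr⟩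
  have : hex.choose = r := by
    have := hex.choose_spec.trans hr.symm
    exact_mod_cast this
  rw [bitLen, dif_pos hex, this]
  exact ratLen_le h1 h2

end BoundedRat

theorem RationalOfLength.boundedRat {L : ℕ} {x : ℝ} (h : RationalOfLength L x) :
    BoundedRat L x := by
  obtain ⟨r, hr, hL⟩ := h
  unfold ratLen at hL
  have h1 : r.den < 2 ^ L := Nat.size_le.1 (by omega)
  have h2 : r.num.natAbs < 2 ^ L := Nat.size_le.1 (by omega)
  refine ⟨r, hr, h1.le, ?_⟩
  have h0 : (1 : ℚ) ≤ r.den := by exact_mod_cast r.den_pos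
  have hnum := natCast_natAbs_num r
  have h2' : (r.num.natAbs : ℚ) ≤ 2 ^ L := by exact_mod_cast h2.le
  have := abs_nonneg r
  nlinarith

/-! ### Frames -/

/-- A memory location: a register or a whole array. -/
inductive Loc
  | n (x : ℕ)
  | r (x : ℕ)
  | na (a : ℕ)
  | ra (a : ℕ)

/-- The location to which an instruction writes. -/
def Instr.target : Instr → Loc
  | .nconst x _ => .n x
  | .ncopy x _ => .n x
  | .nsucc x => .n x
  | .npred x => .n x
  | .nload x _ _ _ _ => .n x
  | .nstore a _ _ _ _ => .na a
  | .rconst x _ => .r x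
  | .rcopy x _ => .r x
  | .rop _ z _ _ => .r z
  | .rpow z _ _ => .r z
  | .rload x _ _ _ _ => .r x
  | .rstore a _ _ _ _ => .ra a
  | .query _ _ _ b => .na b

/-- The locations that occur as targets in a program. -/
def Cmd.Writes : Cmd → Loc → Prop
  | .skip, _ => False
  | .instr c, l => c.target = l
  | .seq p p', l => p.Writes l ∨ p'.Writes l
  | .ifR _ _ p p', l => p.Writes l ∨ p'.Writes l
  | .ifN _ _ p p', l => p.Writes l ∨ p'.Writes l
  | .whileN _ _ p, l => p.Writes l

/-- Two stores agree at a location. -/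
def Store.SameAt (σ τ : Store) : Loc → Prop
  | .n x => τ.n x = σ.n x
  | .r x => τ.r x = σ.r x
  | .na a => τ.na a = σ.na a
  | .ra a => τ.ra a = σ.ra a

theorem Store.SameAt.rfl {σ : Store} {l : Loc} : σ.SameAt σ l := by
  cases l <;> simp [Store.SameAt]

theorem Store.SameAt.trans {σ τ υ : Store} {l : Loc} (h : σ.SameAt τ l) (h' : τ.SameAt υ l) :
    σ.SameAt υ l := by
  cases l <;> simp only [Store.SameAt] at * <;> exact h'.trans h

/-- The stores agree at all locations outside `W`. -/
def Frame (W : Loc → Prop) (σ τ : Store) : Prop := ∀ l, ¬ W l → σ.SameAt τ l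

namespace Frame

variable {W V : Loc → Prop} {σ τ υ : Store}

theorem rfl : Frame W σ σ := fun _ _ => .rfl

theorem trans (h : Frame W σ τ) (h' : Frame W τ υ) : Frame W σ υ :=
  fun l hl => (h l hl).trans (h' l hl)

theorem mono (h : Frame W σ τ) (hWV : ∀ l, W l → V l) : Frame V σ τ :=
  fun l hl => h l fun hW => hl (hWV l hW)

theorem n (h : Frame W σ τ) (x : ℕ) (hx : ¬ W (.n x)) : τ.n x = σ.n x := h _ hx

theorem r (h : Frame W σ τ) (x : ℕ) (hx : ¬ W (.r x)) : τ.r x = σ.r x := h _ hx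

theorem na (h : Frame W σ τ) (x : ℕ) (hx : ¬ W (.na x)) : τ.na x = σ.na x := h _ hx

theorem ra (h : Frame W σ τ) (x : ℕ) (hx : ¬ W (.ra x)) : τ.ra x = σ.ra x := h _ hx

theorem setN {x v : ℕ} (hx : W (.n x)) : Frame W σ (σ.setN x v) := by
  intro l hl
  cases l with
  | n y => exact Function.update_of_ne (by rintro rfl; exact hl hx) _ _
  | _ => rfl

theorem setR {x : ℕ} {v : ℝ} (hx : W (.r x)) : Frame W σ (σ.setR x v) := by
  intro l hl
  cases l with
  | r y => exact Function.update_of_ne (by rintro rfl; exact hl hx) _ _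
  | _ => rfl

theorem setNA {a i j k v : ℕ} (ha : W (.na a)) : Frame W σ (σ.setNA a i j k v) := by
  intro l hl
  cases l with
  | na y =>
    funext i' j' k'
    exact if_neg (by rintro ⟨rfl, -⟩; exact hl ha)
  | _ => rfl

theorem setRA {a i j k : ℕ} {v : ℝ} (ha : W (.ra a)) : Frame W σ (σ.setRA a i j k v) := by
  intro l hl
  cases l with
  | ra y =>
    funext i' j' k'
    exact if_neg (by rintro ⟨rfl, -⟩; exact hl ha)
  | _ => rfl

theorem setSet {a m : ℕ} {s : Finset (Fin m)} (ha : W (.na a)) : Frame W σ (σ.setSet a s) := by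
  intro l hl
  cases l with
  | na y =>
    funext i' j' k'
    exact dif_neg (by rintro ⟨rfl, -⟩; exact hl ha)
  | _ => rfl

end Frame

theorem Instr.frame {E : Env} {c : Instr} {σ σ' : Store} {b : ℕ} (h : c.run E σ = some (σ', b)) :
    Frame (fun l => c.target = l) σ σ' := by
  cases c
  case rop o z x y =>
    simp only [Instr.run, Option.map_eq_some_iff] at h
    obtain ⟨v, -, h⟩ := h
    obtain ⟨rfl, -⟩ := Prod.mk.inj h
    exact .setR rfl
  case rpow z x j =>
    simp only [Instr.run] at h
    split_ifs at h
    obtain ⟨rfl, -⟩ := Prod.mk.inj (Option.some.inj h)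
    exact .setR rfl
  case query i t w b' =>
    simp only [Instr.run, Option.map_eq_some_iff] at h
    obtain ⟨v, -, h⟩ := h
    obtain ⟨rfl, -⟩ := Prod.mk.inj h
    exact .setSet rfl
  all_goals
    simp only [Instr.run] at h
    obtain ⟨rfl, -⟩ := Prod.mk.inj (Option.some.inj h)
    first
    | exact .setN rfl
    | exact .setR rfl
    | exact .setNA rfl
    | exact .setRA rfl

theorem Exec.frame {E : Env} {p : Cmd} {σ σ' : Store} {t b : ℕ} (h : Exec E p σ σ' t b) :
    Frame p.Writes σ σ' := by
  induction h with
  | skip σ => exact .rfl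
  | instr h => exact Instr.frame h
  | seq _ _ ih ih' =>
    exact (ih.mono fun _ => Or.inl).trans (ih'.mono fun _ => Or.inr)
  | ifR_true _ _ ih => exact ih.mono fun _ => Or.inl
  | ifR_false _ _ ih => exact ih.mono fun _ => Or.inr
  | ifN_true _ _ ih => exact ih.mono fun _ => Or.inl
  | ifN_false _ _ ih => exact ih.mono fun _ => Or.inr
  | while_true _ _ _ ih ih' => exact ih.trans ih'
  | while_false _ => exact .rfl

/-! ### Rules for runs of programs -/

namespace Store

variable (σ : Store)

@[simp] theorem setN_n (x v y : ℕ) : (σ.setN x v).n y = if y = x then v else σ.n y :=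
  Function.update_apply _ _ _ _
@[simp] theorem setN_r (x v : ℕ) : (σ.setN x v).r = σ.r := rfl
@[simp] theorem setN_na (x v : ℕ) : (σ.setN x v).na = σ.na := rfl
@[simp] theorem setN_ra (x v : ℕ) : (σ.setN x v).ra = σ.ra := rfl
@[simp] theorem setR_r (x : ℕ) (v : ℝ) (y : ℕ) : (σ.setR x v).r y = if y = x then v else σ.r y :=
  Function.update_apply _ _ _ _
@[simp] theorem setR_n (x : ℕ) (v : ℝ) : (σ.setR x v).n = σ.n := rfl
@[simp] theorem setR_na (x : ℕ) (v : ℝ) : (σ.setR x v).na = σ.na := rfl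
@[simp] theorem setR_ra (x : ℕ) (v : ℝ) : (σ.setR x v).ra = σ.ra := rfl
@[simp] theorem setNA_n (a i j k v : ℕ) : (σ.setNA a i j k v).n = σ.n := rfl
@[simp] theorem setNA_r (a i j k v : ℕ) : (σ.setNA a i j k v).r = σ.r := rfl
@[simp] theorem setNA_ra (a i j k v : ℕ) : (σ.setNA a i j k v).ra = σ.ra := rfl
@[simp] theorem setNA_na (a i j k v a' i' j' k' : ℕ) : (σ.setNA a i j k v).na a' i' j' k'
    = if a' = a ∧ i' = i ∧ j' = j ∧ k' = k then v else σ.na a' i' j' k' := rfl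
@[simp] theorem setRA_n (a i j k : ℕ) (v : ℝ) : (σ.setRA a i j k v).n = σ.n := rfl
@[simp] theorem setRA_r (a i j k : ℕ) (v : ℝ) : (σ.setRA a i j k v).r = σ.r := rfl
@[simp] theorem setRA_na (a i j k : ℕ) (v : ℝ) : (σ.setRA a i j k v).na = σ.na := rfl
@[simp] theorem setRA_ra (a i j k : ℕ) (v : ℝ) (a' i' j' k' : ℕ) :
    (σ.setRA a i j k v).ra a' i' j' k'
      = if a' = a ∧ i' = i ∧ j' = j ∧ k' = k then v else σ.ra a' i' j' k' := rfl

end Store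

infixr:60 " ;; " => Cmd.seq

/-- `for x = 0, …, n y - 1`. -/
def Cmd.forN (x y : ℕ) (p : Cmd) : Cmd :=
  .instr (.nconst x 0) ;; .whileN x y (p ;; .instr (.nsucc x))

/-- The sum, in the real register `z`, over `x = 0, …, n y - 1` of the numbers that `p` leaves in
the real register `r`. -/
def Cmd.sumN (x y z r : ℕ) (p : Cmd) : Cmd :=
  .instr (.rconst z 0) ;; .forN x y (p ;; .instr (.rop .add z z r))

/-- For `x = 0, …, n y - 1`, store the number that `p` leaves in the real register `r` in the real
array `a`; the index register `z` is expected to hold zero. -/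
def Cmd.fillN (x y a z r : ℕ) (p : Cmd) : Cmd :=
  .forN x y (p ;; .instr (.rstore a x z z r))

attribute [simp] Cmd.Writes Instr.target

@[simp] theorem Cmd.writes_forN (x y : ℕ) (p : Cmd) (l : Loc) :
    (Cmd.forN x y p).Writes l ↔ Loc.n x = l ∨ p.Writes l := by
  simp only [Cmd.forN, Cmd.Writes, Instr.target]
  tauto

@[simp] theorem Cmd.writes_sumN (x y z r : ℕ) (p : Cmd) (l : Loc) :
    (Cmd.sumN x y z r p).Writes l ↔ Loc.r z = l ∨ Loc.n x = l ∨ p.Writes l := by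
  simp only [Cmd.sumN, Cmd.Writes, Instr.target, Cmd.writes_forN]
  tauto

@[simp] theorem Cmd.writes_fillN (x y a z r : ℕ) (p : Cmd) (l : Loc) :
    (Cmd.fillN x y a z r p).Writes l ↔ Loc.n x = l ∨ Loc.ra a = l ∨ p.Writes l := by
  simp only [Cmd.fillN, Cmd.Writes, Instr.target, Cmd.writes_forN]
  tauto

/-- Total correctness with resource bounds: `p`, started in `σ`, halts after at most `t` steps in a
store that satisfies `Q`; and provided that `rat` (the input is rational), the numbers written have
encoding length at most `3 ℓ + 3`, as numbers do that are `BoundedRat ℓ`. -/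
def Run (E : Env) (rat : Prop) (ℓ : ℕ) (p : Cmd) (σ : Store) (t : ℕ) (Q : Store → Prop) : Prop :=
  ∃ σ' t' b, Exec E p σ σ' t' b ∧ t' ≤ t ∧ (rat → b ≤ 3 * ℓ + 3) ∧ Q σ'

namespace Run

variable {E : Env} {rat : Prop} {ℓ : ℕ} {p p' : Cmd} {σ : Store} {t t' : ℕ}
  {Q Q' : Store → Prop}

theorem le (h : Run E rat ℓ p σ t Q) (ht : t ≤ t') : Run E rat ℓ p σ t' Q := by
  obtain ⟨σ', t'', b, h1, h2, h3⟩ := h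
  exact ⟨σ', t'', b, h1, h2.trans ht, h3⟩

/-- The locations to which the program does not write keep their values. -/
theorem call (h : Run E rat ℓ p σ t Q') (hQ : ∀ τ, Frame p.Writes σ τ → Q' τ → Q τ) :
    Run E rat ℓ p σ t Q := by
  obtain ⟨σ', t', b, h1, h2, h3, h4⟩ := h
  exact ⟨σ', t', b, h1, h2, h3, hQ σ' h1.frame h4⟩

theorem skip (h : Q σ) : Run E rat ℓ .skip σ 1 Q :=
  ⟨σ, 1, 0, .skip σ, le_rfl, fun _ => Nat.zero_le _, h⟩

theorem seq (h : Run E rat ℓ p σ t fun τ => Run E rat ℓ p' τ t' Q) :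
    Run E rat ℓ (p ;; p') σ (t + t') Q := by
  obtain ⟨σ', t1, b1, h1, h2, h3, σ'', t2, b2, h4, h5, h6, h7⟩ := h
  exact ⟨σ'', t1 + t2, max b1 b2, .seq h1 h4, add_le_add h2 h5, fun h => max_le (h3 h) (h6 h), h7⟩

theorem ifN {x y : ℕ} (h : σ.n x < σ.n y → Run E rat ℓ p σ t Q)
    (h' : σ.n y ≤ σ.n x → Run E rat ℓ p' σ t' Q) :
    Run E rat ℓ (.ifN x y p p') σ (t + t' + 1) Q := by
  by_cases hxy : σ.n x < σ.n y
  · obtain ⟨σ', t1, b1, h1, h2, h3⟩ := h hxy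
    exact ⟨σ', t1 + 1, b1, .ifN_true hxy h1, by omega, h3⟩
  · obtain ⟨σ', t1, b1, h1, h2, h3⟩ := h' (not_lt.1 hxy)
    exact ⟨σ', t1 + 1, b1, .ifN_false hxy h1, by omega, h3⟩

theorem ifR {x y : ℕ} (h : σ.r x ≤ σ.r y → Run E rat ℓ p σ t Q)
    (h' : σ.r y < σ.r x → Run E rat ℓ p' σ t' Q) :
    Run E rat ℓ (.ifR x y p p') σ (t + t' + 1) Q := by
  by_cases hxy : σ.r x ≤ σ.r y
  · obtain ⟨σ', t1, b1, h1, h2, h3⟩ := h hxy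
    exact ⟨σ', t1 + 1, b1, .ifR_true hxy h1, by omega, h3⟩
  · obtain ⟨σ', t1, b1, h1, h2, h3⟩ := h' (not_le.1 hxy)
    exact ⟨σ', t1 + 1, b1, .ifR_false hxy h1, by omega, h3⟩

theorem nconst {x v : ℕ} (h : Q (σ.setN x v)) : Run E rat ℓ (.instr (.nconst x v)) σ 1 Q :=
  ⟨_, 1, 0, .instr rfl, le_rfl, fun _ => Nat.zero_le _, h⟩

theorem ncopy {x y : ℕ} (h : Q (σ.setN x (σ.n y))) : Run E rat ℓ (.instr (.ncopy x y)) σ 1 Q :=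
  ⟨_, 1, 0, .instr rfl, le_rfl, fun _ => Nat.zero_le _, h⟩

theorem nsucc {x : ℕ} (h : Q (σ.setN x (σ.n x + 1))) : Run E rat ℓ (.instr (.nsucc x)) σ 1 Q :=
  ⟨_, 1, 0, .instr rfl, le_rfl, fun _ => Nat.zero_le _, h⟩

theorem nload {x a i j k : ℕ} (h : Q (σ.setN x (σ.na a (σ.n i) (σ.n j) (σ.n k)))) :
    Run E rat ℓ (.instr (.nload x a i j k)) σ 1 Q :=
  ⟨_, 1, 0, .instr rfl, le_rfl, fun _ => Nat.zero_le _, h⟩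

theorem nstore {a i j k x : ℕ} (h : Q (σ.setNA a (σ.n i) (σ.n j) (σ.n k) (σ.n x))) :
    Run E rat ℓ (.instr (.nstore a i j k x)) σ 1 Q :=
  ⟨_, 1, 0, .instr rfl, le_rfl, fun _ => Nat.zero_le _, h⟩

theorem rconst {x v : ℕ} (hv : v ≤ ℓ) (h : Q (σ.setR x v)) :
    Run E rat ℓ (.instr (.rconst x v)) σ 1 Q :=
  ⟨_, 1, _, .instr rfl, le_rfl, fun _ => (BoundedRat.natCast v hv).bitLen_le, h⟩

theorem rcopy {x y : ℕ} (hb : rat → BoundedRat ℓ (σ.r y)) (h : Q (σ.setR x (σ.r y))) :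
    Run E rat ℓ (.instr (.rcopy x y)) σ 1 Q :=
  ⟨_, 1, _, .instr rfl, le_rfl, fun hr => (hb hr).bitLen_le, h⟩

theorem rload {x a i j k : ℕ} {v : ℝ} (hv : σ.ra a (σ.n i) (σ.n j) (σ.n k) = v)
    (hb : rat → BoundedRat ℓ v) (h : Q (σ.setR x v)) :
    Run E rat ℓ (.instr (.rload x a i j k)) σ 1 Q := by
  subst hv
  exact ⟨_, 1, _, .instr rfl, le_rfl, fun hr => (hb hr).bitLen_le, h⟩

theorem rstore {a i j k x : ℕ} (hb : rat → BoundedRat ℓ (σ.r x))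
    (h : Q (σ.setRA a (σ.n i) (σ.n j) (σ.n k) (σ.r x))) :
    Run E rat ℓ (.instr (.rstore a i j k x)) σ 1 Q :=
  ⟨_, 1, _, .instr rfl, le_rfl, fun hr => (hb hr).bitLen_le, h⟩

theorem rop {o : ArithOp} {z x y : ℕ} {v : ℝ} (hv : o.eval (σ.r x) (σ.r y) = some v)
    (hb : rat → BoundedRat ℓ v) (h : Q (σ.setR z v)) :
    Run E rat ℓ (.instr (.rop o z x y)) σ 1 Q :=
  ⟨σ.setR z v, 1, bitLen v, .instr (by simp [Instr.run, hv]), le_rfl,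
    fun hr => (hb hr).bitLen_le, h⟩

theorem rpow {z x j : ℕ} {v : ℝ} (hj : σ.n j < E.q) (hx : 0 ≤ σ.r x)
    (hv : σ.r x ^ E.α ⟨σ.n j, hj⟩ = v) (hb : rat → BoundedRat ℓ v) (h : Q (σ.setR z v)) :
    Run E rat ℓ (.instr (.rpow z x j)) σ 1 Q := by
  subst hv
  exact ⟨_, 1, _, .instr (by rw [Instr.run, dif_pos ⟨hj, hx⟩]), le_rfl,
    fun hr => (hb hr).bitLen_le, h⟩

/-- A loop with the invariant `Inv`. The bound `M` on the number of passes may be generous. -/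
theorem forN {x y n M : ℕ} (Inv : ℕ → Store → Prop) (hn : σ.n y = n) (hM : n ≤ M) (hxy : x ≠ y)
    (hx : ¬ p.Writes (.n x)) (hy : ¬ p.Writes (.n y))
    (hInv : ∀ k τ v, Inv k τ → Inv k (τ.setN x v)) (h0 : Inv 0 σ)
    (hstep : ∀ k : Fin n, ∀ τ, Frame (Cmd.forN x y p).Writes σ τ → τ.n x = k → Inv k τ →
      Run E rat ℓ p τ t (Inv (k + 1))) :
    Run E rat ℓ (.forN x y p) σ (M * (t + 2) + 2) (Inv n) := by
  have hy' : ¬ (Cmd.forN x y p).Writes (.n y) := by simp [hxy, hy]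
  have key : ∀ d k τ, k + d = n → Frame (Cmd.forN x y p).Writes σ τ → τ.n x = k → Inv k τ →
      Run E rat ℓ (.whileN x y (p ;; .instr (.nsucc x))) τ (d * (t + 2) + 1) (Inv n) := by
    intro d
    induction d with
    | zero =>
      intro k τ hk hF hkx hI
      rw [add_zero] at hk
      subst hk
      exact ⟨τ, 1, 0, .while_false (by rw [hF.n y hy', hkx, hn]; exact lt_irrefl _), by omega,
        fun _ => Nat.zero_le _, hI⟩
    | succ d ih =>
      intro k τ hk hF hkx hI
      obtain ⟨τ', t1, b1, h1, h2, h3, h4⟩ := hstep ⟨k, by omega⟩ τ hF hkx hI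
      have hF' : Frame p.Writes τ τ' := h1.frame
      have hx' : τ'.n x = k := by rw [hF'.n x hx, hkx]
      obtain ⟨τ'', t2, b2, h5, h6, h7, h8⟩ := ih (k + 1) (τ'.setN x (τ'.n x + 1)) (by omega)
        ((hF.trans (hF'.mono fun l hl => by simp [hl])).trans (.setN (by simp)))
        (by simp [hx']) (hInv _ _ _ h4)
      refine ⟨τ'', _, _, .while_true (by rw [hF.n y hy', hkx, hn]; omega)
        (.seq h1 (.instr (c := .nsucc x) rfl)) h5, ?_, fun hr => ?_, h8⟩
      · simp only [Instr.time]
        rw [Nat.succ_mul]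
        omega
      · exact max_le (max_le (h3 hr) (Nat.zero_le _)) (h7 hr)
  refine Run.le (t := 1 + (n * (t + 2) + 1)) (seq (nconst ?_)) ?_
  · exact key n 0 _ (by omega) (.setN (by simp)) (by simp) (hInv _ _ _ h0)
  · have := Nat.mul_le_mul_right (t + 2) hM
    omega

theorem sumN {x y z r n M : ℕ} (f : Fin n → ℝ) {a : ℕ} (hn : σ.n y = n) (hM : n ≤ M) (hxy : x ≠ y)
    (hx : ¬ p.Writes (.n x)) (hy : ¬ p.Writes (.n y)) (hz : ¬ p.Writes (.r z)) (hℓ : M * (a + 1) ≤ ℓ)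
    (hf : rat → ∀ k, BoundedRat a (f k))
    (hstep : ∀ k : Fin n, ∀ τ, Frame (Cmd.sumN x y z r p).Writes σ τ → τ.n x = k →
      Run E rat ℓ p τ t fun τ' => τ'.r r = f k) :
    Run E rat ℓ (.sumN x y z r p) σ (M * (t + 3) + 3) fun τ => τ.r z = ∑ k, f k := by
  refine Run.le (t := 1 + (M * (t + 1 + 2) + 2)) (seq (rconst (Nat.zero_le _) ?_)) (by linarith)
  refine call (forN (M := M)
    (fun k τ => τ.r z = ∑ i ∈ Finset.univ.filter (fun i : Fin n => i.val < k), f i)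
    (by simpa using hn) hM hxy (by simpa using hx) (by simpa using hy) (fun k τ v h => by simpa using h)
    (by simp) fun k τ hF hk hI => seq (call (hstep k τ ?_ hk) fun τ' hF' hr => ?_))
    fun τ hF hI => by simpa using hI
  · refine Frame.trans (.setR (by simp)) (hF.mono fun l => ?_)
    simp only [Cmd.writes_forN, Cmd.writes_sumN, Cmd.Writes, Instr.target]
    tauto
  · have hsum : ∑ i ∈ Finset.univ.filter (fun i : Fin n => i.val < k.val + 1), f i
        = ∑ i ∈ Finset.univ.filter (fun i : Fin n => i.val < k.val), f i + f k := by
      have : Finset.univ.filter (fun i : Fin n => i.val < k.val + 1)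
          = insert k (Finset.univ.filter fun i : Fin n => i.val < k.val) := by
        ext i
        simp only [Finset.mem_filter, Finset.mem_univ, true_and, Finset.mem_insert, Fin.ext_iff]
        omega
      rw [this, Finset.sum_insert (by simp), add_comm]
    refine rop (v := ∑ i ∈ Finset.univ.filter (fun i : Fin n => i.val < k.val + 1), f i) ?_
      (fun hr => ?_) (by simp)
    · rw [hF'.r z hz, hI, hr, hsum]
      rfl
    · refine (BoundedRat.sum _ f fun i _ => hf hr i).mono (le_trans ?_ hℓ)
      refine Nat.mul_le_mul_right _ (le_trans ?_ hM)
      exact (Finset.card_le_univ _).trans (by simp)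

theorem fillN {x y a z r n M : ℕ} (f : Fin n → ℝ) (hn : σ.n y = n) (hM : n ≤ M) (hxy : x ≠ y)
    (hz0 : σ.n z = 0) (hxz : z ≠ x)
    (hx : ¬ p.Writes (.n x)) (hy : ¬ p.Writes (.n y)) (hz : ¬ p.Writes (.n z))
    (ha : ¬ p.Writes (.ra a)) (hf : rat → ∀ k, BoundedRat ℓ (f k))
    (hstep : ∀ k : Fin n, ∀ τ, Frame (Cmd.fillN x y a z r p).Writes σ τ → τ.n x = k →
      Run E rat ℓ p τ t fun τ' => τ'.r r = f k) :
    Run E rat ℓ (.fillN x y a z r p) σ (M * (t + 3) + 2)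
      fun τ => ∀ k : Fin n, τ.ra a k 0 0 = f k := by
  refine Run.le (t := M * (t + 1 + 2) + 2) ?_ (by linarith)
  refine call (forN (M := M)
    (fun k τ => ∀ i : Fin n, i.val < k → τ.ra a i 0 0 = f i) hn hM hxy (by simpa using hx)
    (by simpa using hy) (fun k τ v h => by simpa using h) (by simp)
    fun k τ hF hk hI => seq (call (hstep k τ hF hk) fun τ' hF' hr => ?_))
    fun τ hF hI i => hI i i.2
  have hz' : τ'.n z = 0 := by
    rw [hF'.n z hz, hF.n z (by simp [hxz.symm, hz]), hz0]
  refine rstore (fun h => hr ▸ hf h k) fun i hi => ?_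
  rw [hz', hF'.n x hx, hk, hr]
  by_cases hik : i = k
  · simp [hik]
  · have : i.val ≠ k.val := fun h => hik (Fin.ext h)
    simp only [Store.setRA_ra, true_and, and_true, this, if_false]
    rw [hF'.ra a ha, hI i (by omega)]

/-- A loop that iterates a map. -/
theorem iterate {S : Type*} (g : S → S) (s : S) (Inv : S → Store → Prop) {x y n M : ℕ}
    (hn : σ.n y = n) (hM : n ≤ M) (hxy : x ≠ y) (hx : ¬ p.Writes (.n x)) (hy : ¬ p.Writes (.n y))
    (hInv : ∀ s τ v, Inv s τ → Inv s (τ.setN x v)) (h0 : Inv s σ)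
    (hstep : ∀ s τ, Frame (Cmd.forN x y p).Writes σ τ → Inv s τ → Run E rat ℓ p τ t (Inv (g s))) :
    Run E rat ℓ (.forN x y p) σ (M * (t + 2) + 2) (Inv (g^[n] s)) :=
  forN (fun k => Inv (g^[k] s)) hn hM hxy hx hy (fun _ τ v => hInv _ τ v) h0
    fun k τ hF _ hI => by
      rw [Function.iterate_succ_apply']
      exact hstep _ τ hF hI

end Run

/-! ### Encoding lengths in the dynamics -/

theorem powers_le {S : ℕ} (hS : 1 ≤ S) :
    S ≤ S ^ 2 ∧ S ^ 2 ≤ S ^ 3 ∧ S ^ 3 ≤ S ^ 4 ∧ S ^ 4 ≤ S ^ 5 ∧ S ^ 5 ≤ S ^ 6 ∧ S ^ 6 ≤ S ^ 7 ∧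
      S ^ 7 ≤ S ^ 8 := by
  refine ⟨?_, ?_, ?_, ?_, ?_, ?_, ?_⟩
  · exact Nat.le_self_pow (by norm_num) S
  all_goals exact Nat.pow_le_pow_right hS (by norm_num)

namespace Instance

variable {P : Problem} {X : Exponents} (I : Instance P X)

/-- The data of the instance are rational numbers of length at most `S`, and the exponents are
integers, at most `S`. -/
structure BoundedData (S : ℕ) : Prop where
  prob : ∀ i t, BoundedRat S (I.prob i t)
  ξ : ∀ e j, BoundedRat S (I.ξ e j)
  α : ∀ j, ∃ k : ℕ, X.α j = k ∧ k ≤ S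

theorem one_le_size : 1 ≤ I.size := by unfold size; omega

theorem N_le_size : I.N ≤ I.size := by unfold size; omega

theorem m_le_size : I.m ≤ I.size := by unfold size; omega

theorem q_le_size : X.q ≤ I.size := by unfold size; omega

theorem numTypes_le_size (i : Fin I.N) : I.numTypes i ≤ I.size := by
  have := Finset.single_le_sum (f := I.numTypes) (fun _ _ => Nat.zero_le _) (Finset.mem_univ i)
  unfold size
  omega

variable {S : ℕ} {I}

namespace BoundedData

theorem hit (h : I.BoundedData S) (hS : I.size ≤ S) (i : Fin I.N)
    (b : Fin (I.numTypes i) → Finset (Fin I.m)) (e : Fin I.m) :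
    BoundedRat (2 * S ^ 2) (I.hit i b e) := by
  refine (BoundedRat.sum Finset.univ _ fun t _ => (h.prob i t).ite _).mono ?_
  have h1 := I.one_le_size
  have h2 := (I.numTypes_le_size i).trans hS
  rw [Finset.card_univ, Fintype.card_fin]
  nlinarith

theorem one_add_othersLoad (h : I.BoundedData S) (hS : I.size ≤ S) (s : I.Profile) (i : Fin I.N)
    (e : Fin I.m) : BoundedRat (5 * S ^ 3) (1 + I.othersLoad s i e) := by
  obtain ⟨h1, h2, h3, -⟩ := powers_le (I.one_le_size.trans hS)
  have h4 := I.one_le_size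
  have h5 : (Finset.univ.erase i).card ≤ S :=
    (Finset.card_le_univ _).trans (by simpa using I.N_le_size.trans hS)
  have h6 := (BoundedRat.natCast 1 le_rfl).add
    (BoundedRat.sum (Finset.univ.erase i) _ fun i' _ => h.hit hS i' (s i') e)
  rw [Nat.cast_one] at h6
  refine h6.mono ?_
  have h7 := Nat.mul_le_mul_right (2 * S ^ 2 + 1) h5
  nlinarith

theorem rpow (h : I.BoundedData S) {a : ℕ} {x : ℝ} (hx : BoundedRat a x) (j : Fin X.q) :
    BoundedRat (S * a) (x ^ X.α j) := by
  obtain ⟨k, hk, hkS⟩ := h.α j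
  rw [hk, Real.rpow_natCast]
  exact (hx.pow k).mono (Nat.mul_le_mul_right a hkS)

theorem shareEst_term (h : I.BoundedData S) (hS : I.size ≤ S) (s : I.Profile) (i : Fin I.N)
    (e : Fin I.m) (j : Fin X.q) :
    BoundedRat (15 * S ^ 4) ((1 + I.othersLoad s i e) ^ (X.α j - 1)) := by
  obtain ⟨h1, h2, h3, h4, -⟩ := powers_le (I.one_le_size.trans hS)
  have h0 := I.othersLoad_nonneg s i e
  rw [Real.rpow_sub_one (by linarith)]
  refine ((h.rpow (h.one_add_othersLoad hS s i e) j).div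
    (h.one_add_othersLoad hS s i e)).mono ?_
  nlinarith

theorem shareEst (h : I.BoundedData S) (hS : I.size ≤ S) (s : I.Profile) (i : Fin I.N)
    (e : Fin I.m) : BoundedRat (17 * S ^ 5) (I.shareEst s i e) := by
  obtain ⟨h1, h2, h3, h4, -⟩ := powers_le (I.one_le_size.trans hS)
  refine (BoundedRat.sum Finset.univ _ fun j _ =>
    (h.ξ e j).mul (h.shareEst_term hS s i e j)).mono ?_
  rw [Finset.card_univ, Fintype.card_fin]
  have h5 := Nat.mul_le_mul_right (S + 15 * S ^ 4 + 1) (I.q_le_size.trans hS)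
  have h6 := I.one_le_size
  nlinarith

theorem sum_ξ (h : I.BoundedData S) (hS : I.size ≤ S) (e : Fin I.m) :
    BoundedRat (17 * S ^ 5) (∑ j, I.ξ e j) := by
  obtain ⟨h1, h2, h3, h4, -⟩ := powers_le (I.one_le_size.trans hS)
  refine (BoundedRat.sum Finset.univ _ fun j _ => h.ξ e j).mono ?_
  rw [Finset.card_univ, Fintype.card_fin]
  have h5 := Nat.mul_le_mul_right (S + 1) (I.q_le_size.trans hS)
  have h6 := I.one_le_size
  nlinarith

theorem sum_mem (_ : I.BoundedData S) (hS : I.size ≤ S) {w : Fin I.m → ℝ}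
    (hw : ∀ e, BoundedRat (17 * S ^ 5) (w e)) (b : Finset (Fin I.m)) :
    BoundedRat (18 * S ^ 6) (∑ e, if e ∈ b then w e else 0) := by
  obtain ⟨h1, h2, h3, h4, h5, -⟩ := powers_le (I.one_le_size.trans hS)
  refine (BoundedRat.sum Finset.univ _ fun e _ => (hw e).ite _).mono ?_
  rw [Finset.card_univ, Fintype.card_fin]
  have h6 := Nat.mul_le_mul_right (17 * S ^ 5 + 1) (I.m_le_size.trans hS)
  have h7 := I.one_le_size
  nlinarith

theorem prob_mul_sum_mem (h : I.BoundedData S) (hS : I.size ≤ S) {w : Fin I.m → ℝ}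
    (hw : ∀ e, BoundedRat (17 * S ^ 5) (w e)) (i : Fin I.N) (t : Fin (I.numTypes i))
    (b : Finset (Fin I.m)) :
    BoundedRat (19 * S ^ 6) (I.prob i t * ∑ e, if e ∈ b then w e else 0) := by
  obtain ⟨h1, h2, h3, h4, h5, -⟩ := powers_le (I.one_le_size.trans hS)
  exact ((h.prob i t).mul (h.sum_mem hS hw b)).mono (by omega)

theorem costEst (h : I.BoundedData S) (hS : I.size ≤ S) (s : I.Profile) (i : Fin I.N)
    (b : Fin (I.numTypes i) → Finset (Fin I.m)) :
    BoundedRat (20 * S ^ 7) (I.costEst s i b) := by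
  obtain ⟨h1, h2, h3, h4, h5, h6, -⟩ := powers_le (I.one_le_size.trans hS)
  unfold Instance.costEst
  refine (BoundedRat.sum (a := 19 * S ^ 6) Finset.univ _ fun t _ => ?_).mono ?_
  · have := h.prob_mul_sum_mem hS (h.shareEst hS s i) i t (b t)
    simpa using this
  · rw [Finset.card_univ, Fintype.card_fin]
    have h7 := Nat.mul_le_mul_right (19 * S ^ 6 + 1) ((I.numTypes_le_size i).trans hS)
    have h8 := I.one_le_size
    nlinarith

theorem two_rpow (h : I.BoundedData S) (j : Fin X.q) : BoundedRat (2 * S) ((2 : ℝ) ^ X.α j) := by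
  have h1 := h.rpow (BoundedRat.natCast 2 le_rfl) j
  rw [Nat.cast_two] at h1
  exact h1.mono (by omega)

end BoundedData

end Instance

theorem Exponents.exists_eq_max (X : Exponents) : ∃ j, X.α j = X.max := by
  obtain ⟨j, -⟩ := X.exists_one_lt
  have : Nonempty (Fin X.q) := ⟨j⟩
  exact exists_eq_ciSup_of_finite

namespace Instance.BoundedData

variable {P : Problem} {X : Exponents} {I : Instance P X} {S : ℕ}

theorem discount (h : I.BoundedData S) : BoundedRat (2 * S) ((2 : ℝ) ^ X.max) := by
  obtain ⟨j, hj⟩ := X.exists_eq_max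
  rw [← hj]
  exact h.two_rpow j

theorem discount_mul (h : I.BoundedData S) (hS : I.size ≤ S) (s : I.Profile) (i : Fin I.N)
    (b : Fin (I.numTypes i) → Finset (Fin I.m)) :
    BoundedRat (22 * S ^ 7) (2 ^ X.max * I.costEst s i b) := by
  obtain ⟨h1, h2, h3, h4, h5, h6, -⟩ := powers_le (I.one_le_size.trans hS)
  exact (h.discount.mul (h.costEst hS s i b)).mono (by omega)

theorem gain (h : I.BoundedData S) (hS : I.size ≤ S) (O : ActionProcedure) (s : I.Profile)
    (i : Fin I.N) : BoundedRat (43 * S ^ 7) (I.gain O (2 ^ X.max) s i) := by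
  obtain ⟨h1, h2, h3, h4, h5, h6, -⟩ := powers_le (I.one_le_size.trans hS)
  have h7 := I.one_le_size
  exact ((h.costEst hS s i _).sub (h.discount_mul hS s i _)).mono (by omega)

end Instance.BoundedData

/-! ### Programs that ask queries -/

/-- No location of `D` is a target in `p`. -/
def Cmd.Avoids (p : Cmd) (D : Loc → Prop) : Prop := ∀ l, p.Writes l → ¬ D l

section

variable {D : Loc → Prop}

@[simp] theorem Cmd.avoids_skip : Cmd.skip.Avoids D := fun _ h => h.elim

@[simp] theorem Cmd.avoids_instr (c : Instr) : (Cmd.instr c).Avoids D ↔ ¬ D c.target := by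
  simp [Cmd.Avoids]

@[simp] theorem Cmd.avoids_seq (p p' : Cmd) :
    (p ;; p').Avoids D ↔ p.Avoids D ∧ p'.Avoids D := by
  simp only [Cmd.Avoids, Cmd.Writes, or_imp, forall_and]

@[simp] theorem Cmd.avoids_ifN (x y : ℕ) (p p' : Cmd) :
    (Cmd.ifN x y p p').Avoids D ↔ p.Avoids D ∧ p'.Avoids D := by
  simp only [Cmd.Avoids, Cmd.Writes, or_imp, forall_and]

@[simp] theorem Cmd.avoids_ifR (x y : ℕ) (p p' : Cmd) :
    (Cmd.ifR x y p p').Avoids D ↔ p.Avoids D ∧ p'.Avoids D := by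
  simp only [Cmd.Avoids, Cmd.Writes, or_imp, forall_and]

@[simp] theorem Cmd.avoids_whileN (x y : ℕ) (p : Cmd) :
    (Cmd.whileN x y p).Avoids D ↔ p.Avoids D := Iff.rfl

@[simp] theorem Cmd.avoids_forN (x y : ℕ) (p : Cmd) :
    (Cmd.forN x y p).Avoids D ↔ ¬ D (.n x) ∧ p.Avoids D := by
  simp [Cmd.forN]
  tauto

@[simp] theorem Cmd.avoids_sumN (x y z r : ℕ) (p : Cmd) :
    (Cmd.sumN x y z r p).Avoids D ↔ ¬ D (.r z) ∧ ¬ D (.n x) ∧ p.Avoids D := by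
  simp [Cmd.sumN]
  tauto

@[simp] theorem Cmd.avoids_fillN (x y a z r : ℕ) (p : Cmd) :
    (Cmd.fillN x y a z r p).Avoids D ↔ ¬ D (.n x) ∧ ¬ D (.ra a) ∧ p.Avoids D := by
  simp [Cmd.fillN]
  tauto

end

/-- The locations of the input and of constants. The index registers `0`, `1`, `2` and the arrays
hold the input. For the others see `Setting.Ready`. -/
def FixedLoc : Loc → Prop
  | .n x => x ∈ [0, 1, 2, 3, 22]
  | .r x => x ∈ [14, 18, 19]
  | .na a => a ∈ [0, 1, 2]
  | .ra a => a ∈ [0, 1, 2]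

/-- The environment of an instance, with an arbitrary oracle. -/
def Instance.env {P : Problem} {X : Exponents} (I : Instance P X)
    (query : ℕ → ℕ → (Fin I.m → ℝ) → Option (Finset (Fin I.m))) : Env where
  q := X.q
  α := X.α
  m := I.m
  query := query

/-- A way of answering the queries of the dynamics by a command `ask`, which is given the agent and
the type in the index registers `10` and `11` and the weights in the real array `3`, and leaves the
answer in the index array `4`; together with bounds on the resources: `tq` for the time of an
answer, `M` for the number of passes through a loop, and `ℓ` for the encoding lengths if `rat`
holds, in which case those of the input are at most `S`. The input contains, besides the numbers,
what `extra` says. The registers and arrays with names from `30` on are at the disposal of `ask`. -/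
structure Setting {P : Problem} {X : Exponents} (I : Instance P X) (O : ActionProcedure) where
  query : ℕ → ℕ → (Fin I.m → ℝ) → Option (Finset (Fin I.m))
  rat : Prop
  ℓ : ℕ
  M : ℕ
  S : ℕ
  ask : Cmd
  extra : Store → Prop
  tq : ℕ
  size_le : I.size ≤ M
  ceil_le : ⌈(2 : ℝ) ^ X.max⌉₊ ≤ M
  M_le : M ≤ S
  le_ℓ : 50 * S ^ 8 ≤ ℓ
  data : rat → I.BoundedData S
  ask_n : ∀ x < 30, ¬ ask.Writes (.n x)
  ask_r : ∀ x < 30, ¬ ask.Writes (.r x)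
  ask_na : ∀ a < 30, a ≠ 4 → ¬ ask.Writes (.na a)
  ask_ra : ∀ a < 30, ¬ ask.Writes (.ra a)
  extra_congr : ∀ σ τ : Store, τ.na 1 = σ.na 1 → τ.na 2 = σ.na 2 → extra σ → extra τ
  run_ask : ∀ (σ : Store) (i : Fin I.N) (t : Fin (I.numTypes i)) (w : Fin I.m → ℝ), I.Loaded σ →
    extra σ → σ.n 3 = 0 → σ.n 10 = i → σ.n 11 = t → (∀ e : Fin I.m, σ.ra 3 e 0 0 = w e) →
    (∀ e, 0 ≤ w e) → (rat → ∀ e, BoundedRat (17 * S ^ 5) (w e)) →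
    Run (I.env query) rat ℓ ask σ tq fun τ =>
      ∀ e : Fin I.m, τ.na 4 e 0 0 = if e ∈ O I.m (I.req i t) w then 1 else 0

namespace Setting

variable {P : Problem} {X : Exponents} {I : Instance P X} {O : ActionProcedure} (T : Setting I O)

/-- Runs in the environment and within the resource bounds of the setting. -/
abbrev Run (p : Cmd) (σ : Store) (t : ℕ) (Q : Store → Prop) : Prop :=
  BGND.Run (I.env T.query) T.rat T.ℓ p σ t Q

/-- The input and the constants are in their places. -/
structure Ready (σ : Store) : Prop where
  loaded : I.Loaded σ
  extra : T.extra σ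
  zero : σ.n 3 = 0
  ceil : σ.n 22 = ⌈(2 : ℝ) ^ X.max⌉₊
  discount : σ.r 14 = 2 ^ X.max
  rzero : σ.r 18 = 0
  agents : σ.r 19 = I.N

theorem Ready.frame {T : Setting I O} {σ τ : Store} (h : T.Ready σ) {p : Cmd}
    (hF : Frame p.Writes σ τ) (hp : p.Avoids FixedLoc) : T.Ready τ := by
  have hp' : ∀ l, FixedLoc l → ¬ p.Writes l := fun l hl hW => hp l hW hl
  obtain ⟨⟨a1, a2, a3, a4, a5, a6, a7⟩, h2, h3, h4, h5, h6, h7⟩ := h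
  have n := fun x hx => hF.n x (hp' (.n x) hx)
  have r := fun x hx => hF.r x (hp' (.r x) hx)
  have na := fun x hx => hF.na x (hp' (.na x) hx)
  have ra := fun x hx => hF.ra x (hp' (.ra x) hx)
  simp only [FixedLoc] at n r na ra
  refine ⟨⟨?_, ?_, ?_, ?_, ?_, ?_, ?_⟩,
    T.extra_congr σ τ (na 1 (by simp)) (na 2 (by simp)) h2, ?_, ?_, ?_, ?_, ?_⟩
  · rwa [n 0 (by simp)]
  · rwa [n 1 (by simp)]
  · rwa [n 2 (by simp)]
  · rwa [na 0 (by simp)]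
  · rwa [ra 0 (by simp)]
  · rwa [ra 1 (by simp)]
  · rwa [ra 2 (by simp)]
  · rwa [n 3 (by simp)]
  · rwa [n 22 (by simp)]
  · rwa [r 14 (by simp)]
  · rwa [r 18 (by simp)]
  · rwa [r 19 (by simp)]

theorem ask_avoids : T.ask.Avoids FixedLoc := by
  rintro (x | x | x | x) hW <;> intro hx <;> simp only [FixedLoc, List.mem_cons,
    List.not_mem_nil, or_false] at hx
  · exact T.ask_n x (by omega) hW
  · exact T.ask_r x (by omega) hW
  · exact T.ask_na x (by omega) (by omega) hW
  · exact T.ask_ra x (by omega) hW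

theorem size_le_S : I.size ≤ T.S := T.size_le.trans T.M_le

theorem one_le_S : 1 ≤ T.S := I.one_le_size.trans T.size_le_S

theorem le_ℓ_of_le {a : ℕ} (h : a ≤ 50 * T.S ^ 8) : a ≤ T.ℓ := h.trans T.le_ℓ

end Setting

/-! ### Components of the program -/

/-- The probability that the action of the agent in register `14` contains the resource in register
`12`, in the real register `2`. -/
def hitCmd : Cmd :=
  .instr (.nload 16 0 14 3 3) ;;
  .sumN 15 16 2 3 (.instr (.nload 6 3 14 15 12) ;;
    .ifN 3 6 (.instr (.rload 3 0 14 15 3)) (.instr (.rconst 3 0)))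

/-- One plus the expected load of the resource in register `12` caused by the agents other than the
one in register `10`, in the real register `1`. With only strict comparisons of indices at hand,
that two agents differ is tested in both directions. -/
def othersCmd : Cmd :=
  .sumN 14 0 1 2 (.ifN 14 10 hitCmd (.ifN 10 14 hitCmd (.instr (.rconst 2 0)))) ;;
  .instr (.rconst 4 1) ;; .instr (.rop .add 1 4 1)

/-- The estimated cost share of the agent in register `10` on the resource in register `12`, in the
real register `5`. As only powers `x ^ α_j` are available, `x ^ (α_j - 1)` is computed by
a division. -/
def shareCmd : Cmd :=
  othersCmd ;;
  .sumN 13 2 5 6 (.instr (.rpow 6 1 13) ;; .instr (.rop .div 6 6 1) ;;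
    .instr (.rload 7 1 12 13 3) ;; .instr (.rop .mul 6 7 6))

/-- The estimated cost shares of the agent in register `10`, in the real array `3`. -/
def weightsCmd : Cmd := .fillN 12 1 3 3 5 shareCmd

/-- The weights for the initial profile, in the real array `3`. -/
def initialWeightsCmd : Cmd := .fillN 12 1 3 3 5 (.sumN 13 2 5 6 (.instr (.rload 6 1 12 13 3)))

namespace Setting

variable {P : Problem} {X : Exponents} {I : Instance P X} {O : ActionProcedure} (T : Setting I O)
variable {σ : Store}

theorem run_hitCmd (hσ : T.Ready σ) {s : I.Profile} (hs : I.Outputs σ s) (i : Fin I.N) (e : Fin I.m)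
    (hi : σ.n 14 = i) (he : σ.n 12 = e) :
    T.Run hitCmd σ (7 * T.M + 4) fun τ => τ.r 2 = I.hit i (s i) e := by
  have hS := T.one_le_S
  obtain ⟨h1, h2, h3, h4, h5, h6, h7⟩ := powers_le hS
  refine Run.le (.seq (.nload ?_)) (t := 1 + (T.M * (4 + 3) + 3)) (by omega)
  have hb : T.rat → ∀ t : Fin (I.numTypes i),
      BoundedRat T.S (if e ∈ s i t then I.prob i t else 0) := fun hr t =>
    ((T.data hr).prob i t).ite _
  refine Run.sumN (fun t : Fin (I.numTypes i) => if e ∈ s i t then I.prob i t else 0) (a := T.S)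
    (by simp [hi, hσ.zero, hσ.loaded.2.2.2.1 i]) ((I.numTypes_le_size i).trans T.size_le)
    (by simp) (by simp) (by simp) (by simp) (T.le_ℓ_of_le ?_) hb fun t τ hF ht => ?_
  · have := Nat.mul_le_mul_right (T.S + 1) T.M_le
    nlinarith
  · have h14 : τ.n 14 = i := by rw [hF.n 14 (by simp)]; simp [hi]
    have h12 : τ.n 12 = e := by rw [hF.n 12 (by simp)]; simp [he]
    have hn3 : τ.n 3 = 0 := by rw [hF.n 3 (by simp)]; simp [hσ.zero]
    have hna : τ.na 3 = σ.na 3 := by rw [hF.na 3 (by simp)]; simp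
    have hra : τ.ra 0 = σ.ra 0 := by rw [hF.ra 0 (by simp)]; simp
    refine Run.seq (.nload (.ifN (fun hlt => .rload (v := I.prob i t) ?_ (fun hr => ?_) ?_)
      fun hle => .rconst (Nat.zero_le _) ?_))
    · simp [h14, ht, hn3, hra, hσ.loaded.2.2.2.2.1 i t]
    · exact ((T.data hr).prob i t).mono (T.le_ℓ_of_le (by omega))
    · simp only [Store.setN_n, h14, h12, hna, hn3, ht, hs i t e] at hlt
      by_cases h : e ∈ s i t <;> simp_all
    · simp only [Store.setN_n, h14, h12, hna, hn3, ht, hs i t e] at hle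
      by_cases h : e ∈ s i t <;> simp_all

theorem run_othersCmd (hσ : T.Ready σ) {s : I.Profile} (hs : I.Outputs σ s) (i : Fin I.N)
    (e : Fin I.m) (hi : σ.n 10 = i) (he : σ.n 12 = e) :
    T.Run othersCmd σ (T.M * (14 * T.M + 14) + 5)
      fun τ => τ.r 1 = 1 + I.othersLoad s i e := by
  have hS := T.one_le_S
  obtain ⟨h1, h2, h3, h4, h5, h6, h7⟩ := powers_le hS
  refine Run.le (.seq (.call (Run.sumN (fun i' : Fin I.N => if i' ≠ i then I.hit i' (s i') e else 0)
    (t := 14 * T.M + 11)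
    (a := 2 * T.S ^ 2) hσ.loaded.1 (I.N_le_size.trans T.size_le) (by simp) (by simp [hitCmd])
    (by simp [hitCmd]) (by simp [hitCmd]) (T.le_ℓ_of_le ?_)
    (fun hr i' => ((T.data hr).hit T.size_le_S i' (s i') e).ite _) fun i' τ hF ht => ?_)
    fun τ hF hr => .seq (.rconst (T.le_ℓ_of_le (by omega)) (.rop (v := 1 + I.othersLoad s i e)
      ?_ (fun h => ?_) (by simp))))) (by linarith)
  · have := Nat.mul_le_mul_right (2 * T.S ^ 2 + 1) T.M_le
    nlinarith
  · have h10 : τ.n 10 = i := by rw [hF.n 10 (by simp [hitCmd]), hi]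
    have h12 : τ.n 12 = e := by rw [hF.n 12 (by simp [hitCmd]), he]
    have hna : τ.na 3 = σ.na 3 := hF.na 3 (by simp [hitCmd])
    have hτ : T.Ready τ := hσ.frame hF (by simp [hitCmd, FixedLoc])
    have hs' : I.Outputs τ s := by intro i t e; rw [hna]; exact hs i t e
    refine Run.le (Run.ifN (fun h => .call (T.run_hitCmd hτ hs' i' e ht h12) fun υ _ h' => ?_)
      fun h => .ifN (fun h0 => .call (T.run_hitCmd hτ hs' i' e ht h12) fun υ _ h' => ?_)
        fun h0 => .rconst (Nat.zero_le _) ?_) (by linarith)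
    · rw [ht, h10] at h
      rw [h', if_pos (by rintro rfl; exact lt_irrefl _ h)]
    · rw [ht, h10] at h0
      rw [h', if_pos (by rintro rfl; exact lt_irrefl _ h0)]
    · rw [ht, h10] at h h0
      rw [if_neg (not_not.2 (Fin.ext (le_antisymm h0 h)))]
      simp
  · have hsum : ∑ i' : Fin I.N, (if i' ≠ i then I.hit i' (s i') e else 0)
        = I.othersLoad s i e := by
      rw [← Finset.sum_filter]
      exact Finset.sum_congr (by ext; simp) fun _ _ => rfl
    rw [hsum] at hr
    simp [ArithOp.eval, hr]
  · exact ((T.data h).one_add_othersLoad T.size_le_S s i e).mono (T.le_ℓ_of_le (by omega))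

end Setting

/-- Ask for the actions of all types of the agent in register `10`, for the weights in the real
array `3`, and write them to the rows of this agent in the index array `a`. -/
def answersCmd (ask : Cmd) (a : ℕ) : Cmd :=
  .instr (.nload 4 0 10 3 3) ;;
  .forN 11 4 (ask ;; .forN 12 1 (.instr (.nload 6 4 12 3 3) ;; .instr (.nstore a 10 11 12 6)))

/-- The expected weight of the actions of the agent in register `10` according to the index array
`a`, for the weights in the real array `3`, in the real register `z`. -/
def costCmd (a z : ℕ) : Cmd :=
  .instr (.nload 4 0 10 3 3) ;;
  .sumN 11 4 z 9
    (.sumN 12 1 10 11 (.instr (.nload 6 a 10 11 12) ;;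
        .ifN 3 6 (.instr (.rload 11 3 12 3 3)) (.instr (.rconst 11 0))) ;;
      .instr (.rload 12 0 10 11 3) ;; .instr (.rop .mul 9 12 10))

/-- The estimated improvement of the agent in register `10`, in the real register `15`. -/
def gainCmd (ask : Cmd) : Cmd :=
  answersCmd ask 5 ;; costCmd 3 8 ;; costCmd 5 13 ;;
  .instr (.rop .mul 13 14 13) ;; .instr (.rop .sub 15 8 13)

/-- The estimated improvements of all agents, in the real array `4`. -/
def gainsCmd (ask : Cmd) : Cmd := .fillN 10 0 4 3 15 (weightsCmd ;; gainCmd ask)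

/-- The sum of the estimated improvements, in the real register `16`. -/
def totalCmd : Cmd := .sumN 10 0 16 15 (.instr (.rload 15 4 10 3 3))

/-- The first eligible agent, or the number of agents if there is none, in register `17`. The sum of
the estimated improvements is compared with `N` times the improvement of the agent. -/
def selectCmd : Cmd :=
  .instr (.ncopy 17 0) ;;
  .forN 10 0 (.ifN 17 0 .skip (.instr (.rload 15 4 10 3 3) ;;
    .ifR 15 18 .skip (.instr (.rop .mul 20 19 15) ;;
      .ifR 16 20 (.instr (.ncopy 17 10)) .skip)))

/-- One round of the dynamics. -/
def roundCmd (ask : Cmd) : Cmd :=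
  gainsCmd ask ;; totalCmd ;; selectCmd ;;
  .ifN 17 0 (.instr (.ncopy 10 17) ;; weightsCmd ;; answersCmd ask 3) .skip

namespace Setting

variable {P : Problem} {X : Exponents} {I : Instance P X} {O : ActionProcedure} (T : Setting I O)
variable {σ : Store}

theorem one_le_M : 1 ≤ T.M := I.one_le_size.trans T.size_le

theorem run_shareCmd (hσ : T.Ready σ) {s : I.Profile} (hs : I.Outputs σ s) (i : Fin I.N)
    (e : Fin I.m) (hi : σ.n 10 = i) (he : σ.n 12 = e) :
    T.Run shareCmd σ (43 * T.M ^ 2) fun τ => τ.r 5 = I.shareEst s i e := by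
  have hS := T.one_le_S
  have hM := T.one_le_M
  obtain ⟨h1, h2, h3, h4, h5, h6, h7⟩ := powers_le hS
  have hx0 : 0 < 1 + I.othersLoad s i e := by linarith [I.othersLoad_nonneg s i e]
  refine Run.le (.seq (.call (T.run_othersCmd hσ hs i e hi he) fun τ hF hr => Run.sumN (t := 4)
    (fun j => I.ξ e j * (1 + I.othersLoad s i e) ^ (X.α j - 1)) (a := 16 * T.S ^ 4) ?_
    (I.q_le_size.trans T.size_le) (by simp) (by simp) (by simp) (by simp) (T.le_ℓ_of_le ?_)
    (fun hr j => (((T.data hr).ξ e j).mul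
      ((T.data hr).shareEst_term T.size_le_S s i e j)).mono (by omega)) ?_)) (by nlinarith)
  · rw [hF.n 2 (by simp [othersCmd, hitCmd])]
    exact hσ.loaded.2.2.1
  · have := Nat.mul_le_mul_right (16 * T.S ^ 4 + 1) T.M_le
    nlinarith
  · intro j υ hF' hj
    have hx : υ.r 1 = 1 + I.othersLoad s i e := by rw [hF'.r 1 (by simp), hr]
    have h12 : υ.n 12 = e := by
      rw [hF'.n 12 (by simp), hF.n 12 (by simp [othersCmd, hitCmd]), he]
    have h3 : υ.n 3 = 0 := by
      rw [hF'.n 3 (by simp), hF.n 3 (by simp [othersCmd, hitCmd]), hσ.zero]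
    have hra : υ.ra 1 = σ.ra 1 := by
      rw [hF'.ra 1 (by simp), hF.ra 1 (by simp [othersCmd, hitCmd])]
    refine Run.seq (.rpow (v := (1 + I.othersLoad s i e) ^ X.α j) (by rw [hj]; exact j.2) ?_ ?_
      (fun hr => ?_) (.seq (.rop (v := (1 + I.othersLoad s i e) ^ (X.α j - 1)) ?_ (fun hr => ?_)
        (.seq (.rload (v := I.ξ e j) ?_ (fun hr => ?_)
          (.rop (v := I.ξ e j * (1 + I.othersLoad s i e) ^ (X.α j - 1)) ?_ (fun hr => ?_) ?_))))))
    · rw [hx]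
      exact hx0.le
    · rw [hx]
      congr 2
      exact Fin.ext hj
    · exact ((T.data hr).rpow ((T.data hr).one_add_othersLoad T.size_le_S s i e) j).mono
        (T.le_ℓ_of_le (by nlinarith))
    · simp [ArithOp.eval, hx, hx0.ne', Real.rpow_sub_one hx0.ne']
    · exact ((T.data hr).shareEst_term T.size_le_S s i e j).mono (T.le_ℓ_of_le (by omega))
    · simp [hra, h12, hj, h3, hσ.loaded.2.2.2.2.2.1 e j]
    · exact ((T.data hr).ξ e j).mono (T.le_ℓ_of_le (by omega))
    · simp [ArithOp.eval]
    · exact (((T.data hr).ξ e j).mul ((T.data hr).shareEst_term T.size_le_S s i e j)).mono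
        (T.le_ℓ_of_le (by omega))
    · simp

theorem run_weightsCmd (hσ : T.Ready σ) {s : I.Profile} (hs : I.Outputs σ s) (i : Fin I.N)
    (hi : σ.n 10 = i) :
    T.Run weightsCmd σ (48 * T.M ^ 3) fun τ => ∀ e : Fin I.m, τ.ra 3 e 0 0 = I.shareEst s i e := by
  have hM := T.one_le_M
  obtain ⟨h1, h2, h3, h4, h5, h6, h7⟩ := powers_le T.one_le_S
  have hM2 := powers_le hM
  refine Run.le (Run.fillN (t := 43 * T.M ^ 2) (I.shareEst s i) hσ.loaded.2.1
    (I.m_le_size.trans T.size_le)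
    (by simp) hσ.zero (by simp) (by simp [shareCmd, othersCmd, hitCmd])
    (by simp [shareCmd, othersCmd, hitCmd]) (by simp [shareCmd, othersCmd, hitCmd])
    (by simp [shareCmd, othersCmd, hitCmd]) (fun hr e =>
      ((T.data hr).shareEst T.size_le_S s i e).mono (T.le_ℓ_of_le (by omega)))
    fun e τ hF he => T.run_shareCmd ?_ ?_ i e ?_ he) (by nlinarith)
  · exact hσ.frame hF (by simp [shareCmd, othersCmd, hitCmd, FixedLoc])
  · intro i t e
    rw [hF.na 3 (by simp [shareCmd, othersCmd, hitCmd])]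
    exact hs i t e
  · rw [hF.n 10 (by simp [shareCmd, othersCmd, hitCmd]), hi]

theorem run_initialWeightsCmd (hσ : T.Ready σ) :
    T.Run initialWeightsCmd σ (12 * T.M ^ 2) fun τ => ∀ e : Fin I.m, τ.ra 3 e 0 0 = ∑ j, I.ξ e j := by
  have hM := T.one_le_M
  obtain ⟨h1, h2, h3, h4, h5, h6, h7⟩ := powers_le T.one_le_S
  have hM2 := powers_le hM
  refine Run.le (Run.fillN (t := T.M * 4 + 3) (fun e => ∑ j, I.ξ e j) hσ.loaded.2.1
    (I.m_le_size.trans T.size_le)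
    (by simp) hσ.zero (by simp) (by simp) (by simp) (by simp) (by simp) (fun hr e =>
      ((T.data hr).sum_ξ T.size_le_S e).mono (T.le_ℓ_of_le (by omega)))
    fun e τ hF he => Run.sumN (t := 1) (I.ξ e) (a := T.S) ?_ (I.q_le_size.trans T.size_le)
      (by simp) (by simp) (by simp) (by simp) (T.le_ℓ_of_le ?_) (fun hr j => (T.data hr).ξ e j)
      fun j υ hF' hj => .rload ?_ (fun hr => ((T.data hr).ξ e j).mono (T.le_ℓ_of_le (by omega)))
        (by simp)) (by nlinarith)
  · rw [hF.n 2 (by simp)]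
    exact hσ.loaded.2.2.1
  · have := Nat.mul_le_mul_right (T.S + 1) T.M_le
    nlinarith
  · rw [hF'.ra 1 (by simp), hF.ra 1 (by simp), hF'.n 12 (by simp), he, hj, hF'.n 3 (by simp),
      hF.n 3 (by simp), hσ.zero]
    exact hσ.loaded.2.2.2.2.2.1 e j

theorem run_answersCmd (hσ : T.Ready σ) {a : ℕ} (ha : a = 3 ∨ a = 5) {w : Fin I.m → ℝ}
    (hw : ∀ e : Fin I.m, σ.ra 3 e 0 0 = w e) (hw0 : ∀ e, 0 ≤ w e)
    (hb : T.rat → ∀ e, BoundedRat (17 * T.S ^ 5) (w e)) (i : Fin I.N) (hi : σ.n 10 = i) :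
    T.Run (answersCmd T.ask a) σ (T.M * T.tq + 11 * T.M ^ 2) fun τ =>
      (∀ (t : Fin (I.numTypes i)) (e : Fin I.m),
        τ.na a i t e = if e ∈ O I.m (I.req i t) w then 1 else 0) ∧
      ∀ i' t e : ℕ, i' ≠ i → τ.na a i' t e = σ.na a i' t e := by
  have hM := T.one_le_M
  have hM2 := powers_le hM
  have ha4 : a ≠ 4 := by omega
  have haw : ¬ T.ask.Writes (.na a) := T.ask_na a (by omega) (by omega)
  have hfix : ¬ FixedLoc (.na a) := by rcases ha with rfl | rfl <;> simp [FixedLoc]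
  have hn : ∀ x < 30, ¬ T.ask.Writes (.n x) := T.ask_n
  refine Run.le (.seq (.nload (Run.call (Run.forN (t := T.tq + (T.M * (2 + 2) + 2)) (fun k τ =>
      (∀ (t : Fin (I.numTypes i)) (e : Fin I.m), t.val < k →
        τ.na a i t e = if e ∈ O I.m (I.req i t) w then 1 else 0) ∧
      ∀ i' t e : ℕ, i' ≠ i → τ.na a i' t e = σ.na a i' t e) (n := I.numTypes i)
      (by simp [hi, hσ.zero, hσ.loaded.2.2.2.1 i]) ((I.numTypes_le_size i).trans T.size_le) (by simp)
      (by simp [hn]) (by simp [hn]) (fun k τ v h => by simpa using h) (by simp)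
      fun t τ hF ht hI => Run.seq (Run.call (T.run_ask τ i t w ?_ ?_ ?_ ?_ ht ?_ hw0 hb)
        fun υ hF' hυ => ?_)) fun τ hF hI => ⟨fun t e => hI.1 t e t.2, hI.2⟩))) ?_
  rotate_right
  · nlinarith
  all_goals
    have hτ : T.Ready τ := Ready.frame (p := answersCmd T.ask a) hσ
      (Frame.trans (.setN (by simp [answersCmd])) (hF.mono fun l hl => by
        simp only [answersCmd, Cmd.Writes]
        exact Or.inr hl)) (by simp [answersCmd, FixedLoc, T.ask_avoids]; simpa [FixedLoc] using hfix)
    have h10 : τ.n 10 = i := by rw [hF.n 10 (by simp [hn])]; simp [hi]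
  · exact hτ.loaded
  · exact hτ.extra
  · exact hτ.zero
  · exact h10
  · intro e
    rw [hF.ra 3 (by simp [T.ask_ra 3])]
    simpa using hw e
  · have hυ' : T.Ready υ := hτ.frame hF' T.ask_avoids
    refine Run.call (Run.forN (t := 2) (fun k φ =>
      (∀ e : Fin I.m, e.val < k → φ.na a i t e = if e ∈ O I.m (I.req i t) w then 1 else 0) ∧
        ∀ i' t' e' : ℕ, (i' ≠ i ∨ t' ≠ t) → φ.na a i' t' e' = υ.na a i' t' e') (n := I.m)
        hυ'.loaded.2.1 (I.m_le_size.trans T.size_le) (by simp) (by simp) (by simp)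
        (fun k τ v h => by simpa using h) (by simp) fun e φ hF'' he hI' =>
          Run.seq (.nload (.nstore ?_))) fun φ hF'' hI' => ⟨?_, ?_⟩
    · have h10' : φ.n 10 = i := by
        rw [hF''.n 10 (by simp), hF'.n 10 (hn 10 (by norm_num)), h10]
      have h11' : φ.n 11 = t := by
        rw [hF''.n 11 (by simp), hF'.n 11 (hn 11 (by norm_num)), ht]
      have h3' : φ.n 3 = 0 := by rw [hF''.n 3 (by simp), hυ'.zero]
      have h4' : φ.na 4 = υ.na 4 := hF''.na 4 (by simp [ha4])
      simp only [Store.setN_n, h10', h11', he, h3', h4', hυ e, Nat.reduceEqDiff, ↓reduceIte]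
      constructor
      · intro e' he'
        by_cases hee : e' = e
        · subst hee
          simp
        · have : e'.val ≠ e.val := fun h => hee (Fin.ext h)
          simp only [Store.setNA_na, this, and_false, if_false, Store.setN_na]
          exact hI'.1 e' (by omega)
      · intro i' t' e' h
        rw [← hI'.2 i' t' e' h]
        simp only [Store.setNA_na, Store.setN_na]
        rw [if_neg]
        rintro ⟨-, rfl, rfl, -⟩
        exact h.elim (fun h => h rfl) fun h => h rfl
    · intro t' e ht'
      by_cases htt : t' = t
      · subst htt
        exact hI'.1 e e.2
      · have : t'.val ≠ t.val := fun h => htt (Fin.ext h)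
        rw [hI'.2 i t' e (Or.inr this), hF'.na a haw]
        exact hI.1 t' e (by omega)
    · intro i' t' e hi'
      rw [hI'.2 i' t' e (Or.inl hi'), hF'.na a haw]
      exact hI.2 i' t' e hi'

theorem run_costCmd (hσ : T.Ready σ) {a z : ℕ} (hz : z = 8 ∨ z = 13) {w : Fin I.m → ℝ}
    (hw : ∀ e : Fin I.m, σ.ra 3 e 0 0 = w e)
    (hb : T.rat → ∀ e, BoundedRat (17 * T.S ^ 5) (w e)) (i : Fin I.N) (hi : σ.n 10 = i)
    (b : Fin (I.numTypes i) → Finset (Fin I.m))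
    (hab : ∀ (t : Fin (I.numTypes i)) (e : Fin I.m), σ.na a i t e = if e ∈ b t then 1 else 0) :
    T.Run (costCmd a z) σ (21 * T.M ^ 2) fun τ => τ.r z = ∑ t, I.prob i t * ∑ e ∈ b t, w e := by
  have hM := T.one_le_M
  have hM2 := powers_le hM
  obtain ⟨h1, h2, h3, h4, h5, h6, h7⟩ := powers_le T.one_le_S
  have hz' : z ≠ 9 ∧ z ≠ 10 ∧ z ≠ 11 ∧ z ≠ 12 := by omega
  have hmem : ∀ t, ∑ e ∈ b t, w e = ∑ e, if e ∈ b t then w e else 0 := fun t => by simp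
  simp only [hmem]
  refine Run.le (.seq (.nload (Run.sumN (n := I.numTypes i)
    (fun t => I.prob i t * ∑ e, if e ∈ b t then w e else 0)
    (t := (T.M * (4 + 3) + 3) + (1 + 1)) (a := 19 * T.S ^ 6)
    (by simp [hi, hσ.zero, hσ.loaded.2.2.2.1 i]) ((I.numTypes_le_size i).trans T.size_le) (by simp)
    (by simp) (by simp) (by simp; omega) (T.le_ℓ_of_le ?_)
    (fun hr t => (T.data hr).prob_mul_sum_mem T.size_le_S (hb hr) i t (b t))
    fun t τ hF ht => Run.seq (Run.call (Run.sumN (n := I.m) (fun e => if e ∈ b t then w e else 0)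
      (t := 4) (a := 17 * T.S ^ 5) ?_ (I.m_le_size.trans T.size_le) (by simp) (by simp) (by simp)
      (by simp) (T.le_ℓ_of_le ?_) (fun hr e => (hb hr e).ite _) fun e υ hF' he =>
        Run.seq (.nload (.ifN (fun hlt => .rload (v := w e) ?_
          (fun hr => (hb hr e).mono (T.le_ℓ_of_le (by omega))) ?_)
        fun hle => .rconst (Nat.zero_le _) ?_))) fun υ hF' hr => ?_)))) ?_
  · have := Nat.mul_le_mul_right (19 * T.S ^ 6 + 1) T.M_le
    nlinarith
  · rw [hF.n 1 (by simp)]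
    simpa using hσ.loaded.2.1
  · have := Nat.mul_le_mul_right (17 * T.S ^ 5 + 1) T.M_le
    nlinarith
  rotate_right
  · nlinarith
  all_goals
    have h10 : τ.n 10 = i := by rw [hF.n 10 (by simp)]; simp [hi]
    have hn3 : τ.n 3 = 0 := by rw [hF.n 3 (by simp)]; simp [hσ.zero]
    have hna : τ.na a = σ.na a := by rw [hF.na a (by simp)]; simp
    have hra : τ.ra 3 = σ.ra 3 := by rw [hF.ra 3 (by simp)]; simp
    have hra0 : τ.ra 0 = σ.ra 0 := by rw [hF.ra 0 (by simp)]; simp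
  · simp [hF'.ra 3 (by simp), hra, he, hF'.n 3 (by simp), hn3, hw e]
  · simp only [Store.setN_n, hF'.na a (by simp), hna, hF'.n 10 (by simp), h10, hF'.n 11 (by simp), ht,
      hF'.n 3 (by simp), hn3, he, hab t e] at hlt
    by_cases h : e ∈ b t <;> simp_all
  · simp only [Store.setN_n, hF'.na a (by simp), hna, hF'.n 10 (by simp), h10, hF'.n 11 (by simp), ht,
      hF'.n 3 (by simp), hn3, he, hab t e] at hle
    by_cases h : e ∈ b t <;> simp_all
  · refine .seq (.rload (v := I.prob i t) ?_ (fun hr => ?_)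
      (.rop (v := I.prob i t * ∑ e, if e ∈ b t then w e else 0) ?_ (fun hr => ?_) (by simp)))
    · rw [hF'.ra 0 (by simp), hra0, hF'.n 10 (by simp), h10, hF'.n 11 (by simp), ht,
        hF'.n 3 (by simp), hn3]
      exact hσ.loaded.2.2.2.2.1 i t
    · exact ((T.data hr).prob i t).mono (T.le_ℓ_of_le (by omega))
    · simp only [ArithOp.eval, Store.setR_r, hr]
      simp
    · exact ((T.data hr).prob_mul_sum_mem T.size_le_S (hb hr) i t (b t)).mono
        (T.le_ℓ_of_le (by omega))

end Setting

/-! ### One round and the whole program -/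

/-- Compute the constants: the number of agents as a real number, the largest of the powers
`2 ^ α_j`, and its ceiling, which is found by counting. -/
def setupCmd : Cmd :=
  .instr (.nconst 3 0) ;; .instr (.rconst 18 0) ;;
  .sumN 10 0 19 20 (.instr (.rconst 20 1)) ;;
  .instr (.rconst 14 0) ;;
  .forN 13 2 (.instr (.rconst 20 2) ;; .instr (.rpow 20 20 13) ;;
    .ifR 14 20 (.instr (.rcopy 14 20)) .skip) ;;
  .instr (.nconst 22 0) ;; .instr (.rconst 21 0) ;; .instr (.rconst 20 1) ;;
  .instr (.nconst 23 0) ;; .instr (.nconst 24 1) ;;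
  .whileN 23 24 (.ifR 14 21 (.instr (.nconst 23 1))
    (.instr (.nsucc 22) ;; .instr (.rop .add 21 21 20)))

/-- The approximate best response dynamics. The number of rounds is a product, which is run through
by nested loops. -/
def mainCmd (ask : Cmd) : Cmd :=
  setupCmd ;; initialWeightsCmd ;; .forN 10 0 (answersCmd ask 3) ;;
  .forN 25 0 (.forN 26 0 (.forN 27 22 (.forN 28 22 (roundCmd ask))))

theorem Run.whileN_done {E : Env} {rat : Prop} {ℓ : ℕ} {p : Cmd} {σ : Store} {x y : ℕ}
    {Q : Store → Prop} (hxy : σ.n y ≤ σ.n x) (h : Q σ) : Run E rat ℓ (.whileN x y p) σ 1 Q :=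
  ⟨σ, 1, 0, .while_false (not_lt.2 hxy), le_rfl, fun _ => Nat.zero_le _, h⟩

theorem Run.whileN_step {E : Env} {rat : Prop} {ℓ : ℕ} {p : Cmd} {σ : Store} {x y t t' : ℕ}
    {Q : Store → Prop} (hxy : σ.n x < σ.n y)
    (h : Run E rat ℓ p σ t fun τ => Run E rat ℓ (.whileN x y p) τ t' Q) :
    Run E rat ℓ (.whileN x y p) σ (t + t' + 1) Q := by
  obtain ⟨σ', t1, b1, h1, h2, h3, σ'', t2, b2, h4, h5, h6, h7⟩ := h
  exact ⟨σ'', _, _, .while_true hxy h1 h4, by omega, fun h => max_le (h3 h) (h6 h), h7⟩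

namespace Setting

variable {P : Problem} {X : Exponents} {I : Instance P X} {O : ActionProcedure} (T : Setting I O)
variable {σ : Store}

theorem Ready.setN {T : Setting I O} (h : T.Ready σ) {x v : ℕ} (hx : ¬ FixedLoc (.n x)) :
    T.Ready (σ.setN x v) :=
  h.frame (p := .instr (.nconst x v)) (.setN (by simp)) (by simpa using hx)

theorem outputs_frame {W : Loc → Prop} {σ τ : Store} {s : I.Profile} (hs : I.Outputs σ s)
    (hF : Frame W σ τ) (hW : ¬ W (.na 3)) : I.Outputs τ s := by
  intro i t e
  rw [hF.na 3 hW]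
  exact hs i t e

theorem run_gainCmd (hσ : T.Ready σ) {s : I.Profile} (hs : I.Outputs σ s) (i : Fin I.N)
    (hi : σ.n 10 = i) (hw : ∀ e : Fin I.m, σ.ra 3 e 0 0 = I.shareEst s i e) :
    T.Run (gainCmd T.ask) σ (T.M * T.tq + 55 * T.M ^ 2)
      fun τ => τ.r 15 = I.gain O (2 ^ X.max) s i := by
  have hM := T.one_le_M
  have hM2 := powers_le hM
  obtain ⟨h1, h2, h3, h4, h5, h6, h7⟩ := powers_le T.one_le_S
  have hb : T.rat → ∀ e, BoundedRat (17 * T.S ^ 5) (I.shareEst s i e) :=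
    fun hr => (T.data hr).shareEst T.size_le_S s i
  refine Run.le (.seq (.call (T.run_answersCmd hσ (Or.inr rfl) hw (I.shareEst_nonneg s i) hb i hi)
    fun τ hF hA => ?_)) (t := (T.M * T.tq + 11 * T.M ^ 2) + (21 * T.M ^ 2 + (21 * T.M ^ 2 + (1 + 1))))
    (by nlinarith)
  have hτ : T.Ready τ := hσ.frame hF (by simp [answersCmd, FixedLoc, T.ask_avoids])
  have h10 : τ.n 10 = i := by rw [hF.n 10 (by simp [answersCmd, T.ask_n]), hi]
  have hw' : ∀ e : Fin I.m, τ.ra 3 e 0 0 = I.shareEst s i e := by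
    rw [hF.ra 3 (by simp [answersCmd, T.ask_ra])]
    exact hw
  have hs' := outputs_frame hs hF (by simp [answersCmd, T.ask_na])
  refine .seq (.call (T.run_costCmd hτ (Or.inl rfl) hw' hb i h10 (s i) (hs' i)) fun υ hF' hr => ?_)
  have hυ : T.Ready υ := hτ.frame hF' (by simp [costCmd, FixedLoc])
  have h10' : υ.n 10 = i := by rw [hF'.n 10 (by simp [costCmd]), h10]
  have hw'' : ∀ e : Fin I.m, υ.ra 3 e 0 0 = I.shareEst s i e := by
    rw [hF'.ra 3 (by simp [costCmd])]
    exact hw'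
  refine .seq (.call (T.run_costCmd hυ (Or.inr rfl) hw'' hb i h10' (I.response O s i) ?_)
    fun φ hF'' hr' => ?_)
  · rw [hF'.na 5 (by simp [costCmd])]
    exact hA.1
  have hφ : T.Ready φ := hυ.frame hF'' (by simp [costCmd, FixedLoc])
  have h8 : φ.r 8 = I.costEst s i (s i) := by rw [hF''.r 8 (by simp [costCmd]), hr]; rfl
  have h13 : φ.r 13 = I.costEst s i (I.response O s i) := hr'
  refine .seq (.rop (v := 2 ^ X.max * I.costEst s i (I.response O s i)) ?_ (fun hr => ?_)
    (.rop (v := I.gain O (2 ^ X.max) s i) ?_ (fun hr => ?_) (by simp)))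
  · simp [ArithOp.eval, hφ.discount, h13]
  · exact ((T.data hr).discount_mul T.size_le_S s i _).mono (T.le_ℓ_of_le (by omega))
  · simp [ArithOp.eval, h8, Instance.gain]
  · exact ((T.data hr).gain T.size_le_S O s i).mono (T.le_ℓ_of_le (by omega))

theorem run_gainsCmd (hσ : T.Ready σ) {s : I.Profile} (hs : I.Outputs σ s) :
    T.Run (gainsCmd T.ask) σ (T.M ^ 2 * T.tq + 108 * T.M ^ 4)
      fun τ => ∀ i : Fin I.N, τ.ra 4 i 0 0 = I.gain O (2 ^ X.max) s i := by
  have hM := T.one_le_M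
  have hM2 := powers_le hM
  obtain ⟨h1, h2, h3, h4, h5, h6, h7⟩ := powers_le T.one_le_S
  refine Run.le (Run.fillN (t := 48 * T.M ^ 3 + (T.M * T.tq + 55 * T.M ^ 2))
    (I.gain O (2 ^ X.max) s) hσ.loaded.1 (I.N_le_size.trans T.size_le) (by simp) hσ.zero (by simp)
    (by simp [weightsCmd, shareCmd, othersCmd, hitCmd, gainCmd, answersCmd, costCmd, T.ask_n])
    (by simp [weightsCmd, shareCmd, othersCmd, hitCmd, gainCmd, answersCmd, costCmd, T.ask_n])
    (by simp [weightsCmd, shareCmd, othersCmd, hitCmd, gainCmd, answersCmd, costCmd, T.ask_n])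
    (by simp [weightsCmd, shareCmd, othersCmd, hitCmd, gainCmd, answersCmd, costCmd, T.ask_ra])
    (fun hr i => ((T.data hr).gain T.size_le_S O s i).mono (T.le_ℓ_of_le (by omega)))
    fun i τ hF hi => ?_) (by nlinarith)
  have hτ : T.Ready τ := hσ.frame hF (by
    simp [weightsCmd, shareCmd, othersCmd, hitCmd, gainCmd, answersCmd, costCmd, T.ask_avoids,
      FixedLoc])
  have hs' : I.Outputs τ s := outputs_frame hs hF (by
    simp [weightsCmd, shareCmd, othersCmd, hitCmd, gainCmd, answersCmd, costCmd, T.ask_na])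
  refine .seq (.call (T.run_weightsCmd hτ hs' i hi) fun υ hF' hw => T.run_gainCmd ?_ ?_ i ?_ hw)
  · exact hτ.frame hF' (by simp [weightsCmd, shareCmd, othersCmd, hitCmd, FixedLoc])
  · exact outputs_frame hs' hF' (by simp [weightsCmd, shareCmd, othersCmd, hitCmd])
  · rw [hF'.n 10 (by simp [weightsCmd, shareCmd, othersCmd, hitCmd]), hi]

theorem run_totalCmd (hσ : T.Ready σ) (s : I.Profile)
    (hg : ∀ i : Fin I.N, σ.ra 4 i 0 0 = I.gain O (2 ^ X.max) s i) :
    T.Run totalCmd σ (T.M * 4 + 3) fun τ => τ.r 16 = ∑ i, I.gain O (2 ^ X.max) s i := by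
  obtain ⟨h1, h2, h3, h4, h5, h6, h7⟩ := powers_le T.one_le_S
  refine Run.sumN (t := 1) (I.gain O (2 ^ X.max) s) (a := 43 * T.S ^ 7) hσ.loaded.1
    (I.N_le_size.trans T.size_le) (by simp) (by simp) (by simp) (by simp) (T.le_ℓ_of_le ?_)
    (fun hr i => (T.data hr).gain T.size_le_S O s i) fun i τ hF hi => .rload
      (v := I.gain O (2 ^ X.max) s i) ?_ (fun hr => ?_) (by simp)
  · have := Nat.mul_le_mul_right (43 * T.S ^ 7 + 1) T.M_le
    nlinarith
  · rw [hF.ra 4 (by simp), hi, hF.n 3 (by simp), hσ.zero, hg]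
  · exact ((T.data hr).gain T.size_le_S O s i).mono (T.le_ℓ_of_le (by omega))

theorem mem_eligible (I : Instance P X) (η : ℝ) (s : I.Profile) (i : Fin I.N) :
    i ∈ I.eligible O η s ↔
      0 < I.gain O η s i ∧ ∑ i', I.gain O η s i' ≤ I.N * I.gain O η s i := by
  have hN : (0 : ℝ) < I.N := by exact_mod_cast i.pos
  rw [Instance.eligible, Finset.mem_filter, one_div_mul_eq_div, div_le_iff₀' hN]
  simp

theorem run_selectCmd (hσ : T.Ready σ) (s : I.Profile)
    (hg : ∀ i : Fin I.N, σ.ra 4 i 0 0 = I.gain O (2 ^ X.max) s i)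
    (ht : σ.r 16 = ∑ i, I.gain O (2 ^ X.max) s i) :
    T.Run selectCmd σ (15 * T.M) fun τ =>
      (τ.n 17 = I.N ∧ ¬ (I.eligible O (2 ^ X.max) s).Nonempty) ∨
        ∃ h : (I.eligible O (2 ^ X.max) s).Nonempty,
          τ.n 17 = (I.eligible O (2 ^ X.max) s).min' h := by
  have hM := T.one_le_M
  obtain ⟨h1, h2, h3, h4, h5, h6, h7⟩ := powers_le T.one_le_S
  refine Run.le (.seq (.ncopy (.call (.forN (t := 9) (M := T.M) (n := I.N) (fun k τ =>
      (τ.n 17 = I.N ∧ ∀ i : Fin I.N, i.val < k → i ∉ I.eligible O (2 ^ X.max) s) ∨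
      ∃ i ∈ I.eligible O (2 ^ X.max) s, τ.n 17 = i ∧ ∀ i' ∈ I.eligible O (2 ^ X.max) s, i ≤ i')
    (by simp [hσ.loaded.1]) (I.N_le_size.trans T.size_le) (by simp) (by simp) (by simp)
    (fun k τ v h => by simpa using h) (Or.inl (by simp [hσ.loaded.1])) ?_) ?_))) (by omega)
  · intro i τ hF hi hI
    have hN : τ.n 0 = I.N := by rw [hF.n 0 (by simp)]; simp [hσ.loaded.1]
    have h18 : τ.r 18 = 0 := by rw [hF.r 18 (by simp)]; simp [hσ.rzero]
    have h19 : τ.r 19 = I.N := by rw [hF.r 19 (by simp)]; simp [hσ.agents]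
    have h16 : τ.r 16 = ∑ i, I.gain O (2 ^ X.max) s i := by rw [hF.r 16 (by simp)]; simp [ht]
    have hn3 : τ.n 3 = 0 := by rw [hF.n 3 (by simp)]; simp [hσ.zero]
    have hg' : ∀ i : Fin I.N, τ.ra 4 i 0 0 = I.gain O (2 ^ X.max) s i := by
      rw [hF.ra 4 (by simp)]
      simpa using hg
    have hne : I.N ≤ τ.n 17 → ∀ i' ∈ I.eligible O (2 ^ X.max) s, i.val ≤ i'.val := by
      intro hle i' hi'
      rcases hI with ⟨-, hI⟩ | ⟨j, -, hj, -⟩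
      · exact not_lt.1 fun hlt => hI i' hlt hi'
      · omega
    -- an agent that fails a test is not eligible, so none of index at most `i` is
    have hnot : I.N ≤ τ.n 17 → i ∉ I.eligible O (2 ^ X.max) s →
        ∀ i' : Fin I.N, i'.val < i.val + 1 → i' ∉ I.eligible O (2 ^ X.max) s := by
      intro hle hmem i' hlt hi'
      have : i' = i := Fin.ext (le_antisymm (Nat.lt_succ_iff.1 hlt) (hne hle i' hi'))
      exact hmem (this ▸ hi')
    have h17 : I.N ≤ τ.n 17 → τ.n 17 = I.N := by
      intro hle
      rcases hI with ⟨h, -⟩ | ⟨j, -, hj, -⟩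
      · exact h
      · omega
    refine Run.ifN (fun hlt => .skip ?_) fun hle => .seq (.rload (v := I.gain O (2 ^ X.max) s i) ?_
      (fun hr => ?_) (.ifR (fun hz => .skip ?_) fun hz => .seq (.rop
        (v := I.N * I.gain O (2 ^ X.max) s i) ?_ (fun hr => ?_)
          (.ifR (fun hz' => .ncopy ?_) fun hz' => .skip ?_))))
    · rw [hN] at hlt
      rcases hI with ⟨h, -⟩ | h
      · omega
      · exact Or.inr h
    all_goals rw [hN] at hle
    · rw [hi, hn3, hg']
    · exact ((T.data hr).gain T.size_le_S O s i).mono (T.le_ℓ_of_le (by omega))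
    · refine Or.inl ⟨h17 hle, hnot hle fun hmem => ?_⟩
      rw [mem_eligible] at hmem
      simp [h18] at hz
      linarith [hmem.1]
    · simp [ArithOp.eval, h19]
    · exact ((BoundedRat.natCast I.N (I.N_le_size.trans T.size_le_S)).mul
        ((T.data hr).gain T.size_le_S O s i)).mono (T.le_ℓ_of_le (by omega))
    · refine Or.inr ⟨i, ?_, by simp [hi], fun i' hi' => hne hle i' hi'⟩
      rw [mem_eligible]
      simp [h18] at hz
      simp [h16] at hz'
      exact ⟨hz, hz'⟩
    · refine Or.inl ⟨h17 hle, hnot hle fun hmem => ?_⟩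
      rw [mem_eligible] at hmem
      simp [h16] at hz'
      linarith [hmem.2]
  · rintro τ hF (⟨h, h'⟩ | ⟨i, hi, h, h'⟩)
    · exact Or.inl ⟨h, fun ⟨i, hi⟩ => h' i i.2 hi⟩
    · refine Or.inr ⟨⟨i, hi⟩, ?_⟩
      rw [h]
      exact congrArg Fin.val (le_antisymm (Finset.le_min' _ _ _ h') (Finset.min'_le _ _ hi))

theorem round_of_nonempty (I : Instance P X) {η : ℝ} {s : I.Profile}
    (h : (I.eligible O η s).Nonempty) :
    I.round O η s = Function.update s ((I.eligible O η s).min' h)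
      (I.response O s ((I.eligible O η s).min' h)) := dif_pos h

theorem run_roundCmd (hσ : T.Ready σ) {s : I.Profile} (hs : I.Outputs σ s) :
    T.Run (roundCmd T.ask) σ (2 * T.M ^ 2 * T.tq + 200 * T.M ^ 4) fun τ =>
      I.Outputs τ (I.round O (2 ^ X.max) s) := by
  have hM := T.one_le_M
  have hM2 := powers_le hM
  refine Run.le (.seq (.call (T.run_gainsCmd hσ hs) fun τ hF hg => ?_))
    (t := T.M ^ 2 * T.tq + 108 * T.M ^ 4 + ((T.M * 4 + 3) + (15 * T.M +
      ((1 + (48 * T.M ^ 3 + (T.M * T.tq + 11 * T.M ^ 2))) + 1 + 1)))) (by nlinarith)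
  have hτ : T.Ready τ := hσ.frame hF (by
    simp [gainsCmd, weightsCmd, shareCmd, othersCmd, hitCmd, gainCmd, answersCmd, costCmd,
      T.ask_avoids, FixedLoc])
  have hs' : I.Outputs τ s := outputs_frame hs hF (by
    simp [gainsCmd, weightsCmd, shareCmd, othersCmd, hitCmd, gainCmd, answersCmd, costCmd,
      T.ask_na])
  refine .seq (.call (T.run_totalCmd hτ s hg) fun υ hF' ht => ?_)
  have hυ : T.Ready υ := hτ.frame hF' (by simp [totalCmd, FixedLoc])
  refine .seq (.call (T.run_selectCmd hυ s ?_ ht) fun φ hF'' hsel => ?_)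
  · rw [hF'.ra 4 (by simp [totalCmd])]
    exact hg
  have hφ : T.Ready φ := hυ.frame hF'' (by simp [selectCmd, FixedLoc])
  have hsφ : I.Outputs φ s := outputs_frame (outputs_frame hs' hF' (by simp [totalCmd])) hF''
    (by simp [selectCmd])
  rcases hsel with ⟨h17, hne⟩ | ⟨hne, h17⟩
  · refine .ifN (fun hlt => absurd hlt (by rw [h17, hφ.loaded.1]; exact lt_irrefl _)) fun _ =>
      .skip ?_
    rw [Instance.round, dif_neg hne]
    exact hsφ
  · rw [round_of_nonempty I hne]
    generalize (I.eligible O (2 ^ X.max) s).min' hne = i at h17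
    refine .ifN (fun _ => .seq (.ncopy ?_)) fun hle => absurd hle (by
      rw [h17, hφ.loaded.1]; exact not_le.2 i.2)
    have hφ' : T.Ready (φ.setN 10 (φ.n 17)) := hφ.setN (by simp [FixedLoc])
    have hsφ' : I.Outputs (φ.setN 10 (φ.n 17)) s := hsφ
    refine .seq (.call (T.run_weightsCmd hφ' hsφ' i (by simp [h17])) fun ψ hG hw => ?_)
    have hψ : T.Ready ψ := hφ'.frame hG (by simp [weightsCmd, shareCmd, othersCmd, hitCmd, FixedLoc])
    have hsψ := outputs_frame hsφ' hG (by simp [weightsCmd, shareCmd, othersCmd, hitCmd])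
    refine .call (T.run_answersCmd hψ (Or.inl rfl) hw (I.shareEst_nonneg s i)
      (fun hr => (T.data hr).shareEst T.size_le_S s i) i ?_) fun χ hG' hA => ?_
    · rw [hG.n 10 (by simp [weightsCmd, shareCmd, othersCmd, hitCmd])]
      simp [h17]
    · intro i' t e
      rcases eq_or_ne i' i with rfl | hii
      · rw [Function.update_self]
        exact hA.1 t e
      · rw [Function.update_of_ne hii, hA.2 i' t e fun h => hii (Fin.ext h)]
        exact hsψ i' t e

theorem run_setupCmd (hσ : I.Loaded σ) (he : T.extra σ) :
    T.Run setupCmd σ (40 * T.M) fun τ => T.Ready τ := by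
  have hM := T.one_le_M
  obtain ⟨h1, h2, h3, h4, h5, h6, h7⟩ := powers_le T.one_le_S
  have hS := T.one_le_S
  set K := ⌈(2 : ℝ) ^ X.max⌉₊ with hK
  have hKS : K ≤ 50 * T.S ^ 8 := by
    have := T.ceil_le.trans T.M_le
    omega
  -- Register `22` counts up to the ceiling, as does the real register `21`; `d` passes remain.
  have hcount : ∀ d (τ : Store), τ.n 22 + d = K → τ.n 23 = 0 → τ.n 24 = 1 → τ.r 20 = 1 →
      τ.r 14 = 2 ^ X.max → τ.r 21 = τ.n 22 →
      T.Run (.whileN 23 24 (.ifR 14 21 (.instr (.nconst 23 1))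
        (.instr (.nsucc 22) ;; .instr (.rop .add 21 21 20)))) τ (5 * d + 6)
        fun υ => υ.n 22 = K := by
    intro d
    induction d with
    | zero =>
      intro τ hd h23 h24 h20 h14 h21
      refine Run.le (.whileN_step (t := 1 + 2 + 1) (t' := 1) (by omega) (.ifR (fun _ => .nconst
        (.whileN_done (by simp [h24]) (by simp; omega))) fun hlt => ?_)) (by omega)
      rw [h14, h21] at hlt
      have := Nat.le_ceil ((2 : ℝ) ^ X.max)
      rw [← hK, ← hd, add_zero] at this
      linarith
    | succ d ih =>
      intro τ hd h23 h24 h20 h14 h21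
      refine Run.le (.whileN_step (t := 1 + (1 + 1) + 1) (t' := 5 * d + 6) (by omega)
        (.ifR (fun hle => ?_) fun hlt => .seq (.nsucc (.rop (v := ((τ.n 22 + 1 : ℕ) : ℝ)) ?_
          (fun _ => .natCast _ (T.le_ℓ_of_le (by omega))) (ih _ ?_ ?_ ?_ ?_ ?_ ?_))))) (by omega)
      · rw [h14, h21] at hle
        have := Nat.ceil_le.2 hle
        omega
      · simp [ArithOp.eval, h21, h20]
      all_goals simp [h23, h24, h20, h14]
      omega
  refine Run.le (t := 1 + (1 + ((T.M * (1 + 3) + 3) + (1 + ((T.M * (5 + 2) + 2) +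
    (1 + (1 + (1 + (1 + (1 + (5 * K + 6))))))))))) ?_ (by have := T.ceil_le; omega)
  refine .seq (.nconst (.seq (.rconst (Nat.zero_le _) (.seq (.call (.sumN
    (fun _ : Fin I.N => (1 : ℝ)) (a := 1) (by simp [hσ.1]) (I.N_le_size.trans T.size_le)
    (by simp) (by simp) (by simp) (by simp) (T.le_ℓ_of_le ?_)
    (fun _ _ => by simpa using BoundedRat.natCast 1 le_rfl)
    fun k τ hF hk => .rconst (T.le_ℓ_of_le (by omega)) (by simp)) fun τ hF h19 => ?_)))))
  · have := T.M_le
    nlinarith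
  refine .seq (.rconst (Nat.zero_le _) (.seq (.call (.forN (n := X.q)
    (fun k υ => (∀ j : Fin X.q, j.val < k → 2 ^ X.α j ≤ υ.r 14) ∧
      (υ.r 14 = 0 ∨ ∃ j, υ.r 14 = 2 ^ X.α j)) ?_ (I.q_le_size.trans T.size_le) (by simp)
    (by simp) (by simp) (fun k τ v h => by simpa using h) (by simp) fun j υ hF' hj hI =>
      .seq (t := 1) (t' := 1 + (1 + 1 + 1)) (.rconst (T.le_ℓ_of_le (by omega)) (.seq (.rpow
        (v := 2 ^ X.α j) ?_ (by simp) ?_ (fun hr => ?_)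
          (.ifR (fun hle => .rcopy (fun hr => ?_) ?_) fun hlt => .skip ?_))))) fun υ hF' hη => ?_)))
  · rw [Store.setR_n, hF.n 2 (by simp)]
    simpa using hσ.2.2.1
  · simp only [Store.setR_n]
    rw [hj]
    exact j.2
  · simp only [Store.setR_r, if_true]
    congr 2
    exact Fin.ext (by simpa using hj)
  · exact ((T.data hr).two_rpow j).mono (T.le_ℓ_of_le (by omega))
  · simpa using ((T.data hr).two_rpow j).mono (T.le_ℓ_of_le (by omega))
  · simp only [Store.setR_r, Nat.reduceEqDiff, ↓reduceIte] at hle ⊢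
    refine ⟨fun j' hj' => ?_, Or.inr ⟨j, rfl⟩⟩
    rcases eq_or_ne j' j with rfl | hne
    · exact le_rfl
    · have : j'.val ≠ j.val := fun h => hne (Fin.ext h)
      exact (hI.1 j' (by omega)).trans hle
  · simp only [Store.setR_r, Nat.reduceEqDiff, ↓reduceIte] at hlt ⊢
    refine ⟨fun j' hj' => ?_, hI.2⟩
    rcases eq_or_ne j' j with rfl | hne
    · exact hlt.le
    · have : j'.val ≠ j.val := fun h => hne (Fin.ext h)
      exact hI.1 j' (by omega)
  have hυ14 : υ.r 14 = 2 ^ X.max := by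
    obtain ⟨j, hj⟩ := X.exists_eq_max
    refine le_antisymm ?_ (hj ▸ hη.1 j j.2)
    rcases hη.2 with h | ⟨j', h⟩
    · rw [h]
      positivity
    · rw [h]
      exact Real.rpow_le_rpow_of_exponent_le (by norm_num) (X.le_max j')
  refine .seq (.nconst (.seq (.rconst (Nat.zero_le _) (.seq (.rconst (T.le_ℓ_of_le (by omega))
    (.seq (.nconst (.seq (.nconst (.call (hcount K _ (by simp) (by simp) (by simp) (by simp)
      (by simpa using hυ14) (by simp)) fun φ hF'' h22 => ?_))))))))))
  have h14 : φ.r 14 = 2 ^ X.max := by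
    rw [hF''.r 14 (by simp)]
    simpa using hυ14
  have hn : ∀ x, x ∉ [3, 10, 13, 22, 23, 24] → φ.n x = σ.n x := by
    intro x hx
    simp at hx
    rw [hF''.n x (by simp; omega)]
    simp [hx, hF'.n x (by simp; omega), hF.n x (by simp; omega)]
  have hna : φ.na = σ.na := by
    funext a
    rw [hF''.na a (by simp)]
    simp [hF'.na a (by simp), hF.na a (by simp)]
  have hra : φ.ra = σ.ra := by
    funext a
    rw [hF''.ra a (by simp)]
    simp [hF'.ra a (by simp), hF.ra a (by simp)]
  refine ⟨?_, T.extra_congr σ φ (by rw [hna]) (by rw [hna]) he, ?_, h22, h14, ?_, ?_⟩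
  · unfold Instance.Loaded
    rw [hna, hra, hn 0 (by simp), hn 1 (by simp), hn 2 (by simp)]
    exact hσ
  · rw [hF''.n 3 (by simp)]
    simp [hF'.n 3 (by simp), hF.n 3 (by simp)]
  · rw [hF''.r 18 (by simp)]
    simp [hF'.r 18 (by simp), hF.r 18 (by simp)]
  · rw [hF''.r 19 (by simp)]
    simp [hF'.r 19 (by simp), h19]

theorem run_mainCmd (hσ : I.Loaded σ) (he : T.extra σ) :
    T.Run (mainCmd T.ask) σ (3 * T.M ^ 6 * T.tq + 300 * T.M ^ 8) fun τ =>
      I.Outputs τ (bayesABRD P O discount numRounds X I) := by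
  have hM := T.one_le_M
  obtain ⟨m1, m2, m3, m4, m5, m6, m7⟩ := powers_le hM
  set r := 2 * T.M ^ 2 * T.tq + 200 * T.M ^ 4 with hr
  have htime : 40 * T.M + (12 * T.M ^ 2 + ((T.M * ((T.M * T.tq + 11 * T.M ^ 2) + 2) + 2)
      + (T.M * ((T.M * ((T.M * ((T.M * (r + 2) + 2) + 2) + 2) + 2) + 2) + 2) + 2)))
      ≤ 3 * T.M ^ 6 * T.tq + 300 * T.M ^ 8 := by
    have e1 : T.M * ((T.M * ((T.M * ((T.M * (r + 2) + 2) + 2) + 2) + 2) + 2) + 2) + 2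
        = 2 * (T.M ^ 6 * T.tq) + 200 * T.M ^ 8 + 2 * T.M ^ 4 + 4 * T.M ^ 3 + 4 * T.M ^ 2
          + 4 * T.M + 2 := by
      rw [hr]
      ring
    have e2 : T.M * ((T.M * T.tq + 11 * T.M ^ 2) + 2) + 2
        = T.M ^ 2 * T.tq + 11 * T.M ^ 3 + 2 * T.M + 2 := by ring
    have e3 : T.M ^ 2 * T.tq ≤ T.M ^ 6 * T.tq := Nat.mul_le_mul_right _ (by omega)
    have e4 : 3 * T.M ^ 6 * T.tq = 3 * (T.M ^ 6 * T.tq) := by ring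
    rw [e1, e2, e4]
    omega
  have hround : numRounds X.max I.N = ⌈(2 : ℝ) ^ X.max⌉₊ * ⌈(2 : ℝ) ^ X.max⌉₊ * I.N * I.N := by
    rw [numRounds]
    ring
  have hIx : ∀ x : ℕ, ¬ FixedLoc (.n x) → ∀ (s : I.Profile) (τ : Store) (v : ℕ),
      T.Ready τ ∧ I.Outputs τ s → T.Ready (τ.setN x v) ∧ I.Outputs (τ.setN x v) s :=
    fun x hx s τ v h => ⟨h.1.setN hx, h.2⟩
  refine Run.le (.seq (.call (T.run_setupCmd hσ he) fun τ _ hτ => .seq (.call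
    (T.run_initialWeightsCmd hτ) fun υ hF hw => .seq (.call (.forN (M := T.M) (n := I.N)
      (t := T.M * T.tq + 11 * T.M ^ 2) (fun k φ => T.Ready φ ∧ ∀ (i : Fin I.N)
        (t : Fin (I.numTypes i)) (e : Fin I.m), i.val < k →
          φ.na 3 i t e = if e ∈ I.initial O i t then 1 else 0) ?_ (I.N_le_size.trans T.size_le)
        (by simp) (by simp [answersCmd, T.ask_n]) (by simp [answersCmd, T.ask_n])
        (fun k φ v h => ⟨h.1.setN (by simp [FixedLoc]), h.2⟩) ?_ ?_) ?_)))) htime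
  · have hυ : T.Ready υ := hτ.frame hF (by simp [initialWeightsCmd, FixedLoc])
    exact hυ.loaded.1
  · exact ⟨hτ.frame hF (by simp [initialWeightsCmd, FixedLoc]), by simp⟩
  · intro i φ hF' hi hI
    refine .call (T.run_answersCmd hI.1 (Or.inl rfl) (w := fun e => ∑ j, I.ξ e j) ?_
      (fun e => Finset.sum_nonneg fun j _ => (I.ξ_pos e j).le)
      (fun hr => (T.data hr).sum_ξ T.size_le_S) i hi) fun ψ hG hA => ⟨?_, ?_⟩
    · rw [hF'.ra 3 (by simp [answersCmd, T.ask_ra])]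
      exact hw
    · exact hI.1.frame hG (by simp [answersCmd, FixedLoc, T.ask_avoids])
    · intro i' t e hlt
      rcases eq_or_ne i' i with rfl | hne
      · exact hA.1 t e
      · have : i'.val ≠ i.val := fun h => hne (Fin.ext h)
        rw [hA.2 i' t e this]
        exact hI.2 i' t e (by omega)
  · intro φ _ hI
    have hw : ∀ {x : ℕ}, x ∈ [0, 22, 25, 26, 27, 28] → ¬ (roundCmd T.ask).Writes (.n x) := by
      intro x hx
      simp at hx
      rcases hx with rfl | rfl | rfl | rfl | rfl | rfl <;>
      simp [roundCmd, gainsCmd, totalCmd, selectCmd, weightsCmd, shareCmd, othersCmd, hitCmd,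
        gainCmd, answersCmd, costCmd, T.ask_n]
    have hav : (roundCmd T.ask).Avoids FixedLoc := by
      simp [roundCmd, gainsCmd, totalCmd, selectCmd, weightsCmd, shareCmd, othersCmd, hitCmd,
        gainCmd, answersCmd, costCmd, T.ask_avoids, FixedLoc]
    have hN := I.N_le_size.trans T.size_le
    refine .call (.iterate (t := T.M * ((T.M * ((T.M * (r + 2) + 2) + 2) + 2) + 2) + 2)
      _ (I.initial O) (fun s τ => T.Ready τ ∧ I.Outputs τ s) hI.1.loaded.1 hN
      (by simp) (by simp [hw]) (by simp [hw]) (hIx 25 (by simp [FixedLoc]))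
      ⟨hI.1, fun i t e => hI.2 i t e i.2⟩ fun s τ _ h =>
    .iterate (t := T.M * ((T.M * (r + 2) + 2) + 2) + 2) _ s (fun s τ => T.Ready τ ∧ I.Outputs τ s)
      h.1.loaded.1 hN (by simp) (by simp [hw]) (by simp [hw]) (hIx 26 (by simp [FixedLoc]))
      h fun s τ _ h =>
    .iterate (t := T.M * (r + 2) + 2) _ s (fun s τ => T.Ready τ ∧ I.Outputs τ s)
      h.1.ceil T.ceil_le (by simp) (by simp [hw]) (by simp [hw]) (hIx 27 (by simp [FixedLoc]))
      h fun s τ _ h =>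
    .iterate (t := r) (I.round O (2 ^ X.max)) s (fun s τ => T.Ready τ ∧ I.Outputs τ s)
      h.1.ceil T.ceil_le (by simp) (by simp [hw]) (by simp [hw]) (hIx 28 (by simp [FixedLoc]))
      h fun s τ _ h =>
    .call (T.run_roundCmd h.1 h.2) fun υ hG h' => ⟨h.1.frame hG hav, h'⟩) fun τ _ h => ?_
    rw [bayesABRD, discount, hround, Function.iterate_mul, Function.iterate_mul,
      Function.iterate_mul]
    exact h.2

end Setting

/-! ### Access to the oracle -/

/-- Integral exponents can be bounded in terms of a number which the program needs anyway. -/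
theorem Exponents.le_ceil (X : Exponents) (j : Fin X.q) {k : ℕ} (hk : X.α j = k) :
    k ≤ ⌈(2 : ℝ) ^ X.max⌉₊ := by
  have h1 : (k : ℝ) ≤ 2 ^ X.max := by
    have h2 := one_add_mul_self_le_rpow_one_add (s := 1) (by norm_num) X.one_lt_max.le
    norm_num at h2
    have h3 := X.le_max j
    rw [hk] at h3
    linarith
  exact_mod_cast h1.trans (Nat.le_ceil _)

theorem Instance.RationalOfLength.boundedData {P : Problem} {X : Exponents} {I : Instance P X}
    {L S : ℕ} (h : I.RationalOfLength L) (hL : L ≤ S) (hS : ⌈(2 : ℝ) ^ X.max⌉₊ ≤ S) :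
    I.BoundedData S where
  prob i t := (h.1 i t).boundedRat.mono hL
  ξ e j := (h.2.1 e j).boundedRat.mono hL
  α j := by
    obtain ⟨k, hk⟩ := h.2.2 j
    exact ⟨k, hk, (X.le_ceil j hk).trans hS⟩

namespace Instance

variable {P : Problem} {X : Exponents} (I : Instance P X)

/-- The input is rational, and the exponents are integers. -/
def IsRational : Prop := ∃ L, I.RationalOfLength L

open scoped Classical in
/-- The largest encoding length of a number in the input (zero if the input is not rational). -/
def inputLength : ℕ := if h : I.IsRational then Nat.find h else 0

theorem inputLength_spec (h : I.IsRational) : I.RationalOfLength I.inputLength := by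
  classical
  rw [inputLength, dif_pos h]
  convert Nat.find_spec h

theorem inputLength_le {L : ℕ} (h : I.RationalOfLength L) : I.inputLength ≤ L := by
  classical
  rw [inputLength, dif_pos ⟨L, h⟩]
  convert Nat.find_min' (⟨L, h⟩ : ∃ L, I.RationalOfLength L) h

/-- The bound on the number of passes through a loop. -/
def loopBound : ℕ := I.size + ⌈(2 : ℝ) ^ X.max⌉₊

/-- The quantity in which encoding lengths are polynomial. -/
def lengthBound : ℕ := I.loopBound + I.inputLength

theorem one_le_loopBound : 1 ≤ I.loopBound := I.one_le_size.trans (Nat.le_add_right _ _)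

theorem one_le_lengthBound : 1 ≤ I.lengthBound := I.one_le_loopBound.trans (Nat.le_add_right _ _)

theorem loopBound_pow_le (k : ℕ) :
    I.loopBound ^ k ≤ (1 + ⌈(2 : ℝ) ^ X.max⌉₊) ^ k * I.size ^ k := by
  rw [← mul_pow]
  refine Nat.pow_le_pow_left ?_ k
  have := I.one_le_size
  unfold loopBound
  nlinarith

theorem lengthBound_pow_le {L : ℕ} (h : I.RationalOfLength L) (k : ℕ) :
    I.lengthBound ^ k ≤ (1 + ⌈(2 : ℝ) ^ X.max⌉₊) ^ k * (I.size + L) ^ k := by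
  rw [← mul_pow]
  refine Nat.pow_le_pow_left ?_ k
  have h1 := I.one_le_size
  have h2 := I.inputLength_le h
  unfold lengthBound loopBound
  nlinarith

theorem boundedData (h : I.IsRational) : I.BoundedData I.lengthBound :=
  (I.inputLength_spec h).boundedData (Nat.le_add_left _ _)
    ((Nat.le_add_left _ _).trans (Nat.le_add_right _ _))

end Instance

theorem powers_mul_le {M : ℕ} (hM : 1 ≤ M) {m : ℕ} (hm : m ≤ M) :
    3 * M ^ 6 * (m + 1) + 300 * M ^ 8 ≤ 306 * M ^ 8 := by
  have h1 : 3 * M ^ 6 * (m + 1) ≤ 3 * M ^ 6 * (2 * M ^ 2) :=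
    Nat.mul_le_mul_left _ (by nlinarith)
  calc _ ≤ 3 * M ^ 6 * (2 * M ^ 2) + 300 * M ^ 8 := by omega
    _ = _ := by ring

/-- The command that consists of a query. -/
def queryCmd : Cmd := .instr (.query 10 11 3 4)

/-- Queries to the oracle are answered by the primitive instruction. -/
def oracleSetting {P : Problem} {X : Exponents} (I : Instance P X) (O : ActionProcedure) :
    Setting I O where
  query := (I.oracleEnv O).query
  rat := I.IsRational
  ℓ := 50 * I.lengthBound ^ 8
  M := I.loopBound
  S := I.lengthBound
  ask := queryCmd
  extra := fun _ => True
  tq := I.m + 1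
  size_le := Nat.le_add_right _ _
  ceil_le := Nat.le_add_left _ _
  M_le := Nat.le_add_right _ _
  le_ℓ := le_rfl
  data := I.boundedData
  ask_n := by simp [queryCmd]
  ask_r := by simp [queryCmd]
  ask_na a _ h := by simp [queryCmd, h.symm]
  ask_ra := by simp [queryCmd]
  extra_congr := fun _ _ _ _ _ => trivial
  run_ask := by
    intro σ i t w hσ _ h3 hi ht hw hw0 _
    refine ⟨σ.setSet 4 (O I.m (I.req i t) w), I.m + 1, 0, .instr (c := .query 10 11 3 4) ?_, le_rfl,
      fun _ => Nat.zero_le _, fun e => ?_⟩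
    · have hw' : (fun e : Fin I.m => σ.ra 3 e 0 0) = w := funext hw
      have hex : ∃ hi : (i : ℕ) < I.N, (t : ℕ) < I.numTypes ⟨i, hi⟩ := ⟨i.2, t.2⟩
      simp only [Instr.run, Instance.env, Instance.oracleEnv, hi, ht, hw']
      rw [dif_pos hex, if_pos hw0]
      rfl
    · simp [Store.setSet]

/-- The coefficient in the resource bounds. The power replaces the summand `⌈2 ^ a⌉` of `loopBound`
by a factor `1 + ⌈2 ^ a⌉`. -/
def coefficient (A k : ℕ) (a : ℝ) : ℕ := A * (1 + ⌈(2 : ℝ) ^ a⌉₊) ^ k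

/-- The program with access to the oracle. A query takes time `m + 1`. -/
theorem oracleComputes (P : Problem) (O : ActionProcedure) :
    P.OracleComputes O (mainCmd queryCmd) (bayesABRD P O discount numRounds)
      (coefficient 306 8) 8 := by
  intro X I σ hσ
  obtain ⟨σ', t, b, h1, h2, h3, h4⟩ := (oracleSetting I O).run_mainCmd hσ trivial
  refine ⟨σ', t, b, h1, h4, ?_, fun L hL => ?_⟩
  · refine h2.trans ((powers_mul_le I.one_le_loopBound
      (I.m_le_size.trans (Nat.le_add_right _ _))).trans ?_)
    rw [coefficient, mul_assoc]
    exact Nat.mul_le_mul_left _ (I.loopBound_pow_le 8)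
  · have h5 : b ≤ 3 * (50 * I.lengthBound ^ 8) + 3 := h3 ⟨L, hL⟩
    have h6 := Nat.one_le_pow 8 _ I.one_le_lengthBound
    rw [coefficient, mul_assoc]
    exact (by omega : b ≤ 306 * I.lengthBound ^ 8).trans
      (Nat.mul_le_mul_left _ (I.lengthBound_pow_le hL 8))

/-! ### Subroutines in a separate part of the memory -/

/-- Rename registers and arrays. -/
def Instr.shift (K : ℕ) : Instr → Instr
  | .nconst x v => .nconst (x + K) v
  | .ncopy x y => .ncopy (x + K) (y + K)
  | .nsucc x => .nsucc (x + K)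
  | .npred x => .npred (x + K)
  | .nload x a i j k => .nload (x + K) (a + K) (i + K) (j + K) (k + K)
  | .nstore a i j k x => .nstore (a + K) (i + K) (j + K) (k + K) (x + K)
  | .rconst x v => .rconst (x + K) v
  | .rcopy x y => .rcopy (x + K) (y + K)
  | .rop o z x y => .rop o (z + K) (x + K) (y + K)
  | .rpow z x j => .rpow (z + K) (x + K) (j + K)
  | .rload x a i j k => .rload (x + K) (a + K) (i + K) (j + K) (k + K)
  | .rstore a i j k x => .rstore (a + K) (i + K) (j + K) (k + K) (x + K)
  | .query i t w b => .query (i + K) (t + K) (w + K) (b + K)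

/-- Rename the registers and arrays of a program, so that it does not touch those with names below
`K`. -/
def Cmd.shift (K : ℕ) : Cmd → Cmd
  | .skip => .skip
  | .instr c => .instr (c.shift K)
  | .seq p p' => .seq (p.shift K) (p'.shift K)
  | .ifR x y p p' => .ifR (x + K) (y + K) (p.shift K) (p'.shift K)
  | .ifN x y p p' => .ifN (x + K) (y + K) (p.shift K) (p'.shift K)
  | .whileN x y p => .whileN (x + K) (y + K) (p.shift K)

/-- The store as seen by a renamed program. -/
def Store.drop (K : ℕ) (σ : Store) : Store where
  n x := σ.n (x + K)
  r x := σ.r (x + K)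
  na a := σ.na (a + K)
  ra a := σ.ra (a + K)

namespace Store

variable (K : ℕ) (σ : Store)

theorem drop_setN (x v : ℕ) : (σ.setN (x + K) v).drop K = (σ.drop K).setN x v := by
  simp [drop, setN, Function.update_apply, funext_iff]

theorem drop_setR (x : ℕ) (v : ℝ) : (σ.setR (x + K) v).drop K = (σ.drop K).setR x v := by
  simp [drop, setR, Function.update_apply, funext_iff]

theorem drop_setNA (a i j k v : ℕ) :
    (σ.setNA (a + K) i j k v).drop K = (σ.drop K).setNA a i j k v := by
  simp [drop, setNA]

theorem drop_setRA (a i j k : ℕ) (v : ℝ) :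
    (σ.setRA (a + K) i j k v).drop K = (σ.drop K).setRA a i j k v := by
  simp [drop, setRA]

end Store

theorem Instr.run_shift {E : Env} {K : ℕ} {c : Instr} {τ σ' : Store} {b : ℕ}
    (h : c.run bareEnv (τ.drop K) = some (σ', b)) :
    (∃ τ', (c.shift K).run E τ = some (τ', b) ∧ τ'.drop K = σ') ∧
      (c.shift K).time E = c.time bareEnv := by
  cases c
  case rop o z x y =>
    simp only [Instr.run, Option.map_eq_some_iff] at h
    obtain ⟨v, hv, h⟩ := h
    obtain ⟨rfl, rfl⟩ := Prod.mk.inj h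
    refine ⟨⟨τ.setR (z + K) v, ?_, τ.drop_setR K z v⟩, rfl⟩
    simp only [Instr.shift, Instr.run, Option.map_eq_some_iff]
    exact ⟨v, hv, rfl⟩
  case rpow z x j => simp [Instr.run, bareEnv] at h
  case query i t w b => simp [Instr.run, bareEnv] at h
  all_goals
    simp only [Instr.run] at h
    obtain ⟨rfl, rfl⟩ := Prod.mk.inj (Option.some.inj h)
    refine ⟨⟨_, rfl, ?_⟩, rfl⟩
    first
    | exact Store.drop_setN ..
    | exact Store.drop_setR ..
    | exact Store.drop_setNA ..
    | exact Store.drop_setRA ..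

/-- A renamed program runs in any environment as the original program does in the bare one. -/
theorem Exec.shift {E : Env} {K : ℕ} {p : Cmd} {σ σ' : Store} {t b : ℕ}
    (h : Exec bareEnv p σ σ' t b) :
    ∀ τ : Store, τ.drop K = σ → ∃ τ', Exec E (p.shift K) τ τ' t b ∧ τ'.drop K = σ' := by
  induction h with
  | skip σ => exact fun τ hτ => ⟨τ, .skip τ, hτ⟩
  | instr h =>
    rintro τ rfl
    obtain ⟨⟨τ', h1, h2⟩, h3⟩ := Instr.run_shift (E := E) h
    exact ⟨τ', h3 ▸ .instr h1, h2⟩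
  | seq _ _ ih ih' =>
    intro τ hτ
    obtain ⟨τ', h1, h2⟩ := ih τ hτ
    obtain ⟨τ'', h3, h4⟩ := ih' τ' h2
    exact ⟨τ'', .seq h1 h3, h4⟩
  | ifR_true hxy _ ih =>
    rintro τ rfl
    obtain ⟨τ', h1, h2⟩ := ih τ rfl
    exact ⟨τ', .ifR_true hxy h1, h2⟩
  | ifR_false hxy _ ih =>
    rintro τ rfl
    obtain ⟨τ', h1, h2⟩ := ih τ rfl
    exact ⟨τ', .ifR_false hxy h1, h2⟩
  | ifN_true hxy _ ih =>
    rintro τ rfl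
    obtain ⟨τ', h1, h2⟩ := ih τ rfl
    exact ⟨τ', .ifN_true hxy h1, h2⟩
  | ifN_false hxy _ ih =>
    rintro τ rfl
    obtain ⟨τ', h1, h2⟩ := ih τ rfl
    exact ⟨τ', .ifN_false hxy h1, h2⟩
  | while_true hxy _ _ ih ih' =>
    rintro τ rfl
    obtain ⟨τ', h1, h2⟩ := ih τ rfl
    obtain ⟨τ'', h3, h4⟩ := ih' τ' h2
    exact ⟨τ'', .while_true hxy h1 h3, h4⟩
  | while_false hxy =>
    rintro τ rfl
    exact ⟨τ, .while_false hxy, rfl⟩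

/-- The name of a location. -/
def Loc.index : Loc → ℕ
  | .n x => x
  | .r x => x
  | .na a => a
  | .ra a => a

theorem Cmd.le_index_of_shift_writes {K : ℕ} {p : Cmd} {l : Loc} (h : (p.shift K).Writes l) :
    K ≤ l.index := by
  induction p with
  | skip => exact h.elim
  | instr c =>
    simp only [Cmd.shift, Cmd.Writes] at h
    subst h
    cases c <;> simp [Instr.shift, Instr.target, Loc.index]
  | seq p p' ih ih' => exact h.elim ih ih'
  | ifR _ _ p p' ih ih' => exact h.elim ih ih'
  | ifN _ _ p p' ih ih' => exact h.elim ih ih'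
  | whileN _ _ p ih => exact ih h

theorem Cmd.not_shift_writes {K : ℕ} {p : Cmd} {l : Loc} (h : l.index < K) :
    ¬ (p.shift K).Writes l := fun hW => absurd (Cmd.le_index_of_shift_writes hW) (not_le.2 h)

/-! ### Implementing the oracle -/

/-- Copy the request and the weights to the memory of the procedure `D`, run `D`, and copy the
answer. -/
def subroutineCmd (D : Cmd) : Cmd :=
  .instr (.ncopy 32 1) ;; .instr (.nload 33 1 10 11 3) ;;
  .forN 30 33 (.instr (.nload 31 2 10 11 30) ;; .instr (.nstore 32 30 3 3 31)) ;;
  .fillN 30 1 32 3 30 (.instr (.rload 30 3 30 3 3)) ;;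
  D.shift 32 ;;
  .forN 30 1 (.instr (.nload 31 33 30 3 3) ;; .instr (.nstore 4 30 3 3 31))

/-- Functions that are bounded by a monomial at positive arguments. -/
def PolyBounded (f : ℕ → ℕ) : Prop := ∃ C k : ℕ, ∀ x, 1 ≤ x → f x ≤ C * x ^ k

namespace PolyBounded

variable {f g : ℕ → ℕ}

theorem const (c : ℕ) : PolyBounded fun _ => c := ⟨c, 0, by simp⟩

theorem id : PolyBounded fun x => x := ⟨1, 1, by simp⟩

theorem add (hf : PolyBounded f) (hg : PolyBounded g) : PolyBounded fun x => f x + g x := by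
  obtain ⟨C, k, hf⟩ := hf
  obtain ⟨D, l, hg⟩ := hg
  refine ⟨C + D, k + l, fun x hx => ?_⟩
  rw [add_mul]
  refine add_le_add ((hf x hx).trans ?_) ((hg x hx).trans ?_)
  · exact Nat.mul_le_mul_left _ (Nat.pow_le_pow_right hx (by omega))
  · exact Nat.mul_le_mul_left _ (Nat.pow_le_pow_right hx (by omega))

theorem mul (hf : PolyBounded f) (hg : PolyBounded g) : PolyBounded fun x => f x * g x := by
  obtain ⟨C, k, hf⟩ := hf
  obtain ⟨D, l, hg⟩ := hg
  refine ⟨C * D, k + l, fun x hx => (Nat.mul_le_mul (hf x hx) (hg x hx)).trans (le_of_eq ?_)⟩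
  ring

theorem pow (hf : PolyBounded f) (n : ℕ) : PolyBounded fun x => f x ^ n := by
  induction n with
  | zero => simpa using const 1
  | succ n ih => simpa only [pow_succ] using ih.mul hf

end PolyBounded

/-- A bound on the length of requests over at most `x` resources. -/
def requestBound (dP x : ℕ) : ℕ := dP * (x + 1) ^ dP

/-- The time for answering a query, if the procedure has the resource bound `c z ^ d`. -/
def subroutineTime (dP c d x : ℕ) : ℕ :=
  4 * requestBound dP x + 8 * x + 8 + c * (x + requestBound dP x + 1) ^ d

/-- The bound on encoding lengths, if the procedure has the resource bound `c z ^ d`. -/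
def subroutineLength (dP c d x : ℕ) : ℕ :=
  50 * x ^ 8 + c * (x + requestBound dP x + (3 * (17 * x ^ 5) + 3) + 1) ^ d

theorem polyBounded_requestBound (dP : ℕ) : PolyBounded (requestBound dP) :=
  (PolyBounded.const dP).mul ((PolyBounded.id.add (.const 1)).pow dP)

theorem polyBounded_subroutineTime (dP c d : ℕ) : PolyBounded (subroutineTime dP c d) :=
  ((((PolyBounded.const 4).mul (polyBounded_requestBound dP)).add
    ((PolyBounded.const 8).mul .id)).add (.const 8)).add ((PolyBounded.const c).mul
      (((PolyBounded.id.add (polyBounded_requestBound dP)).add (.const 1)).pow d))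

theorem polyBounded_subroutineLength (dP c d : ℕ) : PolyBounded (subroutineLength dP c d) :=
  ((PolyBounded.const 50).mul (PolyBounded.id.pow 8)).add ((PolyBounded.const c).mul
    ((((PolyBounded.id.add (polyBounded_requestBound dP)).add
      (((PolyBounded.const 3).mul ((PolyBounded.const 17).mul (PolyBounded.id.pow 5))).add
        (.const 3))).add (.const 1)).pow d))

theorem requestBound_mono {dP x y : ℕ} (h : x ≤ y) : requestBound dP x ≤ requestBound dP y :=
  Nat.mul_le_mul_left _ (Nat.pow_le_pow_left (by omega) _)

section

variable {P : Problem} {O : ActionProcedure} {D : Cmd} {c d dP : ℕ}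

theorem run_subroutineCmd
    (hD : ∀ (m : ℕ) (r : List Bool) (w : Fin m → ℝ) (σ : Store),
      (P.actions m r).Nonempty → (∀ e, 0 ≤ w e) →
      σ.n 0 = m → σ.n 1 = r.length → (∀ k : Fin r.length, σ.na 0 k 0 0 = (r.get k).toNat) →
      (∀ e : Fin m, σ.ra 0 e 0 0 = w e) →
      ∃ σ' time bits, Exec bareEnv D σ σ' time bits ∧
        (∀ e : Fin m, σ'.na 1 e 0 0 = if e ∈ O m r w then 1 else 0) ∧
        time ≤ c * (m + r.length + 1) ^ d ∧
        ∀ L, (∀ e, RationalOfLength L (w e)) → bits ≤ c * (m + r.length + L + 1) ^ d)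
    (hP : ∀ m r, (P.actions m r).Nonempty → r.length ≤ dP * (m + 1) ^ dP)
    {X : Exponents} (I : Instance P X) {E : Env} {σ : Store} (i : Fin I.N)
    (t : Fin (I.numTypes i)) (w : Fin I.m → ℝ) (hσ : I.Loaded σ) (hreq : I.RequestsLoaded σ)
    (h3 : σ.n 3 = 0) (hi : σ.n 10 = i) (ht : σ.n 11 = t)
    (hw : ∀ e : Fin I.m, σ.ra 3 e 0 0 = w e) (hw0 : ∀ e, 0 ≤ w e)
    (hb : I.IsRational → ∀ e, BoundedRat (17 * I.lengthBound ^ 5) (w e)) :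
    Run E I.IsRational (subroutineLength dP c d I.lengthBound) (subroutineCmd D) σ
      (subroutineTime dP c d I.loopBound)
      fun τ => ∀ e : Fin I.m, τ.na 4 e 0 0 = if e ∈ O I.m (I.req i t) w then 1 else 0 := by
  have hmM : I.m ≤ I.loopBound := I.m_le_size.trans (Nat.le_add_right _ _)
  have hMS : I.loopBound ≤ I.lengthBound := Nat.le_add_right _ _
  set r := I.req i t with hr
  have hlen : r.length ≤ requestBound dP I.loopBound :=
    (hP I.m r (I.req_valid i t)).trans (requestBound_mono hmM)
  have hpow : 17 * I.lengthBound ^ 5 ≤ subroutineLength dP c d I.lengthBound := by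
    obtain ⟨-, -, -, -, h5, h6, h7⟩ := powers_le I.one_le_lengthBound
    unfold subroutineLength
    omega
  have hlow : ∀ l : Loc, l.index < 32 → ¬ (D.shift 32).Writes l :=
    fun l hl => Cmd.not_shift_writes hl
  refine Run.le (t := 1 + (1 + ((requestBound dP I.loopBound * (2 + 2) + 2) +
    ((I.loopBound * (1 + 3) + 2) + (c * (I.m + r.length + 1) ^ d + (I.loopBound * (2 + 2) + 2))))))
    ?_ ?_
  · refine .seq (.ncopy (.seq (.nload (.seq (.call (.forN (fun k τ => ∀ j : Fin r.length,
      j.val < k → τ.na 32 j 0 0 = (r.get j).toNat) (n := r.length) ?_ hlen (by simp) (by simp)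
      (by simp) (fun k τ v h => by simpa using h) (by simp)
      fun j τ hF hj hI => .seq (t := 1) (t' := 1) (.nload (.nstore ?_))) fun τ hF hI => ?_)))))
    · simp [hi, ht, h3, (hreq i t).1, hr]
    · have h10 : τ.n 10 = i := by rw [hF.n 10 (by simp)]; simp [hi]
      have h11 : τ.n 11 = t := by rw [hF.n 11 (by simp)]; simp [ht]
      have h3' : τ.n 3 = 0 := by rw [hF.n 3 (by simp)]; simp [h3]
      have hna : τ.na 2 = σ.na 2 := by rw [hF.na 2 (by simp)]; simp
      intro j' hj'
      simp only [Store.setN_n, h10, h11, hj, h3', hna, Nat.reduceEqDiff, ↓reduceIte]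
      by_cases hjj : j' = j
      · subst hjj
        simpa using (hreq i t).2 j'
      · have : j'.val ≠ j.val := fun h => hjj (Fin.ext h)
        simp only [Store.setNA_na, Store.setN_na, this, false_and, and_false, if_false]
        exact hI j' (by omega)
    · have hIn : ∀ j : Fin r.length, τ.na 32 j 0 0 = (r.get j).toNat := fun j => hI j j.2
      have h1 : τ.n 1 = I.m := by rw [hF.n 1 (by simp)]; simp [hσ.2.1]
      have h32 : τ.n 32 = I.m := by rw [hF.n 32 (by simp)]; simp [hσ.2.1]
      have h33 : τ.n 33 = r.length := by
        rw [hF.n 33 (by simp)]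
        simp [hi, ht, h3, (hreq i t).1, hr]
      have h3' : τ.n 3 = 0 := by rw [hF.n 3 (by simp)]; simp [h3]
      have hra : τ.ra 3 = σ.ra 3 := by rw [hF.ra 3 (by simp)]; simp
      refine .seq (.call (.fillN (t := 1) w h1 hmM (by simp) h3' (by simp) (by simp) (by simp)
        (by simp) (by simp) (fun h e => (hb h e).mono hpow) fun e υ hF' he =>
          .rload (v := w e) ?_ (fun h => (hb h e).mono hpow) (by simp)) fun υ hF' hw' => ?_)
      · rw [hF'.ra 3 (by simp), hra, he, hF'.n 3 (by simp), h3', hw]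
      · obtain ⟨σ', time, bits, hex, hout, htime, hbits⟩ := hD I.m r w (υ.drop 32)
          (I.req_valid i t) hw0 (by simp [Store.drop, hF'.n 32 (by simp), h32])
          (by simp [Store.drop, hF'.n 33 (by simp), h33])
          (by simpa [Store.drop, hF'.na 32 (by simp)] using hIn)
          (by simpa [Store.drop] using hw')
        obtain ⟨φ, hφ, hφ'⟩ := Exec.shift (E := E) hex υ rfl
        refine .seq (.call (Q' := fun φ => ∀ e : Fin I.m,
          φ.na 33 e 0 0 = if e ∈ O I.m r w then 1 else 0)
          ⟨φ, time, bits, hφ, htime, fun h => ?_, fun e => ?_⟩ fun φ hF'' hans => ?_)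
        · refine (hbits (3 * (17 * I.lengthBound ^ 5) + 3)
            fun e => (hb h e).rationalOfLength).trans ?_
          have hle : c * (I.m + r.length + (3 * (17 * I.lengthBound ^ 5) + 3) + 1) ^ d
              ≤ c * (I.lengthBound + requestBound dP I.lengthBound
                + (3 * (17 * I.lengthBound ^ 5) + 3) + 1) ^ d := by
            refine Nat.mul_le_mul_left _ (Nat.pow_le_pow_left ?_ _)
            have := requestBound_mono (dP := dP) hMS
            omega
          unfold subroutineLength
          omega
        · have := hout e
          rw [← hφ'] at this
          exact this
        · have h1' : φ.n 1 = I.m := by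
            rw [hF''.n 1 (hlow _ (by simp [Loc.index])), hF'.n 1 (by simp), h1]
          have h3'' : φ.n 3 = 0 := by
            rw [hF''.n 3 (hlow _ (by simp [Loc.index])), hF'.n 3 (by simp), h3']
          refine .call (.forN (fun k τ => ∀ e : Fin I.m, e.val < k →
            τ.na 4 e 0 0 = if e ∈ O I.m r w then 1 else 0) h1' hmM (by simp) (by simp) (by simp)
            (fun k τ v h => by simpa using h) (by simp) fun e χ hG he hJ =>
              .seq (t := 1) (t' := 1) (.nload (.nstore ?_))) fun χ _ hJ e => hJ e e.2
          have h3χ : χ.n 3 = 0 := by rw [hG.n 3 (by simp), h3'']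
          have hna : χ.na 33 = φ.na 33 := hG.na 33 (by simp)
          intro e' he'
          simp only [Store.setN_n, he, h3χ, hna, Nat.reduceEqDiff, ↓reduceIte]
          by_cases hee : e' = e
          · subst hee
            simpa using hans e'
          · have : e'.val ≠ e.val := fun h => hee (Fin.ext h)
            simp only [Store.setNA_na, Store.setN_na, this, false_and, and_false, if_false]
            exact hJ e' (by omega)
  · have hle : c * (I.m + r.length + 1) ^ d
        ≤ c * (I.loopBound + requestBound dP I.loopBound + 1) ^ d :=
      Nat.mul_le_mul_left _ (Nat.pow_le_pow_left (by omega) _)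
    unfold subroutineTime
    omega

/-- Queries to the oracle are answered by a subroutine. -/
def subroutineSetting
    (hD : ∀ (m : ℕ) (r : List Bool) (w : Fin m → ℝ) (σ : Store),
      (P.actions m r).Nonempty → (∀ e, 0 ≤ w e) →
      σ.n 0 = m → σ.n 1 = r.length → (∀ k : Fin r.length, σ.na 0 k 0 0 = (r.get k).toNat) →
      (∀ e : Fin m, σ.ra 0 e 0 0 = w e) →
      ∃ σ' time bits, Exec bareEnv D σ σ' time bits ∧
        (∀ e : Fin m, σ'.na 1 e 0 0 = if e ∈ O m r w then 1 else 0) ∧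
        time ≤ c * (m + r.length + 1) ^ d ∧
        ∀ L, (∀ e, RationalOfLength L (w e)) → bits ≤ c * (m + r.length + L + 1) ^ d)
    (hP : ∀ m r, (P.actions m r).Nonempty → r.length ≤ dP * (m + 1) ^ dP)
    {X : Exponents} (I : Instance P X) : Setting I O where
  query := I.plainEnv.query
  rat := I.IsRational
  ℓ := subroutineLength dP c d I.lengthBound
  M := I.loopBound
  S := I.lengthBound
  ask := subroutineCmd D
  extra := I.RequestsLoaded
  tq := subroutineTime dP c d I.loopBound
  size_le := Nat.le_add_right _ _
  ceil_le := Nat.le_add_left _ _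
  M_le := Nat.le_add_right _ _
  le_ℓ := Nat.le_add_right _ _
  data := I.boundedData
  ask_n x hx := by
    have := Cmd.not_shift_writes (K := 32) (p := D) (l := .n x) (by simp [Loc.index]; omega)
    simp [subroutineCmd, this]
    omega
  ask_r x hx := by
    have := Cmd.not_shift_writes (K := 32) (p := D) (l := .r x) (by simp [Loc.index]; omega)
    simp [subroutineCmd, this]
    omega
  ask_na x hx hx4 := by
    have := Cmd.not_shift_writes (K := 32) (p := D) (l := .na x) (by simp [Loc.index]; omega)
    simp [subroutineCmd, this]
    omega
  ask_ra x hx := by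
    have := Cmd.not_shift_writes (K := 32) (p := D) (l := .ra x) (by simp [Loc.index]; omega)
    simp [subroutineCmd, this]
    omega
  extra_congr σ τ h1 h2 h := by
    unfold Instance.RequestsLoaded
    rw [h1, h2]
    exact h
  run_ask σ i t w hσ hreq h3 hi ht hw hw0 hb :=
    run_subroutineCmd hD hP I i t w hσ hreq h3 hi ht hw hw0 hb

end

/-- A strongly polynomial implementation of the oracle, used as a subroutine, makes the dynamics
strongly polynomial. -/
theorem exists_computes {P : Problem} {O : ActionProcedure}
    (h : P.StronglyPolynomialProcedure O) :
    ∃ (G : Cmd) (κ' : ℝ → ℕ) (d' : ℕ), P.Computes G (bayesABRD P O discount numRounds) κ' d' := by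
  obtain ⟨D, c, d, hD⟩ := h
  obtain ⟨dP, hP⟩ := P.succinct
  have hT : PolyBounded fun x => 3 * x ^ 6 * subroutineTime dP c d x + 300 * x ^ 8 :=
    (((PolyBounded.const 3).mul (PolyBounded.id.pow 6)).mul
      (polyBounded_subroutineTime dP c d)).add ((PolyBounded.const 300).mul (PolyBounded.id.pow 8))
  have hB : PolyBounded fun x => 3 * subroutineLength dP c d x + 3 :=
    ((PolyBounded.const 3).mul (polyBounded_subroutineLength dP c d)).add (.const 3)
  obtain ⟨C, k, hCk⟩ := hT.add hB
  refine ⟨mainCmd (subroutineCmd D), coefficient C k, k, fun X I σ hσ hreq => ?_⟩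
  obtain ⟨σ', t, b, h1, h2, h3, h4⟩ := (subroutineSetting hD hP I).run_mainCmd hσ hreq
  refine ⟨σ', t, b, h1, h4, ?_, fun L hL => ?_⟩
  · rw [coefficient, mul_assoc]
    exact (h2.trans ((Nat.le_add_right _ _).trans (hCk _ I.one_le_loopBound))).trans
      (Nat.mul_le_mul_left _ (I.loopBound_pow_le k))
  · rw [coefficient, mul_assoc]
    exact ((h3 ⟨L, hL⟩).trans ((Nat.le_add_left _ _).trans (hCk _ I.one_le_lengthBound))).trans
      (Nat.mul_le_mul_left _ (I.lengthBound_pow_le hL k))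

end BGND

end

theorem theorem2 :
    ∃ (η : ℝ → ℝ) (R : ℝ → ℕ → ℕ) (c : ℝ → ℝ) (F : BGND.Cmd) (κ : ℝ → ℕ) (d : ℕ),
      ∀ (P : BGND.Problem) (ρ : ℝ) (O : BGND.ActionProcedure), 1 ≤ ρ → P.IsActionOracle ρ O →
        (∀ (X : BGND.Exponents) (I : BGND.Instance P X),
          I.IsStrategy (BGND.bayesABRD P O η R X I)) ∧
        (∀ X : BGND.Exponents,
          P.bcr (BGND.bayesABRD P O η R) X ≤ ENNReal.ofReal (c X.max * ρ ^ X.max)) ∧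
        P.OracleComputes O F (BGND.bayesABRD P O η R) κ d ∧
        (P.StronglyPolynomialProcedure O →
          ∃ (G : BGND.Cmd) (κ' : ℝ → ℕ) (d' : ℕ),
            P.Computes G (BGND.bayesABRD P O η R) κ' d') := by
  refine ⟨BGND.discount, BGND.numRounds, BGND.ratioBound, BGND.mainCmd BGND.queryCmd,
    BGND.coefficient 306 8, 8, fun P ρ O hρ hO => ⟨?_, ?_, ?_, BGND.exists_computes⟩⟩
  · exact fun X I => I.isStrategy_bayesABRD hO _ _
  · exact fun X => P.bcr_bayesABRD_le hρ hO X
  · exact BGND.oracleComputes P O
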